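/- Let $(M^4,g)$ be a closed (compact, without boundary) oriented Riemannian 4-manifold, let $f:M\to\mathbb R$ be a smooth function, and let $\mathfrak s$ be a spin-c structure on $M$, with Hermitian rank-2 spinor bundles $W^{\pm}\to M$, Clifford multiplication satisfying $X\cdot Y\cdot+Y\cdot X\cdot=-2\langle X,Y\rangle\mathbb 1$, and determinant line bundle $L=\det W^{+}$, where $W^{+}$ is the $+1$-eigenbundle of the complex volume element $-e_1e_2e_3e_4$ ($e_i$ an oriented orthonormal frame). For a smooth unitary connection $A$ on $L$, let $F_A$ be its (imaginary-valued) curvature 2-form, $F_A^+$ its self-dual part, acting on $W^+$ by $\sum_{i<j}F_A^+(e_i,e_j)\,e_i\cdot e_j\cdot$, let $\nabla^A$ be the unitary connection on $W^+\oplus W^-$ that preserves $W^+$ and $W^-$, for which Clifford multiplication is parallel (with respect to the Levi-Civita connection on $TM$), and which induces $A$ on $L$, let $D_A=\sum_i e_i\cdot\nabla^A_{e_i}:\Gamma(W^+)\to\Gamma(W^-)$, and let $D_{A,f}=e^{f/2}D_Ae^{-f/2}$. Let $$\mathrm R_f=\mathrm R+2\Delta_f f+|\nabla f|^2,\qquad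 \Delta_f=\Delta-\nabla_{\nabla f},$$ be the weighted scalar curvature, where $\mathrm R$ is the scalar curvature and $\Delta=\operatorname{div}\nabla$. Let $A$ be a smooth unitary connection on $L$ and $\psi$ a smooth section of $W^+$ solving the weighted monopole equations $$F_A^+\cdot=e^{-f}\bigl(\psi\otimes\psi^*-\tfrac12|\psi|^2\mathbb 1\bigr),\qquad D_{A,f}\psi=0,$$ and suppose that $\psi$ is not identically zero. Then $$\max_M|\psi|^2\le-\min_M\bigl(\mathrm R_f\,e^{f}\bigr).$$ -/

import Mathlib

open Bundle Manifold Set Topology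
open scoped ContDiff

noncomputable section

/-! ### Riemannian geometry -/

section Riemannian

variable {E : Type*} [NormedAddCommGroup E] [NormedSpace ℝ E] [FiniteDimensional ℝ E]
  {H : Type*} [TopologicalSpace H] {I : ModelWithCorners ℝ E H}
  {M : Type*} [TopologicalSpace M] [ChartedSpace H M] [IsManifold I ∞ M]
  [RiemannianBundle (fun x : M ↦ TangentSpace I x)]
  [IsContMDiffRiemannianBundle I ∞ E (fun x : M ↦ TangentSpace I x)]

/-- The right-hand side of the Koszul formula for `2 ⟨∇_X Y, Z⟩` at the point `x`. -/
def koszul (X Y Z : Π x : M, TangentSpace I x) (x : M) : ℝ :=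
  mvfderiv I (fun y ↦ inner ℝ (Y y) (Z y)) x (X x)
    + mvfderiv I (fun y ↦ inner ℝ (Z y) (X y)) x (Y x)
    - mvfderiv I (fun y ↦ inner ℝ (X y) (Y y)) x (Z x)
    + inner ℝ (VectorField.mlieBracket I X Y x) (Z x)
    - inner ℝ (VectorField.mlieBracket I Y Z x) (X x)
    + inner ℝ (VectorField.mlieBracket I Z X x) (Y x)

theorem mdiffAt_inner_tangent {X Y : Π x : M, TangentSpace I x} {x : M}
    (hX : MDiffAt (T% X) x) (hY : MDiffAt (T% Y) x) :
    MDiffAt (fun y ↦ inner ℝ (X y) (Y y)) x :=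
  MDifferentiableAt.inner_bundle (IB := I) (F := E) (E := fun x : M ↦ TangentSpace I x) hX hY

theorem koszul_smul_left {X Y Z : Π x : M, TangentSpace I x} {x : M} {g : M → ℝ}
    (hg : MDiffAt g x) (hX : MDiffAt (T% X) x) (hY : MDiffAt (T% Y) x) (hZ : MDiffAt (T% Z) x) :
    koszul (g • X) Y Z x = g x * koszul X Y Z x := by
  have : CompleteSpace E := FiniteDimensional.complete ℝ E
  have h1 := mdiffAt_inner_tangent hZ hX
  have h2 := mdiffAt_inner_tangent hX hY
  simp only [koszul, Pi.smul_apply', real_inner_smul_left, real_inner_smul_right,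
    VectorField.mlieBracket_smul_left hg hX, VectorField.mlieBracket_smul_right hg hX,
    mvfderiv_fun_mul hg h1, mvfderiv_fun_mul hg h2, map_smul, smul_eq_mul, inner_add_left,
    add_apply, smul_apply, inner_neg_left, neg_smul]
  rw [real_inner_comm (Z x) (X x), real_inner_comm (Y x) (X x)]
  ring

theorem koszul_smul_mid {X Y Z : Π x : M, TangentSpace I x} {x : M} {g : M → ℝ}
    (hg : MDiffAt g x) (hX : MDiffAt (T% X) x) (hY : MDiffAt (T% Y) x) (hZ : MDiffAt (T% Z) x) :
    koszul X (g • Y) Z x =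
      g x * koszul X Y Z x + 2 * (mvfderiv I g x (X x) * inner ℝ (Y x) (Z x)) := by
  have : CompleteSpace E := FiniteDimensional.complete ℝ E
  have h1 := mdiffAt_inner_tangent hY hZ
  have h2 := mdiffAt_inner_tangent hX hY
  simp only [koszul, Pi.smul_apply', real_inner_smul_left, real_inner_smul_right,
    VectorField.mlieBracket_smul_left hg hY, VectorField.mlieBracket_smul_right hg hY,
    mvfderiv_fun_mul hg h1, mvfderiv_fun_mul hg h2, map_smul, smul_eq_mul, inner_add_left,
    add_apply, smul_apply, inner_neg_left, neg_smul]
  rw [real_inner_comm (Y x) (X x)]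
  ring

theorem koszul_smul_right {X Y Z : Π x : M, TangentSpace I x} {x : M} {g : M → ℝ}
    (hg : MDiffAt g x) (hX : MDiffAt (T% X) x) (hY : MDiffAt (T% Y) x) (hZ : MDiffAt (T% Z) x) :
    koszul X Y (g • Z) x = g x * koszul X Y Z x := by
  have : CompleteSpace E := FiniteDimensional.complete ℝ E
  have h1 := mdiffAt_inner_tangent hY hZ
  have h2 := mdiffAt_inner_tangent hZ hX
  simp only [koszul, Pi.smul_apply', real_inner_smul_left, real_inner_smul_right,
    VectorField.mlieBracket_smul_left hg hZ, VectorField.mlieBracket_smul_right hg hZ,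
    mvfderiv_fun_mul hg h1, mvfderiv_fun_mul hg h2, map_smul, smul_eq_mul, inner_add_left,
    add_apply, smul_apply, inner_neg_left, neg_smul]
  rw [real_inner_comm (Z x) (Y x)]
  ring

theorem koszul_add_left {X X' Y Z : Π x : M, TangentSpace I x} {x : M}
    (hX : MDiffAt (T% X) x) (hX' : MDiffAt (T% X') x) (hY : MDiffAt (T% Y) x)
    (hZ : MDiffAt (T% Z) x) :
    koszul (X + X') Y Z x = koszul X Y Z x + koszul X' Y Z x := by
  have : CompleteSpace E := FiniteDimensional.complete ℝ E
  simp only [koszul, Pi.add_apply, inner_add_left, inner_add_right,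
    VectorField.mlieBracket_add_left hX hX', VectorField.mlieBracket_add_right hX hX',
    mvfderiv_fun_add (mdiffAt_inner_tangent hZ hX) (mdiffAt_inner_tangent hZ hX'),
    mvfderiv_fun_add (mdiffAt_inner_tangent hX hY) (mdiffAt_inner_tangent hX' hY), map_add,
    add_apply]
  ring

theorem koszul_add_mid {X Y Y' Z : Π x : M, TangentSpace I x} {x : M}
    (hX : MDiffAt (T% X) x) (hY : MDiffAt (T% Y) x) (hY' : MDiffAt (T% Y') x)
    (hZ : MDiffAt (T% Z) x) :
    koszul X (Y + Y') Z x = koszul X Y Z x + koszul X Y' Z x := by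
  have : CompleteSpace E := FiniteDimensional.complete ℝ E
  simp only [koszul, Pi.add_apply, inner_add_left, inner_add_right,
    VectorField.mlieBracket_add_left hY hY', VectorField.mlieBracket_add_right hY hY',
    mvfderiv_fun_add (mdiffAt_inner_tangent hY hZ) (mdiffAt_inner_tangent hY' hZ),
    mvfderiv_fun_add (mdiffAt_inner_tangent hX hY) (mdiffAt_inner_tangent hX hY'), map_add,
    add_apply]
  ring

theorem koszul_add_right {X Y Z Z' : Π x : M, TangentSpace I x} {x : M}
    (hX : MDiffAt (T% X) x) (hY : MDiffAt (T% Y) x) (hZ : MDiffAt (T% Z) x)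
    (hZ' : MDiffAt (T% Z') x) :
    koszul X Y (Z + Z') x = koszul X Y Z x + koszul X Y Z' x := by
  have : CompleteSpace E := FiniteDimensional.complete ℝ E
  simp only [koszul, Pi.add_apply, inner_add_left, inner_add_right,
    VectorField.mlieBracket_add_left hZ hZ', VectorField.mlieBracket_add_right hZ hZ',
    mvfderiv_fun_add (mdiffAt_inner_tangent hY hZ) (mdiffAt_inner_tangent hY hZ'),
    mvfderiv_fun_add (mdiffAt_inner_tangent hZ hX) (mdiffAt_inner_tangent hZ' hX), map_add,
    add_apply]
  ring

theorem koszul_tensorial_left {Y Z : Π x : M, TangentSpace I x} {x : M}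
    (hY : MDiffAt (T% Y) x) (hZ : MDiffAt (T% Z) x) :
    TensorialAt I E (fun X : Π x : M, TangentSpace I x ↦ koszul X Y Z x) x where
  smul hg hX := koszul_smul_left hg hX hY hZ
  add hX hX' := koszul_add_left hX hX' hY hZ

theorem koszul_tensorial_right {X Y : Π x : M, TangentSpace I x} {x : M}
    (hX : MDiffAt (T% X) x) (hY : MDiffAt (T% Y) x) :
    TensorialAt I E (fun Z : Π x : M, TangentSpace I x ↦ koszul X Y Z x) x where
  smul hg hZ := koszul_smul_right hg hX hY hZ
  add hZ hZ' := koszul_add_right hX hY hZ hZ'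

/-- For `Y` differentiable at `x`, the bilinear form `(X, Z) ↦ 2 ⟨∇_X Y, Z⟩` on `T_x M`. -/
def koszulForm (Y : Π x : M, TangentSpace I x) (x : M) (hY : MDiffAt (T% Y) x) :
    TangentSpace I x →L[ℝ] TangentSpace I x →L[ℝ] ℝ :=
  TensorialAt.mkHom₂ (fun X Z ↦ koszul X Y Z x) x
    (fun _ hZ ↦ koszul_tensorial_left hY hZ) (fun _ hX ↦ koszul_tensorial_right hX hY)

instance instFiniteDimensionalTangentSpace (x : M) : FiniteDimensional ℝ (TangentSpace I x) :=
  inferInstanceAs (FiniteDimensional ℝ E)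

instance instCompleteSpaceTangentSpace (x : M) : CompleteSpace (TangentSpace I x) :=
  FiniteDimensional.complete ℝ _

open Classical in
/-- The covariant derivative of the Levi-Civita connection, given by the Koszul formula (and by
the junk value `0` at the points where the vector field is not differentiable). -/
def leviCivitaFun (Y : Π x : M, TangentSpace I x) (x : M) :
    TangentSpace I x →L[ℝ] TangentSpace I x :=
  if hY : MDiffAt (T% Y) x then
    LinearMap.toContinuousLinearMap
      ((InnerProductSpace.toDual ℝ (TangentSpace I x)).symm.toLinearEquiv.toLinearMap ∘ₗ
        ((1 / 2 : ℝ) • koszulForm Y x hY).toLinearMap)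
  else 0

theorem inner_leviCivitaFun {X Y Z : Π x : M, TangentSpace I x} {x : M}
    (hX : MDiffAt (T% X) x) (hY : MDiffAt (T% Y) x) (hZ : MDiffAt (T% Z) x) :
    inner ℝ (leviCivitaFun Y x (X x)) (Z x) = 1 / 2 * koszul X Y Z x := by
  have h : koszulForm Y x hY (X x) (Z x) = koszul X Y Z x :=
    TensorialAt.mkHom₂_apply (Φ := fun X Z ↦ koszul X Y Z x) _ _ hX hZ
  rw [leviCivitaFun, dif_pos hY]
  have h' := InnerProductSpace.toDual_symm_apply (𝕜 := ℝ) (E := TangentSpace I x) (x := Z x)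
    (y := koszulForm Y x hY (X x))
  simp [real_inner_smul_left, h', h]

theorem leviCivitaFun_ext {x : M} {S T : TangentSpace I x →L[ℝ] TangentSpace I x}
    (h : ∀ X Z : Π x : M, TangentSpace I x, MDiffAt (T% X) x → MDiffAt (T% Z) x →
      inner ℝ (S (X x)) (Z x) = inner ℝ (T (X x)) (Z x)) : S = T := by
  ext u
  refine ext_inner_right ℝ fun w ↦ ?_
  simpa using h (FiberBundle.extend E u) (FiberBundle.extend E w)
    (FiberBundle.mdifferentiableAt_extend ..) (FiberBundle.mdifferentiableAt_extend ..)

variable (I M) in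
/-- The Levi-Civita connection of a Riemannian manifold. -/
def leviCivita : CovariantDerivative I E (fun x : M ↦ TangentSpace I x) where
  toFun := leviCivitaFun
  isCovariantDerivativeOnUniv :=
    { add := by
        intro Y Y' x hY hY' _
        refine leviCivitaFun_ext fun X Z hX hZ ↦ ?_
        rw [inner_leviCivitaFun hX (mdifferentiableAt_add_section hY hY') hZ,
          koszul_add_mid hX hY hY' hZ, add_apply, inner_add_left,
          inner_leviCivitaFun hX hY hZ, inner_leviCivitaFun hX hY' hZ]
        ring
      leibniz := by
        intro Y g x hY hg _
        refine leviCivitaFun_ext fun X Z hX hZ ↦ ?_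
        rw [inner_leviCivitaFun hX (hg.smul_section hY) hZ, koszul_smul_mid hg hX hY hZ]
        simp only [add_apply, smul_apply, inner_add_left,
          real_inner_smul_left, inner_leviCivitaFun hX hY hZ,
          ContinuousLinearMap.smulRight_apply]
        ring }


theorem leviCivita_torsion {X Y : Π x : M, TangentSpace I x} {x : M}
    (hX : MDiffAt (T% X) x) (hY : MDiffAt (T% Y) x) :
    leviCivita I M Y x (X x) - leviCivita I M X x (Y x) = VectorField.mlieBracket I X Y x := by
  refine ext_inner_right ℝ fun w ↦ ?_
  have hZ : MDiffAt (T% (FiberBundle.extend E w : Π x : M, TangentSpace I x)) x :=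
    FiberBundle.mdifferentiableAt_extend ..
  have h1 := inner_leviCivitaFun hX hY hZ
  have h2 := inner_leviCivitaFun hY hX hZ
  simp only [FiberBundle.extend_apply_self] at h1 h2
  change inner ℝ (leviCivitaFun Y x (X x) - leviCivitaFun X x (Y x)) w = _
  rw [inner_sub_left, h1, h2]
  simp only [koszul]
  rw [VectorField.mlieBracket_swap (V := Y) (W := X),
    VectorField.mlieBracket_swap (V := FiberBundle.extend E w) (W := X),
    VectorField.mlieBracket_swap (V := FiberBundle.extend E w) (W := Y)]
  simp only [Pi.neg_apply, inner_neg_left, FiberBundle.extend_apply_self]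
  simp only [funext fun y ↦ real_inner_comm (X y) (Y y),
    funext fun y ↦ real_inner_comm (X y) (FiberBundle.extend E w y),
    funext fun y ↦ real_inner_comm (Y y) (FiberBundle.extend E w y)]
  ring

theorem leviCivita_metric {X Y Z : Π x : M, TangentSpace I x} {x : M}
    (hX : MDiffAt (T% X) x) (hY : MDiffAt (T% Y) x) (hZ : MDiffAt (T% Z) x) :
    mvfderiv I (fun y ↦ inner ℝ (Y y) (Z y)) x (X x) =
      inner ℝ (leviCivita I M Y x (X x)) (Z x) + inner ℝ (Y x) (leviCivita I M Z x (X x)) := by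
  have h1 := inner_leviCivitaFun hX hY hZ
  have h2 := inner_leviCivitaFun hX hZ hY
  change _ = inner ℝ (leviCivitaFun Y x (X x)) (Z x) + inner ℝ (Y x) (leviCivitaFun Z x (X x))
  rw [real_inner_comm _ (Y x), h1, h2]
  simp only [koszul]
  rw [VectorField.mlieBracket_swap (V := Z) (W := Y),
    VectorField.mlieBracket_swap (V := Y) (W := X), VectorField.mlieBracket_swap (V := Z) (W := X)]
  simp only [Pi.neg_apply, inner_neg_left, funext fun y ↦ real_inner_comm (Y y) (X y),
    funext fun y ↦ real_inner_comm (Z y) (X y), funext fun y ↦ real_inner_comm (Z y) (Y y)]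
  ring

/-- The curvature `R(u, v) s = ∇_u ∇_v s - ∇_v ∇_u s - ∇_{[u, v]} s` of a connection on a vector
bundle, computed with extensions of `u`, `v`, `s` to sections that are smooth near `x`. -/
def curvature {F : Type*} [NormedAddCommGroup F] [NormedSpace ℝ F] {V : M → Type*}
    [TopologicalSpace (TotalSpace F V)] [∀ x, AddCommGroup (V x)] [∀ x, Module ℝ (V x)]
    [∀ x, TopologicalSpace (V x)] [∀ x, IsTopologicalAddGroup (V x)]
    [∀ x, ContinuousSMul ℝ (V x)] [FiberBundle F V]
    (cov : CovariantDerivative I F V) (x : M) (u v : TangentSpace I x) (s : V x) : V x :=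
  let X : Π y : M, TangentSpace I y := FiberBundle.extend E u
  let Y : Π y : M, TangentSpace I y := FiberBundle.extend E v
  let σ : Π y : M, V y := FiberBundle.extend F s
  cov (fun y ↦ cov σ y (Y y)) x u - cov (fun y ↦ cov σ y (X y)) x v
    - cov σ x (VectorField.mlieBracket I X Y x)

variable (I) in
/-- The scalar curvature. -/
def scalarCurvature (x : M) : ℝ :=
  let e := stdOrthonormalBasis ℝ (TangentSpace I x)
  ∑ i, ∑ j, inner ℝ (curvature (leviCivita I M) x (e i) (e j) (e j)) (e i)

variable (I) in
/-- The gradient of a function. -/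
def riemannianGradient (u : M → ℝ) (x : M) : TangentSpace I x :=
  (InnerProductSpace.toDual ℝ (TangentSpace I x)).symm (mvfderiv I u x)

variable (I) in
/-- The Laplace-Beltrami operator `Δ u = div (∇ u)`. -/
def laplaceBeltrami (u : M → ℝ) (x : M) : ℝ :=
  let e := stdOrthonormalBasis ℝ (TangentSpace I x)
  ∑ i, inner ℝ (leviCivita I M (riemannianGradient I u) x (e i)) (e i)

variable (I) in
/-- The weighted Laplacian `Δ_f u = Δ u - ⟨∇ f, ∇ u⟩`. -/
def weightedLaplacian (f u : M → ℝ) (x : M) : ℝ :=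
  laplaceBeltrami I u x - inner ℝ (riemannianGradient I f x) (riemannianGradient I u x)

variable (I) in
/-- Perelman's weighted scalar curvature `R_f = R + 2 Δ_f f + |∇ f|²`. -/
def weightedScalarCurvature (f : M → ℝ) (x : M) : ℝ :=
  scalarCurvature I x + 2 * weightedLaplacian I f f x + ‖riemannianGradient I f x‖ ^ 2

end Riemannian

/-! ### Spin-c structures on oriented Riemannian 4-manifolds -/

section Spinc

variable {M : Type*} [TopologicalSpace M] [ChartedSpace (EuclideanSpace ℝ (Fin 4)) M]
  [IsManifold (𝓡 4) ∞ M]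

variable (M) in
/-- An orientation of a 4-manifold: an orientation of every tangent space which, near every point,
is the one given by some smooth local frame. -/
structure ManifoldOrientation where
  /-- The orientation of the tangent space at a point. -/
  at_ (x : M) : Orientation ℝ (TangentSpace (𝓡 4) x) (Fin 4)
  exists_frame (x₀ : M) : ∃ X : Fin 4 → Π x : M, TangentSpace (𝓡 4) x,
    (∀ i, ContMDiffAt (𝓡 4) ((𝓡 4).prod 𝓘(ℝ, EuclideanSpace ℝ (Fin 4))) ∞
      (fun x ↦ TotalSpace.mk' (EuclideanSpace ℝ (Fin 4)) x (X i x)) x₀) ∧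
    ∀ᶠ x in 𝓝 x₀, ∃ b : Module.Basis (Fin 4) ℝ (TangentSpace (𝓡 4) x),
      (∀ i, b i = X i x) ∧ b.orientation = at_ x

instance instFactFinrankTangentSpace (x : M) :
    Fact (Module.finrank ℝ (TangentSpace (𝓡 4) x) = 4) :=
  ⟨finrank_euclideanSpace_fin (𝕜 := ℝ) (n := 4)⟩

variable [RiemannianBundle (fun x : M ↦ TangentSpace (𝓡 4) x)]
  [IsContMDiffRiemannianBundle (𝓡 4) ∞ (EuclideanSpace ℝ (Fin 4))
    (fun x : M ↦ TangentSpace (𝓡 4) x)]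

/-- The Hodge star of a complex-valued 2-form at a point:
`(⋆α)(u, v) = ½ ∑ α(eᵢ, eⱼ) vol(eᵢ, eⱼ, u, v)`, so that `⋆(e¹ ∧ e²) = e³ ∧ e⁴`. -/
def hodgeStarTwoForm (o : ManifoldOrientation M) (x : M)
    (α : TangentSpace (𝓡 4) x → TangentSpace (𝓡 4) x → ℂ) (u v : TangentSpace (𝓡 4) x) : ℂ :=
  let e := stdOrthonormalBasis ℝ (TangentSpace (𝓡 4) x)
  1 / 2 * ∑ i, ∑ j, α (e i) (e j) * ((o.at_ x).volumeForm ![e i, e j, u, v] : ℝ)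

/-- The self-dual part `½ (α + ⋆α)` of a complex-valued 2-form at a point. -/
def selfDualPart (o : ManifoldOrientation M) (x : M)
    (α : TangentSpace (𝓡 4) x → TangentSpace (𝓡 4) x → ℂ) (u v : TangentSpace (𝓡 4) x) : ℂ :=
  1 / 2 * (α u v + hodgeStarTwoForm o x α u v)

/-- The Hermitian inner product on the fibers of a complex vector bundle over `M` depends smoothly
on the base point. -/
class IsSmoothHermitianBundle (F : Type*) [NormedAddCommGroup F] [NormedSpace ℝ F]
    (V : M → Type*) [TopologicalSpace (TotalSpace F V)] [∀ x, NormedAddCommGroup (V x)]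
    [∀ x, InnerProductSpace ℂ (V x)] [FiberBundle F V] [VectorBundle ℝ F V] : Prop where
  exists_contMDiff : ∃ h : Π x : M, V x →L[ℝ] V x →L[ℝ] ℂ,
    ContMDiff (𝓡 4) ((𝓡 4).prod 𝓘(ℝ, F →L[ℝ] F →L[ℝ] ℂ)) ∞
      (fun x ↦ TotalSpace.mk' (F →L[ℝ] F →L[ℝ] ℂ) x (h x)) ∧
    ∀ (x : M) (v w : V x), h x v w = inner ℂ v w

/-- A smooth unitary connection on a Hermitian vector bundle over `M`: a smooth connection on the
underlying real vector bundle that is complex-linear and compatible with the Hermitian metric. -/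
structure IsUnitaryConnection {F : Type*} [NormedAddCommGroup F] [NormedSpace ℝ F]
    {V : M → Type*} [TopologicalSpace (TotalSpace F V)] [∀ x, NormedAddCommGroup (V x)]
    [∀ x, InnerProductSpace ℂ (V x)] [FiberBundle F V] [VectorBundle ℝ F V]
    (cov : CovariantDerivative (𝓡 4) F V) : Prop where
  contMDiff : cov.ContMDiffCovariantDerivative ∞
  smul_I {σ : Π x : M, V x} {x : M}
    (hσ : MDifferentiableAt (𝓡 4) ((𝓡 4).prod 𝓘(ℝ, F)) (fun y ↦ TotalSpace.mk' F y (σ y)) x)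
    (v : TangentSpace (𝓡 4) x) :
    cov (fun y ↦ Complex.I • σ y) x v = Complex.I • cov σ x v
  metric {σ τ : Π x : M, V x} {x : M}
    (hσ : MDifferentiableAt (𝓡 4) ((𝓡 4).prod 𝓘(ℝ, F)) (fun y ↦ TotalSpace.mk' F y (σ y)) x)
    (hτ : MDifferentiableAt (𝓡 4) ((𝓡 4).prod 𝓘(ℝ, F)) (fun y ↦ TotalSpace.mk' F y (τ y)) x)
    (v : TangentSpace (𝓡 4) x) :
    mvfderiv (𝓡 4) (fun y ↦ inner ℂ (σ y) (τ y)) x v =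
      inner ℂ (cov σ x v) (τ x) + inner ℂ (σ x) (cov τ x v)

/-! From now on, `Wp`, `Wm` are smooth Hermitian vector bundles of complex rank 2 and `L` is a
smooth Hermitian line bundle: the local trivializations are complex-linear, and the transition
functions are smooth. -/

variable
  {Wp : M → Type*} [TopologicalSpace (TotalSpace (EuclideanSpace ℂ (Fin 2)) Wp)]
  [∀ x, NormedAddCommGroup (Wp x)] [∀ x, InnerProductSpace ℂ (Wp x)]
  [FiberBundle (EuclideanSpace ℂ (Fin 2)) Wp] [VectorBundle ℂ (EuclideanSpace ℂ (Fin 2)) Wp]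
  [VectorBundle ℝ (EuclideanSpace ℂ (Fin 2)) Wp]
  [ContMDiffVectorBundle ∞ (EuclideanSpace ℂ (Fin 2)) Wp (𝓡 4)]
  [IsSmoothHermitianBundle (EuclideanSpace ℂ (Fin 2)) Wp]
  {Wm : M → Type*} [TopologicalSpace (TotalSpace (EuclideanSpace ℂ (Fin 2)) Wm)]
  [∀ x, NormedAddCommGroup (Wm x)] [∀ x, InnerProductSpace ℂ (Wm x)]
  [FiberBundle (EuclideanSpace ℂ (Fin 2)) Wm] [VectorBundle ℂ (EuclideanSpace ℂ (Fin 2)) Wm]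
  [VectorBundle ℝ (EuclideanSpace ℂ (Fin 2)) Wm]
  [ContMDiffVectorBundle ∞ (EuclideanSpace ℂ (Fin 2)) Wm (𝓡 4)]
  [IsSmoothHermitianBundle (EuclideanSpace ℂ (Fin 2)) Wm]
  {L : M → Type*} [TopologicalSpace (TotalSpace ℂ L)]
  [∀ x, NormedAddCommGroup (L x)] [∀ x, InnerProductSpace ℂ (L x)]
  [FiberBundle ℂ L] [VectorBundle ℂ ℂ L] [VectorBundle ℝ ℂ L]
  [ContMDiffVectorBundle ∞ ℂ L (𝓡 4)] [IsSmoothHermitianBundle ℂ L]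

variable (Wp Wm L) in
/-- A spin-c structure on an oriented Riemannian 4-manifold, with spinor bundles `W⁺`, `W⁻` and
determinant line bundle `L`: Clifford multiplication by tangent vectors on `W⁺ ⊕ W⁻`, and an
isometry of `L` with `det W⁺ = Λ² W⁺`. -/
structure SpincStructure (o : ManifoldOrientation M) where
  /-- Clifford multiplication `TM ⊗ W⁺ → W⁻`. -/
  cp (x : M) : TangentSpace (𝓡 4) x →L[ℝ] Wp x →L[ℝ] Wm x
  /-- Clifford multiplication `TM ⊗ W⁻ → W⁺`. -/
  cm (x : M) : TangentSpace (𝓡 4) x →L[ℝ] Wm x →L[ℝ] Wp x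
  cp_smul (x : M) (v : TangentSpace (𝓡 4) x) (z : ℂ) (φ : Wp x) : cp x v (z • φ) = z • cp x v φ
  cm_smul (x : M) (v : TangentSpace (𝓡 4) x) (z : ℂ) (χ : Wm x) : cm x v (z • χ) = z • cm x v χ
  contMDiff_cp : ContMDiff (𝓡 4) ((𝓡 4).prod 𝓘(ℝ, EuclideanSpace ℝ (Fin 4) →L[ℝ]
    EuclideanSpace ℂ (Fin 2) →L[ℝ] EuclideanSpace ℂ (Fin 2))) ∞
    (fun x ↦ TotalSpace.mk' (EuclideanSpace ℝ (Fin 4) →L[ℝ]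
      EuclideanSpace ℂ (Fin 2) →L[ℝ] EuclideanSpace ℂ (Fin 2)) x (cp x))
  contMDiff_cm : ContMDiff (𝓡 4) ((𝓡 4).prod 𝓘(ℝ, EuclideanSpace ℝ (Fin 4) →L[ℝ]
    EuclideanSpace ℂ (Fin 2) →L[ℝ] EuclideanSpace ℂ (Fin 2))) ∞
    (fun x ↦ TotalSpace.mk' (EuclideanSpace ℝ (Fin 4) →L[ℝ]
      EuclideanSpace ℂ (Fin 2) →L[ℝ] EuclideanSpace ℂ (Fin 2)) x (cm x))
  /-- The Clifford identity `u · v · + v · u · = -2 ⟨u, v⟩` on `W⁺`. -/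
  clifford_p (x : M) (u v : TangentSpace (𝓡 4) x) (φ : Wp x) :
    cm x u (cp x v φ) + cm x v (cp x u φ) = (-2 * inner ℝ u v : ℝ) • φ
  /-- The Clifford identity on `W⁻`. -/
  clifford_m (x : M) (u v : TangentSpace (𝓡 4) x) (χ : Wm x) :
    cp x u (cm x v χ) + cp x v (cm x u χ) = (-2 * inner ℝ u v : ℝ) • χ
  /-- Clifford multiplication by unit vectors is unitary. -/
  norm_cp (x : M) (u : TangentSpace (𝓡 4) x) (hu : ‖u‖ = 1) (φ : Wp x) : ‖cp x u φ‖ = ‖φ‖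
  norm_cm (x : M) (u : TangentSpace (𝓡 4) x) (hu : ‖u‖ = 1) (χ : Wm x) : ‖cm x u χ‖ = ‖χ‖
  /-- `W⁺` and `W⁻` are the eigenbundles, for the eigenvalues `1` and `-1`, of the complex volume
  element `-e₁ e₂ e₃ e₄`, where `e` is an oriented orthonormal basis. -/
  chirality_p (x : M) (e : OrthonormalBasis (Fin 4) ℝ (TangentSpace (𝓡 4) x))
    (he : e.toBasis.orientation = o.at_ x) (φ : Wp x) :
    -(cm x (e 0) (cp x (e 1) (cm x (e 2) (cp x (e 3) φ)))) = φ
  chirality_m (x : M) (e : OrthonormalBasis (Fin 4) ℝ (TangentSpace (𝓡 4) x))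
    (he : e.toBasis.orientation = o.at_ x) (χ : Wm x) :
    -(cp x (e 0) (cm x (e 1) (cp x (e 2) (cm x (e 3) χ)))) = -χ
  /-- The identification of `Λ² W⁺` with `L`, as an alternating map `W⁺ × W⁺ → L`. -/
  det (x : M) : Wp x →L[ℝ] Wp x →L[ℝ] L x
  det_smul (x : M) (z : ℂ) (φ χ : Wp x) : det x (z • φ) χ = z • det x φ χ
  det_self (x : M) (φ : Wp x) : det x φ φ = 0
  norm_det (x : M) (φ χ : Wp x) :
    ‖det x φ χ‖ ^ 2 = ‖φ‖ ^ 2 * ‖χ‖ ^ 2 - ‖(inner ℂ φ χ : ℂ)‖ ^ 2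
  contMDiff_det : ContMDiff (𝓡 4) ((𝓡 4).prod 𝓘(ℝ, EuclideanSpace ℂ (Fin 2) →L[ℝ]
    EuclideanSpace ℂ (Fin 2) →L[ℝ] ℂ)) ∞
    (fun x ↦ TotalSpace.mk' (EuclideanSpace ℂ (Fin 2) →L[ℝ]
      EuclideanSpace ℂ (Fin 2) →L[ℝ] ℂ) x (det x))

/-- The curvature form `F_A` of a connection `A` on the line bundle `L`: the complex-valued
2-form (purely imaginary when `A` is unitary) such that the curvature of `A` is multiplication by
`F_A`, computed with a unit vector of the fiber. -/
def curvatureForm (A : CovariantDerivative (𝓡 4) ℂ L) (x : M) (u v : TangentSpace (𝓡 4) x) : ℂ :=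
  haveI : FiniteDimensional ℂ (L x) := VectorBundle.finiteDimensional ℂ ℂ L x
  let s := stdOrthonormalBasis ℂ (L x)
  ∑ i, inner ℂ (s i) (curvature A x u v (s i))

namespace SpincStructure

variable {o : ManifoldOrientation M} (S : SpincStructure Wp Wm L o)

/-- The pair of connections `(∇⁺, ∇⁻)` on `W⁺`, `W⁻` is the unitary connection `∇^A` determined by
the unitary connection `A` on `L`: it is unitary, Clifford multiplication is parallel for it and
the Levi-Civita connection, and it induces `A` on `L = det W⁺`. -/
structure IsSpinConnection (A : CovariantDerivative (𝓡 4) ℂ L)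
    (covp : CovariantDerivative (𝓡 4) (EuclideanSpace ℂ (Fin 2)) Wp)
    (covm : CovariantDerivative (𝓡 4) (EuclideanSpace ℂ (Fin 2)) Wm) : Prop where
  unitary_p : IsUnitaryConnection covp
  unitary_m : IsUnitaryConnection covm
  clifford_p {Y : Π x : M, TangentSpace (𝓡 4) x} {φ : Π x : M, Wp x} {x : M}
    (hY : MDifferentiableAt (𝓡 4) ((𝓡 4).prod 𝓘(ℝ, EuclideanSpace ℝ (Fin 4)))
      (fun y ↦ TotalSpace.mk' (EuclideanSpace ℝ (Fin 4)) y (Y y)) x)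
    (hφ : MDifferentiableAt (𝓡 4) ((𝓡 4).prod 𝓘(ℝ, EuclideanSpace ℂ (Fin 2)))
      (fun y ↦ TotalSpace.mk' (EuclideanSpace ℂ (Fin 2)) y (φ y)) x)
    (v : TangentSpace (𝓡 4) x) :
    covm (fun y ↦ S.cp y (Y y) (φ y)) x v =
      S.cp x (leviCivita (𝓡 4) M Y x v) (φ x) + S.cp x (Y x) (covp φ x v)
  clifford_m {Y : Π x : M, TangentSpace (𝓡 4) x} {χ : Π x : M, Wm x} {x : M}
    (hY : MDifferentiableAt (𝓡 4) ((𝓡 4).prod 𝓘(ℝ, EuclideanSpace ℝ (Fin 4)))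
      (fun y ↦ TotalSpace.mk' (EuclideanSpace ℝ (Fin 4)) y (Y y)) x)
    (hχ : MDifferentiableAt (𝓡 4) ((𝓡 4).prod 𝓘(ℝ, EuclideanSpace ℂ (Fin 2)))
      (fun y ↦ TotalSpace.mk' (EuclideanSpace ℂ (Fin 2)) y (χ y)) x)
    (v : TangentSpace (𝓡 4) x) :
    covp (fun y ↦ S.cm y (Y y) (χ y)) x v =
      S.cm x (leviCivita (𝓡 4) M Y x v) (χ x) + S.cm x (Y x) (covm χ x v)
  det {φ χ : Π x : M, Wp x} {x : M}
    (hφ : MDifferentiableAt (𝓡 4) ((𝓡 4).prod 𝓘(ℝ, EuclideanSpace ℂ (Fin 2)))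
      (fun y ↦ TotalSpace.mk' (EuclideanSpace ℂ (Fin 2)) y (φ y)) x)
    (hχ : MDifferentiableAt (𝓡 4) ((𝓡 4).prod 𝓘(ℝ, EuclideanSpace ℂ (Fin 2)))
      (fun y ↦ TotalSpace.mk' (EuclideanSpace ℂ (Fin 2)) y (χ y)) x)
    (v : TangentSpace (𝓡 4) x) :
    A (fun y ↦ S.det y (φ y) (χ y)) x v =
      S.det x (covp φ x v) (χ x) + S.det x (φ x) (covp χ x v)

/-- The spin-c Dirac operator `D_A φ = ∑ eᵢ · ∇^A_{eᵢ} φ` from sections of `W⁺` to sections of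
`W⁻`, in terms of the connection `∇^A` on `W⁺`. -/
def dirac (covp : CovariantDerivative (𝓡 4) (EuclideanSpace ℂ (Fin 2)) Wp)
    (φ : Π x : M, Wp x) (x : M) : Wm x :=
  let e := stdOrthonormalBasis ℝ (TangentSpace (𝓡 4) x)
  ∑ i, S.cp x (e i) (covp φ x (e i))

/-- The weighted spin-c Dirac operator `D_{A,f} = e^{f/2} D_A e^{-f/2}`. -/
def weightedDirac (f : M → ℝ) (covp : CovariantDerivative (𝓡 4) (EuclideanSpace ℂ (Fin 2)) Wp)
    (ψ : Π x : M, Wp x) (x : M) : Wm x :=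
  Real.exp (f x / 2) • S.dirac covp (fun y ↦ Real.exp (-(f y / 2)) • ψ y) x

/-- The Clifford action `∑_{i<j} α(eᵢ, eⱼ) eᵢ · eⱼ ·` of a complex-valued 2-form on `W⁺`. -/
def cliffordTwoForm (x : M) (α : TangentSpace (𝓡 4) x → TangentSpace (𝓡 4) x → ℂ) (φ : Wp x) :
    Wp x :=
  let e := stdOrthonormalBasis ℝ (TangentSpace (𝓡 4) x)
  ∑ i, ∑ j ∈ Finset.Ioi i, α (e i) (e j) • S.cm x (e i) (S.cp x (e j) φ)

/-- `(A, ψ)` solves the weighted monopole equations `F_A⁺ · = e^{-f} (ψ ⊗ ψ*)°`, `D_{A,f} ψ = 0`,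
where `(ψ ⊗ ψ*)° = ψ ⊗ ψ* - ½ |ψ|²` and `(∇⁺, ∇⁻) = ∇^A` is the connection determined by `A`. -/
structure IsWeightedMonopole (f : M → ℝ) (A : CovariantDerivative (𝓡 4) ℂ L)
    (covp : CovariantDerivative (𝓡 4) (EuclideanSpace ℂ (Fin 2)) Wp)
    (covm : CovariantDerivative (𝓡 4) (EuclideanSpace ℂ (Fin 2)) Wm)
    (ψ : Π x : M, Wp x) : Prop where
  unitary : IsUnitaryConnection A
  spinConnection : S.IsSpinConnection A covp covm
  contMDiff : ContMDiff (𝓡 4) ((𝓡 4).prod 𝓘(ℝ, EuclideanSpace ℂ (Fin 2))) ∞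
    (fun x ↦ TotalSpace.mk' (EuclideanSpace ℂ (Fin 2)) x (ψ x))
  curvature_eq (x : M) (φ : Wp x) :
    S.cliffordTwoForm x (selfDualPart o x (curvatureForm A x)) φ =
      Real.exp (-f x) • ((inner ℂ (ψ x) φ : ℂ) • ψ x - ((1 / 2 : ℝ) * ‖ψ x‖ ^ 2) • φ)
  dirac_eq (x : M) : S.weightedDirac f covp ψ x = 0

end SpincStructure

end Spinc
end

/-! Put φ = e^{-f/2} ψ. The Dirac equation becomes D_A φ = 0. The curvature equation gives F_A⁺·φ =
½|φ|² φ, because ψ is an eigenvector of ψ ⊗ ψ* - ½|ψ|² with eigenvalue ½|ψ|², and e^{-f}|ψ|² = |φ|².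
So φ solves unweighted equations, and the ordinary Weitzenböck formula says that the trace of ∇²φ is
¼(|φ|² + R) φ. Pairing with φ gives Δ|φ|² = ½(|φ|² + R)|φ|² + 2|∇φ|².

The weight comes back through the choice of point: a maximum of |ψ|², not of |φ|². Write w = |φ|² =
e^{-f}|ψ|². Where |ψ|² is maximal its differential vanishes and its Hessian is nonpositive, hence dw
= -w df and Δw ≤ w(|∇f|² - Δf). The first relation and Cauchy–Schwarz (a Kato inequality) give
w|∇f|² ≤ 4|∇φ|². Inserting both in the Bochner identity and cancelling w > 0 yields w ≤ -(R + 2Δf -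
|∇f|²) = -R_f. Multiplying by e^f bounds |ψ|² at that point by -R_f e^f, hence by minus the minimum.
This is `IsWeightedMonopole.norm_sq_le`.

Most of the work is the Weitzenböck formula, `sum_secondCovariantDerivative`. Its analytic half
differentiates D_A φ = 0 and uses the Clifford relations to express the trace of ∇²φ through ∑ eᵢ eⱼ
K(eᵢ, eⱼ) φ, with K the curvature of W⁺. Its algebraic half computes K. Since Clifford
multiplication and the determinant are parallel, K acts as a derivation, so its commutators with the
products e_k e_l come from the Riemann tensor and its trace from F_A; this determines it
(`eq_of_commutator`, `curvatureEnd_eq`). On W⁺ the products e₀eⱼ are quaternionic units. In terms of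
them, the symmetries of the Riemann tensor reduce its contribution to a scalar (`sum_curvature`),
and a 2-form acts only through its self-dual part (`cliffordTwoForm_selfDualPart`).

All these identities are proved with globally smooth sections and then transferred to the pointwise
definitions, which use `FiberBundle.extend` and `stdOrthonormalBasis`, by tensoriality and by
independence of traces from the basis. -/

noncomputable section

set_option linter.unusedSectionVars false

/-! ### Globally smooth sections with prescribed germs, and brackets as commutators. -/

section Sections

variable {E : Type*} [NormedAddCommGroup E] [NormedSpace ℝ E]
  {H : Type*} [TopologicalSpace H] {I : ModelWithCorners ℝ E H}
  {M : Type*} [TopologicalSpace M] [ChartedSpace H M] [IsManifold I ∞ M]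
  {F : Type*} [NormedAddCommGroup F] [NormedSpace ℝ F]
  {V : M → Type*} [TopologicalSpace (TotalSpace F V)] [∀ x, AddCommGroup (V x)]
  [∀ x, Module ℝ (V x)] [∀ x, TopologicalSpace (V x)] [FiberBundle F V] [VectorBundle ℝ F V]
  [ContMDiffVectorBundle ∞ F V I]
  {W : Type*} [NormedAddCommGroup W] [NormedSpace ℝ W]

/-- A section that is smooth near `x` agrees near `x` with a globally smooth section. -/
theorem exists_contMDiff_eventuallyEq [FiniteDimensional ℝ E] [T2Space M] {x : M}
    {σ : Π y : M, V y} (hσ : ∀ᶠ y in 𝓝 x, CMDiffAt ∞ (T% σ) y) :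
    ∃ τ : Π y : M, V y, CMDiff ∞ (T% τ) ∧ ∀ᶠ y in 𝓝 x, τ y = σ y := by
  obtain ⟨u, hu, huo, hxu⟩ := eventually_nhds_iff.1 hσ
  obtain ⟨χ, -, hχ⟩ := (SmoothBumpFunction.nhds_basis_tsupport (I := I) x).mem_iff.1
    (huo.mem_nhds hxu)
  refine ⟨(χ : M → ℝ) • σ, ContMDiffOn.smul_section_of_tsupport χ.contMDiff.contMDiffOn huo hχ
    fun y hy ↦ (hu y hy).contMDiffWithinAt, ?_⟩
  filter_upwards [χ.eventuallyEq_one] with y hy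
  simp [hy]

/-- Every vector of a fiber is the value of a globally smooth section that agrees near `x` with the
extension `FiberBundle.extend`. -/
theorem exists_contMDiff_eventuallyEq_extend [FiniteDimensional ℝ E] [T2Space M] {x : M} (v : V x) :
    ∃ τ : Π y : M, V y, CMDiff ∞ (T% τ) ∧ τ x = v ∧
      ∀ᶠ y in 𝓝 x, τ y = FiberBundle.extend F v y := by
  obtain ⟨s, hs, hσ⟩ := FiberBundle.exists_contMDiffOn_extend (k := ∞) I F v
  obtain ⟨u, hus, huo, hxu⟩ := mem_nhds_iff.1 hs
  obtain ⟨τ, hτ, h⟩ := exists_contMDiff_eventuallyEq (I := I) (x := x)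
    (σ := FiberBundle.extend F v) (by
      filter_upwards [huo.mem_nhds hxu] with y hy
      exact hσ.contMDiffAt (Filter.mem_of_superset (huo.mem_nhds hy) hus))
  exact ⟨τ, hτ, by simpa using h.self_of_nhds, h⟩

theorem exists_contMDiff_section [FiniteDimensional ℝ E] [T2Space M] {x : M} (v : V x) :
    ∃ τ : Π y : M, V y, CMDiff ∞ (T% τ) ∧ τ x = v :=
  let ⟨τ, h, h', _⟩ := exists_contMDiff_eventuallyEq_extend (I := I) (F := F) v
  ⟨τ, h, h'⟩

/-- The derivative along X is the fibre component of the tangent map of g composed with the section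
X, so its smoothness is that of the tangent map. -/
theorem ContMDiff.mvfderiv_apply {g : M → W} (hg : CMDiff ∞ g) {X : Π y : M, TangentSpace I y}
    (hX : CMDiff ∞ (T% X)) : CMDiff ∞ (fun y ↦ mvfderiv I g y (X y)) := by
  have h := (hg.contMDiff_tangentMap (m := ∞) (by simp)).comp hX
  intro y
  have := (contMDiffAt_totalSpace.1 (h y)).2
  exact this.congr_of_eventuallyEq (.of_forall fun _ ↦ by
    simp only [tangentMap, mvfderiv, Function.comp_apply, ContinuousLinearMap.comp_apply]; simp; rfl)

theorem ContMDiff.mlieBracket [CompleteSpace E] {X Y : Π y : M, TangentSpace I y}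
    (hX : CMDiff ∞ (T% X)) (hY : CMDiff ∞ (T% Y)) :
    CMDiff ∞ (T% (VectorField.mlieBracket I X Y)) := fun x ↦
  haveI : IsManifold I (((⊤ : ℕ∞) : WithTop ℕ∞) + 1) M := inferInstanceAs (IsManifold I ∞ M)
  haveI : IsManifold I (minSmoothness ℝ 2) M := by
    rw [minSmoothness_of_isRCLikeNormedField]; infer_instance
  ContMDiffAt.mlieBracket_vectorField (m := ⊤) (n := ⊤) (hX x) (hY x) (by simp)

/-- The Lie bracket of vector fields acts on functions as the commutator. -/
theorem mvfderiv_mlieBracket [FiniteDimensional ℝ E] [T2Space M] {g : M → ℝ} (hg : CMDiff ∞ g)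
    {X Y : Π y : M, TangentSpace I y} (hX : CMDiff ∞ (T% X)) (hY : CMDiff ∞ (T% Y)) (x : M) :
    mvfderiv I g x (VectorField.mlieBracket I X Y x) =
      mvfderiv I (fun y ↦ mvfderiv I g y (Y y)) x (X x) -
        mvfderiv I (fun y ↦ mvfderiv I g y (X y)) x (Y x) := by
  have : CompleteSpace E := FiniteDimensional.complete ℝ E
  have : IsManifold I (minSmoothness ℝ 3) M := by
    rw [minSmoothness_of_isRCLikeNormedField]; infer_instance
  -- The argument tests brackets on a field Z that is nonzero at x; in dimension 0 there is none,
  -- but both sides vanish.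
  rcases subsingleton_or_nontrivial E with hE | hE
  · have h0 (v : TangentSpace I x) : v = 0 := Subsingleton.elim (α := E) v 0
    simp [h0 (VectorField.mlieBracket I X Y x), h0 (X x), h0 (Y x)]
  have : Nontrivial (TangentSpace I x) := inferInstanceAs (Nontrivial E)
  obtain ⟨z, hz⟩ := exists_ne (0 : TangentSpace I x)
  obtain ⟨Z, hZ, rfl⟩ := exists_contMDiff_section (I := I) (F := E) (V := fun x ↦ TangentSpace I x) z
  have hs {U : Π y : M, TangentSpace I y} (hU : CMDiff ∞ (T% U)) :
      CMDiffAt (minSmoothness ℝ 2) (T% U) x := by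
    rw [minSmoothness_of_isRCLikeNormedField]; exact (hU x).of_le ENat.LEInfty.out
  have hd {U : Π y : M, TangentSpace I y} (hU : CMDiff ∞ (T% U)) (y : M) : MDiffAt (T% U) y :=
    (hU y).mdifferentiableAt (by simp)
  have hgd (y : M) : MDiffAt g y := (hg y).mdifferentiableAt (by simp)
  have key (U : Π y : M, TangentSpace I y) :
      VectorField.mlieBracket I U (g • Z) =
        (fun y ↦ mvfderiv I g y (U y)) • Z + g • VectorField.mlieBracket I U Z := by
    ext1 y
    exact VectorField.mlieBracket_smul_right (hgd y) (hd hZ y)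
  have key2 {U U' : Π y : M, TangentSpace I y} (hU : CMDiff ∞ (T% U)) (hU' : CMDiff ∞ (T% U')) :
      VectorField.mlieBracket I U (VectorField.mlieBracket I U' (g • Z)) x =
        mvfderiv I (fun y ↦ mvfderiv I g y (U' y)) x (U x) • Z x +
        mvfderiv I g x (U' x) • VectorField.mlieBracket I U Z x +
        mvfderiv I g x (U x) • VectorField.mlieBracket I U' Z x +
        g x • VectorField.mlieBracket I U (VectorField.mlieBracket I U' Z) x := by
    have hg' : MDiffAt (fun y ↦ mvfderiv I g y (U' y)) x :=
      (hg.mvfderiv_apply hU' x).mdifferentiableAt (by simp)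
    rw [key, VectorField.mlieBracket_add_right
      ((((hg.mvfderiv_apply hU').smul_section hZ) x).mdifferentiableAt (by simp))
      (((hg.smul_section (hU'.mlieBracket hZ)) x).mdifferentiableAt (by simp)),
      VectorField.mlieBracket_smul_right hg' (hd hZ x),
      VectorField.mlieBracket_smul_right (hgd x) (hd (hU'.mlieBracket hZ) x)]
    abel
  -- The Jacobi identity for X, Y, gZ is compared with g times the one for X, Y, Z. Everything
  -- cancels except multiples of Z x, and their coefficients are the two sides of the claim.
  have h1 := VectorField.leibniz_identity_mlieBracket_apply (hs hX) (hs hY)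
    (hs (hg.smul_section hZ))
  have h2 := VectorField.leibniz_identity_mlieBracket_apply (hs hX) (hs hY) (hs hZ)
  rw [key2 hX hY, key2 hY hX, key, h2] at h1
  simp only [Pi.add_apply, Pi.smul_apply', smul_add] at h1
  refine smul_left_injective ℝ hz ?_
  simp only [sub_smul]
  have h3 : ∀ a b c d e p q : TangentSpace I x,
      a + b + c + (p + q) = e + p + (d + c + b + q) → e = a - d := by
    intro a b c d e p q h
    rw [eq_sub_iff_add_eq, ← sub_eq_zero]
    rw [← sub_eq_zero] at h
    rw [← neg_eq_zero, ← h]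
    abel
  exact h3 _ _ _ _ _ _ _ h1

end Sections

/-! ### Curvature operators and parallel pairings. -/

section Curvature

variable {E : Type*} [NormedAddCommGroup E] [NormedSpace ℝ E]
  {H : Type*} [TopologicalSpace H] {I : ModelWithCorners ℝ E H}
  {M : Type*} [TopologicalSpace M] [ChartedSpace H M] [IsManifold I ∞ M]

variable (I) in
/-- `∇_X ∇_Y σ - ∇_Y ∇_X σ - ∇_{[X, Y]} σ` at `x`, for an operator `σ ↦ ∇ σ` on sections. -/
def curvatureOp {V : M → Type*} [∀ x, AddCommGroup (V x)] [∀ x, Module ℝ (V x)]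
    [∀ x, TopologicalSpace (V x)]
    (D : (Π x : M, V x) → Π x : M, TangentSpace I x →L[ℝ] V x)
    (X Y : Π x : M, TangentSpace I x) (σ : Π x : M, V x) (x : M) : V x :=
  D (fun y ↦ D σ y (Y y)) x (X x) - D (fun y ↦ D σ y (X y)) x (Y x) -
    D σ x (VectorField.mlieBracket I X Y x)

/-- A parallel pairing intertwines the curvature operators. -/
theorem curvatureOp_pairing {V₁ V₂ V₃ : M → Type*}
    [∀ x, AddCommGroup (V₁ x)] [∀ x, Module ℝ (V₁ x)] [∀ x, TopologicalSpace (V₁ x)]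
    [∀ x, AddCommGroup (V₂ x)] [∀ x, Module ℝ (V₂ x)] [∀ x, TopologicalSpace (V₂ x)]
    [∀ x, AddCommGroup (V₃ x)] [∀ x, Module ℝ (V₃ x)] [∀ x, TopologicalSpace (V₃ x)]
    {D₁ : (Π x : M, V₁ x) → Π x : M, TangentSpace I x →L[ℝ] V₁ x}
    {D₂ : (Π x : M, V₂ x) → Π x : M, TangentSpace I x →L[ℝ] V₂ x}
    {D₃ : (Π x : M, V₃ x) → Π x : M, TangentSpace I x →L[ℝ] V₃ x}
    {B : Π x : M, V₁ x → V₂ x → V₃ x}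
    (hBl : ∀ x v v' w, B x (v + v') w = B x v w + B x v' w)
    (hBr : ∀ x v w w', B x v (w + w') = B x v w + B x v w')
    {S₁ : Set (Π x : M, V₁ x)} {S₂ : Set (Π x : M, V₂ x)}
    (hB : ∀ σ ∈ S₁, ∀ τ ∈ S₂, ∀ (x : M) (v : TangentSpace I x),
      D₃ (fun y ↦ B y (σ y) (τ y)) x v = B x (D₁ σ x v) (τ x) + B x (σ x) (D₂ τ x v))
    (hadd : ∀ σ ∈ S₁, ∀ τ ∈ S₂, ∀ σ' ∈ S₁, ∀ τ' ∈ S₂, ∀ (x : M) (v : TangentSpace I x),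
      D₃ (fun y ↦ B y (σ y) (τ y) + B y (σ' y) (τ' y)) x v =
        D₃ (fun y ↦ B y (σ y) (τ y)) x v + D₃ (fun y ↦ B y (σ' y) (τ' y)) x v)
    {X Y : Π x : M, TangentSpace I x} {σ : Π x : M, V₁ x} {τ : Π x : M, V₂ x}
    (hσ : σ ∈ S₁) (hτ : τ ∈ S₂)
    (hXσ : (fun y ↦ D₁ σ y (X y)) ∈ S₁) (hYσ : (fun y ↦ D₁ σ y (Y y)) ∈ S₁)
    (hXτ : (fun y ↦ D₂ τ y (X y)) ∈ S₂) (hYτ : (fun y ↦ D₂ τ y (Y y)) ∈ S₂) (x : M) :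
    curvatureOp I D₃ X Y (fun y ↦ B y (σ y) (τ y)) x =
      B x (curvatureOp I D₁ X Y σ x) (τ x) + B x (σ x) (curvatureOp I D₂ X Y τ x) := by
  have hBl' (x v v' w) : B x (v - v') w = B x v w - B x v' w := by
    rw [eq_sub_iff_add_eq, ← hBl, sub_add_cancel]
  have hBr' (x v w w') : B x v (w - w') = B x v w - B x v w' := by
    rw [eq_sub_iff_add_eq, ← hBr, sub_add_cancel]
  simp only [curvatureOp, hB σ hσ τ hτ, hBl', hBr']
  -- The mixed terms B(∇_X σ, ∇_Y τ) and B(∇_Y σ, ∇_X τ) occur in both iterated derivatives and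
  -- cancel in the commutator.
  rw [hadd _ hYσ _ hτ _ hσ _ hYτ, hadd _ hXσ _ hτ _ hσ _ hXτ, hB _ hYσ _ hτ, hB _ hσ _ hYτ,
    hB _ hXσ _ hτ, hB _ hσ _ hXτ]
  abel

end Curvature

/-! ### Tensoriality of the curvature of a metric connection. -/

section Tensoriality

variable {E : Type*} [NormedAddCommGroup E] [NormedSpace ℝ E] [FiniteDimensional ℝ E]
  {H : Type*} [TopologicalSpace H] {I : ModelWithCorners ℝ E H}
  {M : Type*} [TopologicalSpace M] [ChartedSpace H M] [IsManifold I ∞ M] [T2Space M]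
  {F : Type*} [NormedAddCommGroup F] [NormedSpace ℝ F]
  {V : M → Type*} [TopologicalSpace (TotalSpace F V)] [∀ x, AddCommGroup (V x)]
  [∀ x, Module ℝ (V x)] [∀ x, TopologicalSpace (V x)] [∀ x, IsTopologicalAddGroup (V x)]
  [∀ x, ContinuousSMul ℝ (V x)] [FiberBundle F V] [VectorBundle ℝ F V]
  [ContMDiffVectorBundle ∞ F V I]

theorem ContMDiff.mdiffAt_section {σ : Π x : M, V x} (hσ : CMDiff ∞ (T% σ)) (x : M) :
    MDiffAt (T% σ) x :=
  (hσ x).mdifferentiableAt (by simp)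

/-- A smooth connection with a parallel nondegenerate real bilinear form on the fibers. -/
structure IsSmoothMetricConnection (cov : CovariantDerivative I F V) (B : Π x : M, V x → V x → ℝ) :
    Prop where
  contMDiff {σ : Π x : M, V x} {X : Π x : M, TangentSpace I x} (hσ : CMDiff ∞ (T% σ))
    (hX : CMDiff ∞ (T% X)) : CMDiff ∞ (T% (fun y ↦ cov σ y (X y)))
  add_left (x : M) (v v' w : V x) : B x (v + v') w = B x v w + B x v' w
  add_right (x : M) (v w w' : V x) : B x v (w + w') = B x v w + B x v w'
  nondegenerate (x : M) (v : V x) (hv : ∀ w, B x v w = 0) : v = 0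
  contMDiff_form {σ τ : Π x : M, V x} (hσ : CMDiff ∞ (T% σ)) (hτ : CMDiff ∞ (T% τ)) :
    CMDiff ∞ (fun y ↦ B y (σ y) (τ y))
  parallel {σ τ : Π x : M, V x} (hσ : CMDiff ∞ (T% σ)) (hτ : CMDiff ∞ (T% τ)) (x : M)
    (v : TangentSpace I x) : mvfderiv I (fun y ↦ B y (σ y) (τ y)) x v =
      B x (cov σ x v) (τ x) + B x (σ x) (cov τ x v)

namespace IsSmoothMetricConnection

variable {cov : CovariantDerivative I F V} {B : Π x : M, V x → V x → ℝ}
  (h : IsSmoothMetricConnection cov B)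
include h

/-- The curvature operator is skew with respect to the parallel form. -/
theorem curvatureOp_skew {X Y : Π x : M, TangentSpace I x} {σ τ : Π x : M, V x}
    (hX : CMDiff ∞ (T% X)) (hY : CMDiff ∞ (T% Y)) (hσ : CMDiff ∞ (T% σ)) (hτ : CMDiff ∞ (T% τ))
    (x : M) :
    B x (curvatureOp I cov X Y σ x) (τ x) + B x (σ x) (curvatureOp I cov X Y τ x) = 0 := by
  -- The target is the trivial line bundle with ordinary differentiation, which is flat because
  -- brackets act on functions as commutators.
  have key := curvatureOp_pairing (I := I) (D₁ := cov) (D₂ := cov) (V₃ := fun _ ↦ ℝ)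
    (D₃ := fun g y ↦ mvfderiv I g y) (B := B) h.add_left h.add_right
    (S₁ := {σ | CMDiff ∞ (T% σ)}) (S₂ := {σ | CMDiff ∞ (T% σ)})
    (fun σ hσ τ hτ x v ↦ h.parallel hσ hτ x v)
    (fun σ hσ τ hτ σ' hσ' τ' hτ' x v ↦ by
      rw [mvfderiv_fun_add ((h.contMDiff_form hσ hτ x).mdifferentiableAt (by simp))
        ((h.contMDiff_form hσ' hτ' x).mdifferentiableAt (by simp)), add_apply])
    hσ hτ (h.contMDiff hσ hX) (h.contMDiff hσ hY) (h.contMDiff hτ hX) (h.contMDiff hτ hY) x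
  rw [← key]
  simp only [curvatureOp]
  rw [mvfderiv_mlieBracket (h.contMDiff_form hσ hτ) hX hY x]
  ring

omit h in
theorem curvatureOp_swap (X Y : Π x : M, TangentSpace I x) (σ : Π x : M, V x) (x : M) :
    curvatureOp I cov X Y σ x = -curvatureOp I cov Y X σ x := by
  simp only [curvatureOp]
  rw [VectorField.mlieBracket_swap_apply (V := X), map_neg]
  abel

/-- `TensorialAt` tests fields that are only differentiable at x, whereas `h.contMDiff` concerns
smooth ones. Expanding X in a local frame, replaced by global fields with the same germs, leaves
differentiable coefficients times smooth sections. -/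
theorem mdiffAt_apply {σ : Π x : M, V x} (hσ : CMDiff ∞ (T% σ)) {x : M}
    {X : Π x : M, TangentSpace I x} (hX : MDiffAt (T% X) x) :
    MDiffAt (T% (fun y ↦ cov σ y (X y))) x := by
  let t := trivializationAt E (fun x : M ↦ TangentSpace I x) x
  have hx : x ∈ t.baseSet := FiberBundle.mem_baseSet_trivializationAt _ _ x
  let b := Module.finBasis ℝ E
  have hs (i) : ∃ Z : Π x : M, TangentSpace I x, CMDiff ∞ (T% Z) ∧
      ∀ᶠ y in 𝓝 x, Z y = t.localFrame b i y :=
    exists_contMDiff_eventuallyEq (by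
      filter_upwards [t.open_baseSet.mem_nhds hx] with y hy
      exact contMDiffAt_localFrame_of_mem ∞ _ b i hy)
  choose Z hZ hZs using hs
  refine (MDifferentiableAt.sum_section (s := Finset.univ) fun i _ ↦
    (mdifferentiableAt_localFrameCoeff b hx hX i).smul_section
      ((h.contMDiff hσ (hZ i)).mdiffAt_section x)).congr_of_eventuallyEq ?_
  filter_upwards [t.eventually_eq_localFrame_sum_coeff_smul (I := I) (s := X) b hx,
    Filter.eventually_all.2 hZs] with y hy hy'
  simp only [TotalSpace.mk_inj]
  conv_lhs => rw [hy, map_sum]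
  simp [hy']

/-- The derivative of g in ∇_Y(g ∇_X σ) is cancelled by the one in [gX, Y]. -/
theorem curvatureOp_tensorial {Y : Π x : M, TangentSpace I x} {σ : Π x : M, V x}
    (hσ : CMDiff ∞ (T% σ)) (x : M) :
    TensorialAt I E (fun X : Π x : M, TangentSpace I x ↦ curvatureOp I cov X Y σ x) x := by
  have : CompleteSpace E := FiniteDimensional.complete ℝ E
  constructor
  · intro g X hg hX
    have h1 := cov.isCovariantDerivativeOnUniv.leibniz (h.mdiffAt_apply hσ hX) hg
    simp only [curvatureOp, VectorField.mlieBracket_smul_left hg hX, Pi.smul_apply', map_smul]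
    change _ - cov (g • fun y ↦ cov σ y (X y)) x (Y x) - _ = _
    rw [h1]
    simp only [add_apply, smul_apply, ContinuousLinearMap.smulRight_apply, map_add, map_smul,
      smul_sub, neg_smul, map_neg]
    abel
  · intro X X' hX hX'
    have h1 := cov.isCovariantDerivativeOnUniv.add (h.mdiffAt_apply hσ hX) (h.mdiffAt_apply hσ hX')
    simp only [curvatureOp, VectorField.mlieBracket_add_left hX hX', Pi.add_apply, map_add]
    change _ - cov ((fun y ↦ cov σ y (X y)) + fun y ↦ cov σ y (X' y)) x (Y x) - _ = _
    rw [h1, add_apply]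
    abel

-- Locality. No smoothness is asked of the primed fields, so they may be the extensions in the
-- definition of `curvature`, which are controlled only near x.
omit h in
theorem curvatureOp_congr_of_eventuallyEq {X X' Y Y' : Π x : M, TangentSpace I x}
    {σ σ' : Π x : M, V x} (hXσ : CMDiff ∞ (T% (fun y ↦ cov σ y (X y))))
    (hYσ : CMDiff ∞ (T% (fun y ↦ cov σ y (Y y)))) {x : M}
    (hX : ∀ᶠ y in 𝓝 x, X y = X' y) (hY : ∀ᶠ y in 𝓝 x, Y y = Y' y)
    (hσσ' : ∀ᶠ y in 𝓝 x, σ y = σ' y)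
    (hσ : CMDiff ∞ (T% σ)) :
    curvatureOp I cov X Y σ x = curvatureOp I cov X' Y' σ' x := by
  have hc : ∀ᶠ y in 𝓝 x, cov σ y = cov σ' y := by
    filter_upwards [hσσ'.eventually_nhds] with y hy
    refine cov.isCovariantDerivativeOnUniv.congr_of_eventuallyEq (hσ.mdiffAt_section y)
      ((hσ.mdiffAt_section y).congr_of_eventuallyEq ?_) Filter.univ_mem hy
    filter_upwards [hy] with z hz
    rw [hz]
  have aux {U U' : Π x : M, TangentSpace I x} (hU : ∀ᶠ y in 𝓝 x, U y = U' y)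
      (hUσ : CMDiff ∞ (T% (fun y ↦ cov σ y (U y)))) :
      cov (fun y ↦ cov σ y (U y)) x = cov (fun y ↦ cov σ' y (U' y)) x := by
    have he : ∀ᶠ y in 𝓝 x, cov σ y (U y) = cov σ' y (U' y) := by
      filter_upwards [hc, hU] with y h1 h2
      rw [h1, h2]
    refine cov.isCovariantDerivativeOnUniv.congr_of_eventuallyEq (hUσ.mdiffAt_section x)
      ((hUσ.mdiffAt_section x).congr_of_eventuallyEq ?_) Filter.univ_mem he
    filter_upwards [he] with z hz
    rw [hz]
  simp only [curvatureOp]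
  rw [aux hX hXσ, aux hY hYσ, hc.self_of_nhds, hX.self_of_nhds, hY.self_of_nhds,
    Filter.EventuallyEq.mlieBracket_vectorField_eq hX hY]

/-- The curvature operator is tensorial in all its arguments. -/
theorem curvatureOp_congr {X X' Y Y' : Π x : M, TangentSpace I x} {σ σ' : Π x : M, V x}
    (hX : CMDiff ∞ (T% X)) (hX' : CMDiff ∞ (T% X')) (hY : CMDiff ∞ (T% Y)) (hY' : CMDiff ∞ (T% Y'))
    (hσ : CMDiff ∞ (T% σ)) (hσ' : CMDiff ∞ (T% σ')) {x : M} (hXX' : X x = X' x)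
    (hYY' : Y x = Y' x) (hσσ' : σ x = σ' x) :
    curvatureOp I cov X Y σ x = curvatureOp I cov X' Y' σ' x := by
  rw [(h.curvatureOp_tensorial hσ x).pointwise (hX.mdiffAt_section x) (hX'.mdiffAt_section x) hXX',
    curvatureOp_swap, (h.curvatureOp_tensorial hσ x).pointwise (hY.mdiffAt_section x)
      (hY'.mdiffAt_section x) hYY', ← curvatureOp_swap, ← sub_eq_zero]
  -- Tensoriality in σ comes from skewness: B(Rσ, τ) = -B(σ, Rτ) depends on σ only through its value
  -- at x, and B is nondegenerate.
  refine h.nondegenerate x _ fun w ↦ ?_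
  obtain ⟨τ, hτ, rfl⟩ := exists_contMDiff_section (I := I) (F := F) w
  have hsub (v v' w : V x) : B x (v - v') w = B x v w - B x v' w := by
    rw [eq_sub_iff_add_eq, ← h.add_left, sub_add_cancel]
  have h1 := h.curvatureOp_skew hX' hY' hσ hτ x
  have h2 := h.curvatureOp_skew hX' hY' hσ' hτ x
  rw [hsub]
  rw [hσσ'] at h1
  linarith

/-- The bridge between the pointwise definition and computations with sections: the pointwise
properties of `curvature` below are proved by choosing smooth representatives and applying this. -/
theorem curvature_eq_curvatureOp {X Y : Π x : M, TangentSpace I x} {σ : Π x : M, V x}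
    (hX : CMDiff ∞ (T% X)) (hY : CMDiff ∞ (T% Y)) (hσ : CMDiff ∞ (T% σ)) (x : M) :
    curvature cov x (X x) (Y x) (σ x) = curvatureOp I cov X Y σ x := by
  obtain ⟨X', hX', hXx, hXe⟩ := exists_contMDiff_eventuallyEq_extend (I := I) (F := E) (X x)
  obtain ⟨Y', hY', hYx, hYe⟩ := exists_contMDiff_eventuallyEq_extend (I := I) (F := E) (Y x)
  obtain ⟨σ', hσ', hσx, hσe⟩ := exists_contMDiff_eventuallyEq_extend (I := I) (F := F) (σ x)
  rw [h.curvatureOp_congr hX hX' hY hY' hσ hσ' hXx.symm hYx.symm hσx.symm,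
    curvatureOp_congr_of_eventuallyEq (h.contMDiff hσ' hX') (h.contMDiff hσ' hY') hXe hYe hσe hσ']
  simp [curvatureOp, curvature]

theorem curvature_swap (x : M) (u v : TangentSpace I x) (s : V x) :
    curvature cov x u v s = -curvature cov x v u s := by
  obtain ⟨X, hX, rfl⟩ := exists_contMDiff_section (I := I) (F := E) u
  obtain ⟨Y, hY, rfl⟩ := exists_contMDiff_section (I := I) (F := E) v
  obtain ⟨σ, hσ, rfl⟩ := exists_contMDiff_section (I := I) (F := F) s
  rw [h.curvature_eq_curvatureOp hX hY hσ, h.curvature_eq_curvatureOp hY hX hσ, curvatureOp_swap]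

theorem curvature_add_left (x : M) (u u' v : TangentSpace I x) (s : V x) :
    curvature cov x (u + u') v s = curvature cov x u v s + curvature cov x u' v s := by
  obtain ⟨X, hX, rfl⟩ := exists_contMDiff_section (I := I) (F := E) u
  obtain ⟨X', hX', rfl⟩ := exists_contMDiff_section (I := I) (F := E) u'
  obtain ⟨Y, hY, rfl⟩ := exists_contMDiff_section (I := I) (F := E) v
  obtain ⟨σ, hσ, rfl⟩ := exists_contMDiff_section (I := I) (F := F) s
  rw [h.curvature_eq_curvatureOp hX hY hσ, h.curvature_eq_curvatureOp hX' hY hσ,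
    ← (h.curvatureOp_tensorial hσ x).add (hX.mdiffAt_section x) (hX'.mdiffAt_section x)]
  exact h.curvature_eq_curvatureOp (hX.add_section hX') hY hσ x

theorem curvature_smul_left (x : M) (c : ℝ) (u v : TangentSpace I x) (s : V x) :
    curvature cov x (c • u) v s = c • curvature cov x u v s := by
  obtain ⟨X, hX, rfl⟩ := exists_contMDiff_section (I := I) (F := E) u
  obtain ⟨Y, hY, rfl⟩ := exists_contMDiff_section (I := I) (F := E) v
  obtain ⟨σ, hσ, rfl⟩ := exists_contMDiff_section (I := I) (F := F) s
  rw [h.curvature_eq_curvatureOp hX hY hσ,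
    ← (h.curvatureOp_tensorial hσ x).smul (f := fun _ ↦ c) mdifferentiableAt_const
      (hX.mdiffAt_section x)]
  exact h.curvature_eq_curvatureOp (contMDiff_const.smul_section hX) hY hσ x

theorem curvatureOp_add {X Y : Π x : M, TangentSpace I x} {σ σ' : Π x : M, V x}
    (hX : CMDiff ∞ (T% X)) (hY : CMDiff ∞ (T% Y)) (hσ : CMDiff ∞ (T% σ)) (hσ' : CMDiff ∞ (T% σ'))
    (x : M) : curvatureOp I cov X Y (fun y ↦ σ y + σ' y) x =
      curvatureOp I cov X Y σ x + curvatureOp I cov X Y σ' x := by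
  have hc {σ σ' : Π x : M, V x} (hσ : CMDiff ∞ (T% σ)) (hσ' : CMDiff ∞ (T% σ')) (y : M) :
      cov (fun y ↦ σ y + σ' y) y = cov σ y + cov σ' y :=
    cov.isCovariantDerivativeOnUniv.add (hσ.mdiffAt_section y) (hσ'.mdiffAt_section y)
  simp only [curvatureOp, hc hσ hσ', add_apply]
  rw [hc (h.contMDiff hσ hX) (h.contMDiff hσ' hX), hc (h.contMDiff hσ hY) (h.contMDiff hσ' hY)]
  simp only [add_apply]
  abel

theorem curvatureOp_smul {X Y : Π x : M, TangentSpace I x} {σ : Π x : M, V x} (c : ℝ)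
    (hX : CMDiff ∞ (T% X)) (hY : CMDiff ∞ (T% Y)) (hσ : CMDiff ∞ (T% σ))
    (x : M) : curvatureOp I cov X Y (fun y ↦ c • σ y) x = c • curvatureOp I cov X Y σ x := by
  have hc {σ : Π x : M, V x} (hσ : CMDiff ∞ (T% σ)) (y : M) :
      cov (fun y ↦ c • σ y) y = c • cov σ y :=
    cov.isCovariantDerivativeOnUniv.smul_const c (hσ.mdiffAt_section y)
  simp only [curvatureOp, hc hσ, smul_apply]
  rw [hc (h.contMDiff hσ hX), hc (h.contMDiff hσ hY)]
  simp only [smul_apply, smul_sub]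

theorem curvature_add_right (x : M) (u v : TangentSpace I x) (s s' : V x) :
    curvature cov x u v (s + s') = curvature cov x u v s + curvature cov x u v s' := by
  obtain ⟨X, hX, rfl⟩ := exists_contMDiff_section (I := I) (F := E) u
  obtain ⟨Y, hY, rfl⟩ := exists_contMDiff_section (I := I) (F := E) v
  obtain ⟨σ, hσ, rfl⟩ := exists_contMDiff_section (I := I) (F := F) s
  obtain ⟨σ', hσ', rfl⟩ := exists_contMDiff_section (I := I) (F := F) s'
  rw [h.curvature_eq_curvatureOp hX hY hσ, h.curvature_eq_curvatureOp hX hY hσ',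
    ← h.curvatureOp_add hX hY hσ hσ']
  exact h.curvature_eq_curvatureOp hX hY (hσ.add_section hσ') x

theorem curvature_smul_right (x : M) (c : ℝ) (u v : TangentSpace I x) (s : V x) :
    curvature cov x u v (c • s) = c • curvature cov x u v s := by
  obtain ⟨X, hX, rfl⟩ := exists_contMDiff_section (I := I) (F := E) u
  obtain ⟨Y, hY, rfl⟩ := exists_contMDiff_section (I := I) (F := E) v
  obtain ⟨σ, hσ, rfl⟩ := exists_contMDiff_section (I := I) (F := F) s
  rw [h.curvature_eq_curvatureOp hX hY hσ, ← h.curvatureOp_smul c hX hY hσ]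
  exact h.curvature_eq_curvatureOp hX hY (contMDiff_const.smul_section hσ) x

theorem curvature_skew (x : M) (u v : TangentSpace I x) (s t : V x) :
    B x (curvature cov x u v s) t + B x s (curvature cov x u v t) = 0 := by
  obtain ⟨X, hX, rfl⟩ := exists_contMDiff_section (I := I) (F := E) u
  obtain ⟨Y, hY, rfl⟩ := exists_contMDiff_section (I := I) (F := E) v
  obtain ⟨σ, hσ, rfl⟩ := exists_contMDiff_section (I := I) (F := F) s
  obtain ⟨τ, hτ, rfl⟩ := exists_contMDiff_section (I := I) (F := F) t
  rw [h.curvature_eq_curvatureOp hX hY hσ, h.curvature_eq_curvatureOp hX hY hτ]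
  exact h.curvatureOp_skew hX hY hσ hτ x

end IsSmoothMetricConnection
end Tensoriality

/-! ### Smooth orthonormal frames, traces, and smoothness of the Levi-Civita connection. -/

section OrthonormalFrame

variable {E : Type*} [NormedAddCommGroup E] [NormedSpace ℝ E] [FiniteDimensional ℝ E]
  {H : Type*} [TopologicalSpace H] {I : ModelWithCorners ℝ E H}
  {M : Type*} [TopologicalSpace M] [ChartedSpace H M] [IsManifold I ∞ M] [T2Space M]
  [RiemannianBundle (fun x : M ↦ TangentSpace I x)]
  [IsContMDiffRiemannianBundle I ∞ E (fun x : M ↦ TangentSpace I x)]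

theorem ContMDiffAt.inner_tangent {X Y : Π x : M, TangentSpace I x} {x : M}
    (hX : CMDiffAt ∞ (T% X) x) (hY : CMDiffAt ∞ (T% Y) x) :
    CMDiffAt ∞ (fun y ↦ inner ℝ (X y) (Y y)) x :=
  ContMDiffAt.inner_bundle (IB := I) (F := E) (E := fun x : M ↦ TangentSpace I x) hX hY

theorem ContMDiff.inner_tangent {X Y : Π x : M, TangentSpace I x}
    (hX : CMDiff ∞ (T% X)) (hY : CMDiff ∞ (T% Y)) : CMDiff ∞ (fun y ↦ inner ℝ (X y) (Y y)) :=
  fun x ↦ (hX x).inner_tangent (hY x)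

theorem contMDiffAt_norm_inv_smul {X : Π x : M, TangentSpace I x} {x : M}
    (hX : CMDiffAt ∞ (T% X) x) (h0 : X x ≠ 0) :
    CMDiffAt ∞ (T% (fun y ↦ ‖X y‖⁻¹ • X y)) x := by
  have h1 : CMDiffAt ∞ (fun y ↦ ‖X y‖⁻¹) x := by
    have h2 : (fun y ↦ ‖X y‖⁻¹) = (fun t : ℝ ↦ (√t)⁻¹) ∘ fun y ↦ inner ℝ (X y) (X y) := by
      ext y
      simp
    rw [h2]
    have h3 : inner ℝ (X x) (X x) ≠ 0 := by simpa using h0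
    refine ContMDiffAt.comp x (ContDiffAt.contMDiffAt ?_) (hX.inner_tangent hX)
    refine (Real.contDiffAt_sqrt h3).inv ?_
    simpa [real_inner_self_eq_norm_sq] using h0
  exact h1.smul_section hX

/-- Every orthonormal basis of a tangent space extends to globally smooth vector fields which are
orthonormal near the base point. -/
theorem exists_contMDiff_orthonormal {n : ℕ} {x : M}
    (e : OrthonormalBasis (Fin n) ℝ (TangentSpace I x)) :
    ∃ X : Fin n → Π y : M, TangentSpace I y, (∀ i, CMDiff ∞ (T% (X i))) ∧ (∀ i, X i x = e i) ∧
      ∀ᶠ y in 𝓝 x, ∃ b : OrthonormalBasis (Fin n) ℝ (TangentSpace I y), ∀ i, b i = X i y := by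
  have h0 (i : Fin n) : ∃ Z : Π y : M, TangentSpace I y, CMDiff ∞ (T% Z) ∧ Z x = e i :=
    exists_contMDiff_section (I := I) (F := E) (V := fun x ↦ TangentSpace I x) (e i)
  choose Z hZ hZx using h0
  -- Gram–Schmidt leaves the already orthogonal vectors at x unchanged, so the frame still starts
  -- from e. Strong induction then propagates smoothness and nonvanishing together, the latter being
  -- needed to divide.
  let G (i : Fin n) (y : M) : TangentSpace I y := InnerProductSpace.gramSchmidt ℝ (fun j ↦ Z j y) i
  have hGx (i : Fin n) : G i x = e i := by
    have : InnerProductSpace.gramSchmidt ℝ (fun j ↦ Z j x) = fun j ↦ Z j x := by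
      apply InnerProductSpace.gramSchmidt_of_orthogonal
      intro i j hij
      simp only [hZx]
      exact e.orthonormal.2 hij
    simp only [G]
    rw [this]
    exact hZx i
  have hG (i : Fin n) : ∀ᶠ y in 𝓝 x, CMDiffAt ∞ (T% (G i)) y ∧ G i y ≠ 0 := by
    induction i using WellFoundedLT.induction with
    | ind i ih =>
      have h1 : ∀ᶠ y in 𝓝 x, CMDiffAt ∞ (T% (G i)) y := by
        have h2 : ∀ᶠ y in 𝓝 x, ∀ j ∈ Finset.Iio i, CMDiffAt ∞ (T% (G j)) y ∧ G j y ≠ 0 :=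
          (Filter.eventually_all_finset _).2 fun j hj ↦ ih j (Finset.mem_Iio.1 hj)
        filter_upwards [h2] with y hy
        have h3 : G i = Z i - fun y ↦ ∑ j ∈ Finset.Iio i,
            ((inner ℝ (G j y) (Z i y) / inner ℝ (G j y) (G j y)) • G j y) := by
          ext1 y
          have := InnerProductSpace.gramSchmidt_def'' ℝ (fun j ↦ Z j y) i
          simp only [Pi.sub_apply]
          rw [eq_sub_iff_add_eq]
          refine Eq.trans ?_ this.symm
          simp [G]
        rw [h3]
        refine (hZ i y).sub_section (ContMDiffAt.sum_section fun j hj ↦ ?_)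
        obtain ⟨h4, h5⟩ := hy j hj
        refine ContMDiffAt.smul_section ?_ h4
        exact (h4.inner_tangent (hZ i y)).div₀ (h4.inner_tangent h4) (by simpa using h5)
      have h6 : ContinuousAt (fun y ↦ inner ℝ (G i y) (G i y)) x :=
        (h1.self_of_nhds.inner_tangent h1.self_of_nhds).continuousAt
      have h7 : inner ℝ (G i x) (G i x) ≠ 0 := by
        rw [hGx]; simp
      filter_upwards [h1, h6.eventually_ne h7] with y hy hy'
      exact ⟨hy, by simpa using hy'⟩
  have hN (i : Fin n) : ∃ X : Π y : M, TangentSpace I y, CMDiff ∞ (T% X) ∧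
      ∀ᶠ y in 𝓝 x, X y = ‖G i y‖⁻¹ • G i y :=
    exists_contMDiff_eventuallyEq ((hG i).mono fun y hy ↦ contMDiffAt_norm_inv_smul hy.1 hy.2)
  choose X hX hXe using hN
  refine ⟨X, hX, fun i ↦ ?_, ?_⟩
  · rw [(hXe i).self_of_nhds, hGx]
    simp
  · filter_upwards [Filter.eventually_all.2 hXe, Filter.eventually_all.2 hG] with y hy hy'
    have ho : Orthonormal ℝ (fun i ↦ X i y) := by
      constructor
      · intro i
        simp only [hy, norm_smul, norm_inv, norm_norm]
        exact inv_mul_cancel₀ (norm_ne_zero_iff.2 (hy' i).2)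
      · intro i j hij
        simp only [hy, inner_smul_left, inner_smul_right]
        rw [InnerProductSpace.gramSchmidt_orthogonal ℝ _ hij]
        simp
    have hc : Fintype.card (Fin n) = Module.finrank ℝ (TangentSpace I y) := by
      rw [← Module.finrank_eq_card_basis e.toBasis]
      rfl
    refine ⟨OrthonormalBasis.mk ho ?_, fun i ↦ ?_⟩
    -- The dimension count for spanning is applied with a nonempty index type, so n = 0 is treated
    -- separately.
    rcases isEmpty_or_nonempty (Fin n) with hn | hn
    · have := Module.finrank_zero_iff.1 (hc.symm.trans Fintype.card_eq_zero)
      intro v _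
      rw [Subsingleton.elim v 0]
      exact Submodule.zero_mem _
    · exact (ho.linearIndependent.span_eq_top_of_card_eq_finrank hc).ge
    · rw [OrthonormalBasis.coe_mk]

/-- By Parseval, ∑ᵢ ⟨b'ⱼ, bᵢ⟩⟨bᵢ, b'ₖ⟩ = ⟨b'ⱼ, b'ₖ⟩. This replaces `stdOrthonormalBasis`, chosen
point by point with no continuity, by the values of a smooth frame. -/
theorem OrthonormalBasis.sum_apply_apply_eq {U W : Type*} {ι ι' : Type*} [Fintype ι] [Fintype ι']
    [NormedAddCommGroup U] [InnerProductSpace ℝ U] [AddCommGroup W] [Module ℝ W]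
    (B : U →ₗ[ℝ] U →ₗ[ℝ] W) (b : OrthonormalBasis ι ℝ U) (b' : OrthonormalBasis ι' ℝ U) :
    ∑ i, B (b i) (b i) = ∑ i, B (b' i) (b' i) := by
  classical
  calc ∑ i, B (b i) (b i) = ∑ i, ∑ j, ∑ k,
        (inner ℝ (b' j) (b i) * inner ℝ (b i) (b' k)) • B (b' j) (b' k) := by
        refine Finset.sum_congr rfl fun i _ ↦ ?_
        conv_lhs => rw [← b'.sum_repr' (b i)]
        simp only [map_sum, LinearMap.sum_apply, map_smul, LinearMap.smul_apply, Finset.smul_sum, smul_smul]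
        rw [Finset.sum_comm]
        refine Finset.sum_congr rfl fun j _ ↦ Finset.sum_congr rfl fun k _ ↦ ?_
        rw [real_inner_comm (b' k) (b i), mul_comm]
    _ = ∑ j, ∑ k, (inner ℝ (b' j) (b' k) : ℝ) • B (b' j) (b' k) := by
        rw [Finset.sum_comm]
        refine Finset.sum_congr rfl fun j _ ↦ ?_
        rw [Finset.sum_comm]
        refine Finset.sum_congr rfl fun k _ ↦ ?_
        rw [← Finset.sum_smul, b.sum_inner_mul_inner]
    _ = ∑ i, B (b' i) (b' i) := by
        simp [orthonormal_iff_ite.1 b'.orthonormal, ite_smul]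

theorem contMDiff_koszul {X Y Z : Π x : M, TangentSpace I x} (hX : CMDiff ∞ (T% X))
    (hY : CMDiff ∞ (T% Y)) (hZ : CMDiff ∞ (T% Z)) : CMDiff ∞ (koszul X Y Z) := by
  have : CompleteSpace E := FiniteDimensional.complete ℝ E
  exact ((((((hY.inner_tangent hZ).mvfderiv_apply hX).add
    ((hZ.inner_tangent hX).mvfderiv_apply hY)).sub
    ((hX.inner_tangent hY).mvfderiv_apply hZ)).add ((hX.mlieBracket hY).inner_tangent hZ)).sub
    ((hY.mlieBracket hZ).inner_tangent hX)).add ((hZ.mlieBracket hX).inner_tangent hY)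

/-- A vector field whose inner products with smooth vector fields are smooth is smooth. -/
theorem contMDiff_of_inner {U : Π x : M, TangentSpace I x}
    (hU : ∀ Z : Π x : M, TangentSpace I x, CMDiff ∞ (T% Z) →
      CMDiff ∞ (fun y ↦ inner ℝ (U y) (Z y))) : CMDiff ∞ (T% U) := by
  intro x
  obtain ⟨X, hX, -, hb⟩ := exists_contMDiff_orthonormal (stdOrthonormalBasis ℝ (TangentSpace I x))
  have h := ContMDiffAt.sum_section (s := Finset.univ) (t := fun i y ↦ inner ℝ (U y) (X i y) • X i y)
    (n := ∞) (x₀ := x) (I := I) (F := E) (V := fun x ↦ TangentSpace I x)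
    fun i _ ↦ (hU _ (hX i) x).smul_section (hX i x)
  refine h.congr_of_eventuallyEq ?_
  filter_upwards [hb] with y ⟨b, hb⟩
  simp only [TotalSpace.mk_inj]
  conv_lhs => rw [← b.sum_repr' (U y)]
  simp only [hb]
  exact Finset.sum_congr rfl fun i _ ↦ by rw [real_inner_comm]

/-- The Koszul formula makes the inner products of ∇_X Y with smooth fields smooth, and these detect
smoothness. -/
theorem contMDiff_leviCivita {X Y : Π x : M, TangentSpace I x} (hX : CMDiff ∞ (T% X))
    (hY : CMDiff ∞ (T% Y)) : CMDiff ∞ (T% (fun y ↦ leviCivita I M Y y (X y))) := by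
  refine contMDiff_of_inner fun Z hZ ↦ ?_
  have h : (fun y ↦ inner ℝ (leviCivita I M Y y (X y)) (Z y)) =
      fun y ↦ 1 / 2 * koszul X Y Z y := by
    ext y
    exact inner_leviCivitaFun (hX.mdiffAt_section y) (hY.mdiffAt_section y) (hZ.mdiffAt_section y)
  rw [h]
  exact contMDiff_const.mul (contMDiff_koszul hX hY hZ)

variable (I M) in
theorem isSmoothMetricConnection_leviCivita :
    IsSmoothMetricConnection (leviCivita I M) (fun _ v w ↦ inner ℝ v w) where
  contMDiff hσ hX := contMDiff_leviCivita hX hσ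
  add_left _ v v' w := inner_add_left v v' w
  add_right _ v w w' := inner_add_right v w w'
  nondegenerate x v hv := by simpa using hv v
  contMDiff_form hσ hτ := hσ.inner_tangent hτ
  parallel {σ τ} hσ hτ x v := by
    obtain ⟨X, hX, rfl⟩ := exists_contMDiff_section (I := I) (F := E) v
    exact leviCivita_metric (hX.mdiffAt_section x) (hσ.mdiffAt_section x) (hτ.mdiffAt_section x)

theorem inner_riemannianGradient (u : M → ℝ) (x : M) (v : TangentSpace I x) :
    inner ℝ (riemannianGradient I u x) v = mvfderiv I u x v :=
  InnerProductSpace.toDual_symm_apply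

theorem contMDiff_riemannianGradient {u : M → ℝ} (hu : CMDiff ∞ u) :
    CMDiff ∞ (T% (riemannianGradient I u)) :=
  contMDiff_of_inner fun Z hZ ↦ by
    simpa only [inner_riemannianGradient] using hu.mvfderiv_apply hZ

end OrthonormalFrame

/-! ### First and second derivative tests along integral curves. -/

section SecondDerivative

variable {E : Type*} [NormedAddCommGroup E] [NormedSpace ℝ E] [FiniteDimensional ℝ E]
  {H : Type*} [TopologicalSpace H] {I : ModelWithCorners ℝ E H}
  {M : Type*} [TopologicalSpace M] [ChartedSpace H M] [IsManifold I ∞ M] [T2Space M]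
  [BoundarylessManifold I M]

/-- Along an integral curve of X, differentiating along X becomes d/dt, also iterated. This reduces
the maximum tests on M to calculus in one variable. -/
theorem IsMIntegralCurveAt.eventually_hasDerivAt_comp {γ : ℝ → M} {X : Π x : M, TangentSpace I x}
    {t₀ : ℝ} (hγ : IsMIntegralCurveAt γ X t₀) {u : M → ℝ} (hu : CMDiff ∞ u) :
    ∀ᶠ t in 𝓝 t₀, HasDerivAt (fun t ↦ u (γ t)) (mvfderiv I u (γ t) (X (γ t))) t := by
  filter_upwards [hγ] with t ht
  have h1 := ((hu (γ t)).mdifferentiableAt (by simp)).hasMFDerivAt.comp t ht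
  have h2 : HasFDerivAt (fun t ↦ u (γ t))
      ((mvfderiv I u (γ t)).comp ((1 : ℝ →L[ℝ] ℝ).smulRight (X (γ t)))) t :=
    hasMFDerivAt_iff_hasFDerivAt.1 h1
  refine h2.hasDerivAt.congr_deriv ?_
  rw [ContinuousLinearMap.comp_apply]
  congr 1
  exact one_smul ℝ (X (γ t))

/-- At a local maximum the first derivatives vanish. -/
theorem IsLocalMax.mvfderiv_eq_zero {u : M → ℝ} (hu : CMDiff ∞ u) {x : M} (hx : IsLocalMax u x) :
    mvfderiv I u x = 0 := by
  have : CompleteSpace E := FiniteDimensional.complete ℝ E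
  ext v
  obtain ⟨X, hX, rfl⟩ := exists_contMDiff_section (I := I) (F := E) v
  obtain ⟨γ, hγ0, hγ⟩ := exists_isMIntegralCurveAt_of_contMDiffAt_boundaryless 0
    ((hX x).of_le ENat.LEInfty.out)
  have h1 := (hγ.eventually_hasDerivAt_comp hu).self_of_nhds
  have hc : Filter.Tendsto γ (𝓝 0) (𝓝 x) := hγ0 ▸ hγ.continuousAt
  have h2 : IsLocalMax (fun t ↦ u (γ t)) 0 := by
    have := hc.eventually hx
    simpa [IsLocalMax, IsMaxFilter, hγ0] using this
  have := h2.hasDerivAt_eq_zero h1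
  rw [hγ0] at this
  simpa using this

/-- At a local maximum the second derivative along a vector field is nonpositive. -/
theorem IsLocalMax.mvfderiv_mvfderiv_nonpos {u : M → ℝ} (hu : CMDiff ∞ u) {x : M}
    (hx : IsLocalMax u x) {X : Π x : M, TangentSpace I x} (hX : CMDiff ∞ (T% X)) :
    mvfderiv I (fun y ↦ mvfderiv I u y (X y)) x (X x) ≤ 0 := by
  have : CompleteSpace E := FiniteDimensional.complete ℝ E
  obtain ⟨γ, hγ0, hγ⟩ := exists_isMIntegralCurveAt_of_contMDiffAt_boundaryless 0
    ((hX x).of_le ENat.LEInfty.out)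
  have h1 := hγ.eventually_hasDerivAt_comp hu
  have h2 := (hγ.eventually_hasDerivAt_comp (hu.mvfderiv_apply hX)).self_of_nhds
  have h3 : deriv (fun t ↦ u (γ t)) =ᶠ[𝓝 0] fun t ↦ mvfderiv I u (γ t) (X (γ t)) := by
    filter_upwards [h1] with t ht using ht.deriv
  have hc : Filter.Tendsto γ (𝓝 0) (𝓝 x) := hγ0 ▸ hγ.continuousAt
  have hmax : IsLocalMax (fun t ↦ u (γ t)) 0 := by
    have := hc.eventually hx
    simpa [IsLocalMax, IsMaxFilter, hγ0] using this
  rw [hγ0] at h2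
  have h4 : deriv (deriv fun t ↦ u (γ t)) 0 = mvfderiv I (fun y ↦ mvfderiv I u y (X y)) x (X x) := by
    rw [h3.deriv_eq, h2.deriv]
  rw [← h4]
  -- A positive second derivative would make the point a local minimum as well, so u ∘ γ would be
  -- locally constant and its second derivative zero.
  by_contra! hpos
  have hmin := isLocalMin_of_deriv_deriv_pos hpos hmax.deriv_eq_zero h1.self_of_nhds.continuousAt
  have hconst : (fun t ↦ u (γ t)) =ᶠ[𝓝 0] fun _ ↦ u (γ 0) := by
    filter_upwards [hmax, hmin] with t ht ht' using le_antisymm ht ht'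
  have h5 : deriv (fun t ↦ u (γ t)) =ᶠ[𝓝 0] fun _ ↦ 0 := by
    filter_upwards [hconst.eventually_nhds] with t ht
    rw [Filter.EventuallyEq.deriv_eq ht, deriv_const]
  rw [h5.deriv_eq, deriv_const] at hpos
  exact lt_irrefl _ hpos

end SecondDerivative

/-! ### The Bianchi identity, and traces computed in arbitrary orthonormal frames. -/

section Traces

variable {E : Type*} [NormedAddCommGroup E] [NormedSpace ℝ E] [FiniteDimensional ℝ E]
  {H : Type*} [TopologicalSpace H] {I : ModelWithCorners ℝ E H}
  {M : Type*} [TopologicalSpace M] [ChartedSpace H M] [IsManifold I ∞ M] [T2Space M]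
  [RiemannianBundle (fun x : M ↦ TangentSpace I x)]
  [IsContMDiffRiemannianBundle I ∞ E (fun x : M ↦ TangentSpace I x)]

/-- Vanishing torsion turns the cyclic sum of curvature operators into the Jacobi identity for
vector fields. -/
theorem curvature_leviCivita_bianchi (x : M) (u v w : TangentSpace I x) :
    curvature (leviCivita I M) x u v w + curvature (leviCivita I M) x v w u +
      curvature (leviCivita I M) x w u v = 0 := by
  have : CompleteSpace E := FiniteDimensional.complete ℝ E
  have : IsManifold I (minSmoothness ℝ 3) M := by
    rw [minSmoothness_of_isRCLikeNormedField]; infer_instance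
  have h := isSmoothMetricConnection_leviCivita I M
  obtain ⟨X, hX, rfl⟩ := exists_contMDiff_section (I := I) (F := E) u
  obtain ⟨Y, hY, rfl⟩ := exists_contMDiff_section (I := I) (F := E) v
  obtain ⟨Z, hZ, rfl⟩ := exists_contMDiff_section (I := I) (F := E) w
  have hs {U : Π y : M, TangentSpace I y} (hU : CMDiff ∞ (T% U)) :
      CMDiffAt (minSmoothness ℝ 2) (T% U) x := by
    rw [minSmoothness_of_isRCLikeNormedField]; exact (hU x).of_le ENat.LEInfty.out
  -- Torsion-freeness is used twice: for Y, Z inside the derivative and for X, [Y, Z] outside it.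
  have key {X Y Z : Π y : M, TangentSpace I y} (hX : CMDiff ∞ (T% X)) (hY : CMDiff ∞ (T% Y))
      (hZ : CMDiff ∞ (T% Z)) :
      leviCivita I M (fun y ↦ leviCivita I M Z y (Y y)) x (X x) -
        leviCivita I M (fun y ↦ leviCivita I M Y y (Z y)) x (X x) -
        leviCivita I M X x (VectorField.mlieBracket I Y Z x) =
      VectorField.mlieBracket I X (VectorField.mlieBracket I Y Z) x := by
    rw [← leviCivita_torsion (hX.mdiffAt_section x) ((hY.mlieBracket hZ).mdiffAt_section x)]
    congr 1
    have h1 : (fun y ↦ leviCivita I M Z y (Y y)) =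
        VectorField.mlieBracket I Y Z + fun y ↦ leviCivita I M Y y (Z y) := by
      ext1 y
      rw [Pi.add_apply, ← leviCivita_torsion (hY.mdiffAt_section y) (hZ.mdiffAt_section y),
        sub_add_cancel]
    rw [h1, (leviCivita I M).isCovariantDerivativeOnUniv.add
      ((hY.mlieBracket hZ).mdiffAt_section x) ((contMDiff_leviCivita hZ hY).mdiffAt_section x),
      add_apply, add_sub_cancel_right]
  rw [h.curvature_eq_curvatureOp hX hY hZ, h.curvature_eq_curvatureOp hY hZ hX,
    h.curvature_eq_curvatureOp hZ hX hY]
  have h1 := key hX hY hZ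
  have h2 := key hY hZ hX
  have h3 := key hZ hX hY
  have h4 := VectorField.leibniz_identity_mlieBracket_apply (hs hX) (hs hY) (hs hZ)
  rw [VectorField.mlieBracket_swap_apply (V := VectorField.mlieBracket I X Y),
    VectorField.mlieBracket_swap (V := X) (W := Z)] at h4
  have h5 : VectorField.mlieBracket I Y (-VectorField.mlieBracket I Z X) x =
      -VectorField.mlieBracket I Y (VectorField.mlieBracket I Z X) x := by
    have := VectorField.mlieBracket_const_smul_right (V := Y) (c := (-1 : ℝ))
      ((hZ.mlieBracket hX).mdiffAt_section x)
    simpa using this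
  rw [h5, ← h1, ← h2, ← h3] at h4
  simp only [curvatureOp]
  rw [← sub_eq_zero] at h4
  rw [← h4]
  abel

theorem scalarCurvature_eq_sum {n : ℕ} {x : M}
    (e : OrthonormalBasis (Fin n) ℝ (TangentSpace I x)) :
    scalarCurvature I x =
      ∑ i, ∑ j, inner ℝ (curvature (leviCivita I M) x (e i) (e j) (e j)) (e i) := by
  have h := isSmoothMetricConnection_leviCivita I M
  have hr (u v v' w : TangentSpace I x) : curvature (leviCivita I M) x u (v + v') w =
      curvature (leviCivita I M) x u v w + curvature (leviCivita I M) x u v' w := by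
    rw [h.curvature_swap, h.curvature_add_left, h.curvature_swap x v, h.curvature_swap x v']
    abel
  have hr' (c : ℝ) (u v w : TangentSpace I x) : curvature (leviCivita I M) x u (c • v) w =
      c • curvature (leviCivita I M) x u v w := by
    rw [h.curvature_swap, h.curvature_smul_left, h.curvature_swap x v, smul_neg, neg_neg]
  let A (u : TangentSpace I x) : TangentSpace I x →ₗ[ℝ] TangentSpace I x →ₗ[ℝ] ℝ :=
    LinearMap.mk₂ ℝ (fun v w ↦ inner ℝ (curvature (leviCivita I M) x u v w) u)
      (fun v v' w ↦ by simp only [hr, inner_add_left])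
      (fun c v w ↦ by simp only [hr', real_inner_smul_left, smul_eq_mul])
      (fun v w w' ↦ by simp only [h.curvature_add_right, inner_add_left])
      (fun c v w ↦ by simp only [h.curvature_smul_right, real_inner_smul_left, smul_eq_mul])
  let A' (v : TangentSpace I x) : TangentSpace I x →ₗ[ℝ] TangentSpace I x →ₗ[ℝ] ℝ :=
    LinearMap.mk₂ ℝ (fun u u' ↦ inner ℝ (curvature (leviCivita I M) x u v v) u')
      (fun v v' w ↦ by simp only [h.curvature_add_left, inner_add_left])
      (fun c v w ↦ by simp only [h.curvature_smul_left, real_inner_smul_left, smul_eq_mul])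
      (fun v w w' ↦ by simp only [inner_add_right])
      (fun c v w ↦ by simp only [real_inner_smul_right, smul_eq_mul])
  have h1 (u : TangentSpace I x) := OrthonormalBasis.sum_apply_apply_eq (A u)
    (stdOrthonormalBasis ℝ (TangentSpace I x)) e
  have h2 (v : TangentSpace I x) := OrthonormalBasis.sum_apply_apply_eq (A' v)
    (stdOrthonormalBasis ℝ (TangentSpace I x)) e
  simp only [A, A', LinearMap.mk₂_apply] at h1 h2
  simp only [scalarCurvature, h1]
  rw [Finset.sum_comm]
  simp only [h2]
  rw [Finset.sum_comm]

theorem laplaceBeltrami_eq_sum_inner {n : ℕ} {x : M}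
    (e : OrthonormalBasis (Fin n) ℝ (TangentSpace I x)) (u : M → ℝ) :
    laplaceBeltrami I u x =
      ∑ i, inner ℝ (leviCivita I M (riemannianGradient I u) x (e i)) (e i) := by
  have h := OrthonormalBasis.sum_apply_apply_eq
    ((innerₗ (TangentSpace I x)).comp (leviCivita I M (riemannianGradient I u) x).toLinearMap)
    (stdOrthonormalBasis ℝ (TangentSpace I x)) e
  simpa [laplaceBeltrami] using h

variable (I) in
/-- The second covariant derivative `X (X u) - (∇_X X) u`. -/
def hessianAlong (X : Π x : M, TangentSpace I x) (u : M → ℝ) (x : M) : ℝ :=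
  mvfderiv I (fun y ↦ mvfderiv I u y (X y)) x (X x) - mvfderiv I u x (leviCivita I M X x (X x))

/-- Metric compatibility gives X⟨∇u, X⟩ = ⟨∇_X ∇u, X⟩ + ⟨∇u, ∇_X X⟩. The correction term in
`hessianAlong` lets the fields be orthonormal at x only and not parallel there. -/
theorem laplaceBeltrami_eq_sum_hessianAlong {n : ℕ} {x : M}
    (e : OrthonormalBasis (Fin n) ℝ (TangentSpace I x)) {X : Fin n → Π x : M, TangentSpace I x}
    (hX : ∀ i, CMDiff ∞ (T% (X i))) (hXe : ∀ i, X i x = e i) {u : M → ℝ} (hu : CMDiff ∞ u) :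
    laplaceBeltrami I u x = ∑ i, hessianAlong I (X i) u x := by
  rw [laplaceBeltrami_eq_sum_inner e]
  refine Finset.sum_congr rfl fun i _ ↦ ?_
  have h := leviCivita_metric ((hX i).mdiffAt_section x)
    ((contMDiff_riemannianGradient hu).mdiffAt_section x) ((hX i).mdiffAt_section x)
  simp only [inner_riemannianGradient] at h
  rw [hessianAlong, h, hXe]
  ring

/-- Near each point the trace is rewritten in a smooth orthonormal frame. Continuity is what makes
the minimum of R_f e^f exist on a compact manifold. -/
theorem continuous_scalarCurvature : Continuous (scalarCurvature I : M → ℝ) := by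
  have h := isSmoothMetricConnection_leviCivita I M
  rw [continuous_iff_continuousAt]
  intro x
  obtain ⟨X, hX, -, hb⟩ := exists_contMDiff_orthonormal (stdOrthonormalBasis ℝ (TangentSpace I x))
  have hc (i j) : Continuous
      (fun y ↦ inner ℝ (curvatureOp I (leviCivita I M) (X i) (X j) (X j) y) (X i y)) := by
    have h1 : CMDiff ∞ (T% (curvatureOp I (leviCivita I M) (X i) (X j) (X j))) :=
      ((contMDiff_leviCivita (hX i) (contMDiff_leviCivita (hX j) (hX j))).sub_section
        (contMDiff_leviCivita (hX j) (contMDiff_leviCivita (hX i) (hX j)))).sub_section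
        (contMDiff_leviCivita ((hX i).mlieBracket (hX j)) (hX j))
    exact (h1.inner_tangent (hX i)).continuous
  refine (continuous_finsetSum Finset.univ fun i _ ↦ continuous_finsetSum Finset.univ
    fun j _ ↦ hc i j).continuousAt.congr ?_
  filter_upwards [hb] with y ⟨b, hb⟩
  rw [scalarCurvature_eq_sum b]
  refine Finset.sum_congr rfl fun i _ ↦ Finset.sum_congr rfl fun j _ ↦ ?_
  rw [hb, hb, h.curvature_eq_curvatureOp (hX i) (hX j) (hX j)]

theorem continuous_laplaceBeltrami {u : M → ℝ} (hu : CMDiff ∞ u) :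
    Continuous (laplaceBeltrami I u) := by
  rw [continuous_iff_continuousAt]
  intro x
  obtain ⟨X, hX, -, hb⟩ := exists_contMDiff_orthonormal (stdOrthonormalBasis ℝ (TangentSpace I x))
  refine (continuous_finsetSum Finset.univ fun i _ ↦
    ((contMDiff_leviCivita (hX i) (contMDiff_riemannianGradient hu)).inner_tangent
      (hX i)).continuous).continuousAt.congr ?_
  filter_upwards [hb] with y ⟨b, hb⟩
  rw [laplaceBeltrami_eq_sum_inner b]
  exact Finset.sum_congr rfl fun i _ ↦ by rw [hb]

theorem continuous_weightedScalarCurvature {f : M → ℝ} (hf : CMDiff ∞ f) :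
    Continuous (weightedScalarCurvature I f) := by
  have h := ((contMDiff_riemannianGradient hf).inner_tangent
    (contMDiff_riemannianGradient hf)).continuous
  have h' : weightedScalarCurvature I f = fun x ↦ scalarCurvature I x +
      2 * (laplaceBeltrami I f x -
        inner ℝ (riemannianGradient I f x) (riemannianGradient I f x)) +
      inner ℝ (riemannianGradient I f x) (riemannianGradient I f x) := by
    ext x
    simp only [weightedScalarCurvature, weightedLaplacian, real_inner_self_eq_norm_sq]
  rw [h']
  exact (continuous_scalarCurvature.add
    (continuous_const.mul ((continuous_laplaceBeltrami hf).sub h))).add h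

end Traces

/-! ### Clifford products on half-spinors as quaternionic units. -/

section CliffordAlgebra

/-- The relations satisfied by the products `C i j = eᵢ eⱼ` of the vectors of an orthonormal basis
of a Euclidean 4-space, on the eigenspace of `-e₀ e₁ e₂ e₃` for the eigenvalue `s = ±1`. -/
structure IsCliffordTable {A : Type*} [Ring A] [Algebra ℂ A] (s : ℂ) (C : Fin 4 → Fin 4 → A) :
    Prop where
  sq : s ^ 2 = 1
  diag (i : Fin 4) : C i i = -1
  swap {i j : Fin 4} (hij : i ≠ j) : C i j = -C j i
  mul {i j : Fin 4} (hij : i ≠ j) (k : Fin 4) : C i j * C i k = C j k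
  chirality : C 0 1 * C 2 3 = -(s • (1 : A))

namespace IsCliffordTable

variable {A : Type*} [Ring A] [Algebra ℂ A] {s : ℂ} {C : Fin 4 → Fin 4 → A}
  (h : IsCliffordTable s C)
include h

theorem mul_self {j : Fin 4} (hj : 0 ≠ j) : C 0 j * C 0 j = -1 := by
  rw [h.mul hj, h.diag]

theorem anticomm {j k : Fin 4} (hj : 0 ≠ j) (hk : 0 ≠ k) (hjk : j ≠ k) :
    C 0 j * C 0 k = -(C 0 k * C 0 j) := by
  rw [h.mul hj, h.mul hk, h.swap hjk]

/-- Chirality identifies each product eᵢeⱼ with the complementary one up to sign. With the next two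
lemmas it leaves only the three units e₀e₁, e₀e₂, e₀e₃. -/
theorem apply_two_three : C 2 3 = s • C 0 1 := by
  have h1 : C 0 1 * (C 0 1 * C 2 3) = -C 2 3 := by
    rw [← mul_assoc, h.mul_self (by decide), neg_one_mul]
  rw [h.chirality, mul_neg, neg_inj, mul_smul_comm, mul_one] at h1
  exact h1.symm

theorem apply_one_three : C 1 3 = -(s • C 0 2) := by
  have h1 : C 0 2 * C 0 3 = s • C 0 1 := by rw [h.mul (by decide), h.apply_two_three]
  have h2 : s • C 0 1 * C 0 3 = -C 0 2 := by
    rw [← h1, mul_assoc, h.mul_self (by decide), mul_neg, mul_one]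
  rw [smul_mul_assoc, h.mul (by decide)] at h2
  rw [← smul_neg, ← h2, smul_smul, ← pow_two, h.sq, one_smul]

theorem apply_one_two : C 1 2 = s • C 0 3 := by
  have h1 : C 0 2 * C 0 3 = s • C 0 1 := by rw [h.mul (by decide), h.apply_two_three]
  have h2 : C 0 2 * (s • C 0 1) = -C 0 3 := by
    rw [← h1, ← mul_assoc, h.mul_self (by decide), neg_mul, one_mul]
  rw [mul_smul_comm, h.mul (by decide), h.swap (by decide), smul_neg, neg_inj] at h2
  rw [← h2, smul_smul, ← pow_two, h.sq, one_smul]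

/-- The three coefficients are twice the components of P visible to the eigenspace: the self-dual
ones for s = 1, the anti-self-dual ones for s = -1, duality being relative to the ordered basis. -/
theorem sum_smul {P : Fin 4 → Fin 4 → ℂ} (hP : ∀ i j, P i j = -P j i) :
    ∑ i, ∑ j, P i j • C i j = (2 * (P 0 1 + s * P 2 3)) • C 0 1 +
      (2 * (P 0 2 - s * P 1 3)) • C 0 2 + (2 * (P 0 3 + s * P 1 2)) • C 0 3 := by
  have hd (i) : P i i = 0 := self_eq_neg.1 (hP i i)
  simp only [Fin.sum_univ_four, hd, hP 1 0, hP 2 0, hP 3 0, hP 2 1, hP 3 1, hP 3 2,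
    h.swap (show (1 : Fin 4) ≠ 0 by decide), h.swap (show (2 : Fin 4) ≠ 0 by decide),
    h.swap (show (3 : Fin 4) ≠ 0 by decide), h.swap (show (2 : Fin 4) ≠ 1 by decide),
    h.swap (show (3 : Fin 4) ≠ 1 by decide), h.swap (show (3 : Fin 4) ≠ 2 by decide),
    h.apply_two_three, h.apply_one_three, h.apply_one_two]
  module

theorem sum_Ioi_smul (P : Fin 4 → Fin 4 → ℂ) :
    ∑ i, ∑ j ∈ Finset.Ioi i, P i j • C i j = (P 0 1 + s * P 2 3) • C 0 1 +
      (P 0 2 - s * P 1 3) • C 0 2 + (P 0 3 + s * P 1 2) • C 0 3 := by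
  have h0 : Finset.Ioi (0 : Fin 4) = {1, 2, 3} := by decide
  have h1 : Finset.Ioi (1 : Fin 4) = {2, 3} := by decide
  have h2 : Finset.Ioi (2 : Fin 4) = {3} := by decide
  have h3 : Finset.Ioi (3 : Fin 4) = ∅ := by decide
  simp [Fin.sum_univ_four, h0, h1, h2, h3, h.apply_two_three, h.apply_one_three, h.apply_one_two]
  module

theorem mul_table : C 0 1 * C 0 2 = s • C 0 3 ∧ C 0 2 * C 0 1 = -(s • C 0 3) ∧
    C 0 2 * C 0 3 = s • C 0 1 ∧ C 0 3 * C 0 2 = -(s • C 0 1) ∧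
    C 0 3 * C 0 1 = s • C 0 2 ∧ C 0 1 * C 0 3 = -(s • C 0 2) := by
  refine ⟨?_, ?_, ?_, ?_, ?_, ?_⟩ <;> rw [h.mul (by decide)]
  · exact h.apply_one_two
  · rw [h.swap (by decide), h.apply_one_two]
  · exact h.apply_two_three
  · rw [h.swap (by decide), h.apply_two_three]
  · rw [h.swap (by decide), h.apply_one_three, neg_neg]
  · exact h.apply_one_three

end IsCliffordTable

/-- The algebraic symmetries of a curvature tensor. -/
structure IsCurvatureTensor (R : Fin 4 → Fin 4 → Fin 4 → Fin 4 → ℂ) : Prop where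
  skew_left (i j k l) : R i j k l = -R j i k l
  skew_right (i j k l) : R i j k l = -R i j l k
  bianchi (i j k l) : R i j k l + R j k i l + R k i j l = 0

/-- The usual octahedron argument: half the sum of four Bianchi identities, up to skew symmetries.
-/
theorem IsCurvatureTensor.pair_symm {R : Fin 4 → Fin 4 → Fin 4 → Fin 4 → ℂ}
    (hR : IsCurvatureTensor R) (i j k l : Fin 4) : R i j k l = R k l i j := by
  linear_combination (1 / 2 : ℂ) * (hR.bianchi j k i l + hR.bianchi k i l j + hR.bianchi i l j k +
    hR.bianchi l j k i - hR.skew_right j k i l - hR.skew_right k i j l - hR.skew_right i l k j -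
    hR.skew_right l j i k + hR.skew_right i j k l - hR.skew_left i j l k - hR.skew_left l k i j -
    hR.skew_right k l i j)

variable {A : Type*} [Ring A] [Algebra ℂ A] {s : ℂ} {C : Fin 4 → Fin 4 → A}

/-- In the quaternionic units, the coefficients of e₀e₁, e₀e₂, e₀e₃ cancel by pair symmetry. In the
coefficient of 1 the part proportional to s vanishes by the Bianchi identity, and the Ricci-type
trace remains. -/
theorem IsCliffordTable.sum_curvature (h : IsCliffordTable s C)
    {R : Fin 4 → Fin 4 → Fin 4 → Fin 4 → ℂ} (hR : IsCurvatureTensor R) :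
    ∑ i, ∑ j, C i j * ∑ k, ∑ l, R i j k l • C k l = (2 * ∑ i, ∑ j, R i j j i) • (1 : A) := by
  obtain ⟨m1, m2, m3, m4, m5, m6⟩ := h.mul_table
  have q1 := h.mul_self (j := 1) (by decide)
  have q2 := h.mul_self (j := 2) (by decide)
  have q3 := h.mul_self (j := 3) (by decide)
  have h1 (i j) := h.sum_smul (hR.skew_right i j)
  have h2 (P : Fin 4 → Fin 4 → ℂ) (x : A) :
      ∑ i, ∑ j, C i j * (P i j • x) = (∑ i, ∑ j, P i j • C i j) * x := by
    simp only [Finset.sum_mul, mul_smul_comm, smul_mul_assoc]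
  have hd (i k l) : R i i k l = 0 := self_eq_neg.1 (hR.skew_left i i k l)
  simp only [h1, mul_add, Finset.sum_add_distrib, h2]
  rw [h.sum_smul (fun i j ↦ by rw [hR.skew_left i j 0 1, hR.skew_left i j 2 3]; ring),
    h.sum_smul (fun i j ↦ by rw [hR.skew_left i j 0 2, hR.skew_left i j 1 3]; ring),
    h.sum_smul (fun i j ↦ by rw [hR.skew_left i j 0 3, hR.skew_left i j 1 2]; ring)]
  simp only [add_mul, smul_mul_assoc, m1, m2, m3, m4, m5, m6, q1, q2, q3]
  simp only [Fin.sum_univ_four, hd, hR.skew_left 1 0, hR.skew_left 2 0, hR.skew_left 3 0,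
    hR.skew_left 2 1, hR.skew_left 3 1, hR.skew_left 3 2, hR.skew_right _ _ 1 0,
    hR.skew_right _ _ 2 0, hR.skew_right _ _ 3 0, hR.skew_right _ _ 2 1, hR.skew_right _ _ 3 1,
    hR.skew_right _ _ 3 2]
  match_scalars
  · linear_combination (-4 * (R 2 3 2 3 + R 1 3 1 3 + R 1 2 1 2)) * h.sq - 4 * s *
      (2 * hR.bianchi 0 1 2 3 + hR.pair_symm 2 3 0 1 - hR.pair_symm 1 3 0 2 -
      2 * hR.skew_left 2 0 1 3 - hR.pair_symm 1 2 0 3)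
  · linear_combination (-4 * s) *
      (hR.pair_symm 0 2 0 1 + s * hR.pair_symm 0 2 2 3 - s * hR.pair_symm 1 3 0 1 -
        s ^ 2 * hR.pair_symm 1 3 2 3)
  · linear_combination (-4 * s) *
      (hR.pair_symm 0 1 0 3 + s * hR.pair_symm 0 1 1 2 + s * hR.pair_symm 2 3 0 3 +
        s ^ 2 * hR.pair_symm 2 3 1 2)
  · linear_combination (-4 * s) *
      (hR.pair_symm 0 3 0 2 - s * hR.pair_symm 0 3 1 3 + s * hR.pair_symm 1 2 0 2 -
        s ^ 2 * hR.pair_symm 1 2 1 3)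

/-- Eigenvalues of a are ±i, and b exchanges the two eigenspaces because it anticommutes with a. So
some v ≠ 0 satisfies a v = i v, and v, b v is the basis. -/
theorem exists_quaternionic_basis {W : Type*} [AddCommGroup W] [Module ℂ W]
    (hW : Module.finrank ℂ W = 2) {a b : Module.End ℂ W} (ha : a * a = -1) (hb : b * b = -1)
    (hab : a * b = -(b * a)) :
    ∃ e : Module.Basis (Fin 2) ℂ W, a (e 0) = Complex.I • e 0 ∧ a (e 1) = -(Complex.I • e 1) ∧
      b (e 0) = e 1 ∧ b (e 1) = -e 0 := by
  have : Module.Finite ℂ W := Module.finite_of_finrank_eq_succ hW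
  have : Nontrivial W := Module.nontrivial_of_finrank_pos (R := ℂ) (by omega)
  have ha' (v : W) : a (a v) = -v := LinearMap.congr_fun ha v
  have hb' (v : W) : b (b v) = -v := LinearMap.congr_fun hb v
  have hab' (v : W) : a (b v) = -b (a v) := LinearMap.congr_fun hab v
  have hv : ∃ v : W, v ≠ 0 ∧ a v = Complex.I • v := by
    obtain ⟨μ, hμ⟩ := Module.End.exists_eigenvalue a
    obtain ⟨v, hv⟩ := hμ.exists_hasEigenvector
    have hv0 := hv.2
    have hv1 := hv.apply_eq_smul
    have h1 : (μ * μ + 1) • v = 0 := by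
      have := ha' v
      rw [hv1, map_smul, hv1, smul_smul] at this
      rw [add_smul, this, one_smul, neg_add_cancel]
    have h2 : (μ - Complex.I) * (μ + Complex.I) = 0 := by
      have h3 := (smul_eq_zero.1 h1).resolve_right hv0
      linear_combination h3 - Complex.I_mul_I
    rcases mul_eq_zero.1 h2 with h3 | h3
    · exact ⟨v, hv0, by rw [hv1, sub_eq_zero.1 h3]⟩
    · refine ⟨b v, fun h ↦ hv0 ?_, ?_⟩
      · rw [← neg_eq_zero, ← hb', h, map_zero]
      · rw [hab', hv1, map_smul, eq_neg_of_add_eq_zero_left h3, neg_smul, neg_neg]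
  obtain ⟨v, hv0, hv⟩ := hv
  have hbv : a (b v) = -(Complex.I • b v) := by rw [hab', hv, map_smul]
  have hbv0 : b v ≠ 0 := fun h ↦ hv0 (by rw [← neg_eq_zero, ← hb', h, map_zero])
  have hli : LinearIndependent ℂ ![v, b v] := by
    rw [LinearIndependent.pair_iff]
    intro x y hxy
    have h1 := congr_arg a hxy
    rw [map_add, map_smul, map_smul, hv, hbv, map_zero] at h1
    have h2 : (2 * Complex.I * x) • v = 0 := by
      calc (2 * Complex.I * x) • v = Complex.I • (x • v + y • b v) +
            (x • Complex.I • v + y • -(Complex.I • b v)) := by module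
        _ = 0 := by rw [hxy, h1, smul_zero, add_zero]
    have hx : x = 0 := by simpa [hv0] using h2
    rw [hx, zero_smul, zero_add] at hxy
    exact ⟨hx, (smul_eq_zero.1 hxy).resolve_right hbv0⟩
  refine ⟨basisOfLinearIndependentOfCardEqFinrank hli (by simp [hW]), ?_, ?_, ?_, ?_⟩ <;>
    simp [hv, hbv, hb']

/-- Endomorphisms of a complex plane commuting with a quaternionic structure are scalar. -/
theorem eq_smul_one_of_commute {W : Type*} [AddCommGroup W] [Module ℂ W]
    (hW : Module.finrank ℂ W = 2) {a b T : Module.End ℂ W} (ha : a * a = -1) (hb : b * b = -1)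
    (hab : a * b = -(b * a)) (hTa : T * a = a * T) (hTb : T * b = b * T) :
    ∃ z : ℂ, T = z • (1 : Module.End ℂ W) := by
  obtain ⟨e, h1, h2, h3, h4⟩ := exists_quaternionic_basis hW ha hb hab
  have hT0 : T (e 0) = e.repr (T (e 0)) 0 • e 0 + e.repr (T (e 0)) 1 • e 1 := by
    conv_lhs => rw [← e.sum_repr (T (e 0)), Fin.sum_univ_two]
  have h5 := LinearMap.congr_fun hTa (e 0)
  simp only [Module.End.mul_apply, h1, map_smul] at h5
  -- Commuting with a, T preserves the i-eigenspace; commuting with b carries the same scalar over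
  -- to e 1 = b (e 0).
  have h6 : e.repr (T (e 0)) 1 = 0 := by
    have h7 := congr_arg (fun v ↦ e.repr v 1) h5
    rw [hT0] at h7
    simp [h1, h2] at h7
    have : (2 * Complex.I) * e.repr (T (e 0)) 1 = 0 := by linear_combination h7
    simpa using this
  refine ⟨e.repr (T (e 0)) 0, e.ext fun i ↦ ?_⟩
  rw [h6, zero_smul, add_zero] at hT0
  have h8 := LinearMap.congr_fun hTb (e 0)
  simp only [Module.End.mul_apply, h3] at h8
  fin_cases i
  · simpa using hT0
  · simp only [Fin.mk_one, LinearMap.smul_apply, Module.End.one_apply]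
    rw [h8]
    conv_lhs => rw [hT0, map_smul, h3]

/-- The quaternionic units are trace-free: they act trivially on `Λ²`. -/
theorem alternating_apply_add_eq_zero {W L : Type*} [AddCommGroup W] [Module ℂ W] [AddCommGroup L]
    [Module ℂ L] (hW : Module.finrank ℂ W = 2) {a b : Module.End ℂ W} (ha : a * a = -1)
    (hb : b * b = -1) (hab : a * b = -(b * a)) (B : W →ₗ[ℂ] W →ₗ[ℂ] L) (hB : ∀ v, B v v = 0)
    (v w : W) : B (a v) w + B v (a w) = 0 := by
  obtain ⟨e, h1, h2, -, -⟩ := exists_quaternionic_basis hW ha hb hab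
  have h3 : B (e 1) (e 0) = -B (e 0) (e 1) := by
    have := hB (e 0 + e 1)
    simp only [map_add, LinearMap.add_apply, hB, zero_add, add_zero] at this
    exact eq_neg_of_add_eq_zero_left (by rw [← this])
  rw [← e.sum_repr v, ← e.sum_repr w]
  simp only [Fin.sum_univ_two, map_add, map_smul, map_neg, h1, h2, LinearMap.add_apply,
    LinearMap.smul_apply, LinearMap.neg_apply, hB, h3]
  module

end CliffordAlgebra

/-! ### Reconstruction of the spin curvature from its commutators and trace. -/

section SpinCurvature

variable {W L : Type*} [AddCommGroup W] [Module ℂ W] [AddCommGroup L] [Module ℂ L]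
  {s : ℂ} {C : Fin 4 → Fin 4 → Module.End ℂ W}

/-- A derivation-like endomorphism `T` of the positive spinors is determined by the skew matrix `ρ`
by which it acts on vectors and by its trace. -/
theorem IsCliffordTable.eq_of_commutator (h : IsCliffordTable s C) (hW : Module.finrank ℂ W = 2)
    {T : Module.End ℂ W} {ρ : Fin 4 → Fin 4 → ℂ} (hρ : ∀ i j, ρ i j = -ρ j i)
    (hT : ∀ k l, T * C k l = C k l * T + ∑ m, ρ k m • C m l + ∑ m, ρ l m • C k m)
    (B : W →ₗ[ℂ] W →ₗ[ℂ] L) (hB : ∀ v, B v v = 0) (hB0 : ∃ v w, B v w ≠ 0) {F : ℂ}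
    (hF : ∀ v w, B (T v) w + B v (T w) = F • B v w) :
    T = (F / 2) • 1 + (1 / 4 : ℂ) • ∑ k, ∑ l, ρ k l • C k l := by
  obtain ⟨m1, m2, m3, m4, m5, m6⟩ := h.mul_table
  have q1 := h.mul_self (j := 1) (by decide)
  have q2 := h.mul_self (j := 2) (by decide)
  have q3 := h.mul_self (j := 3) (by decide)
  have hab := h.anticomm (j := 1) (k := 2) (by decide) (by decide) (by decide)
  have hbc := h.anticomm (j := 2) (k := 3) (by decide) (by decide) (by decide)
  have hca := h.anticomm (j := 3) (k := 1) (by decide) (by decide) (by decide)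
  have hd (i) : ρ i i = 0 := self_eq_neg.1 (hρ i i)
  -- The quarter sum already has the prescribed commutators, so the remainder U commutes with e₀e₁
  -- and e₀e₂ and is therefore a scalar.
  obtain ⟨U, hU⟩ : ∃ U, T = U + (1 / 4 : ℂ) • ∑ k, ∑ l, ρ k l • C k l :=
    ⟨T - (1 / 4 : ℂ) • ∑ k, ∑ l, ρ k l • C k l, by abel⟩
  rw [h.sum_smul hρ] at hU
  have hUa : U * C 0 1 = C 0 1 * U := by
    have h1 := hT 0 1
    rw [hU] at h1
    simp only [Fin.sum_univ_four, hd, hρ 1 0, h.swap (show (2 : Fin 4) ≠ 1 by decide),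
      h.swap (show (3 : Fin 4) ≠ 1 by decide), h.diag, h.apply_one_two,
      h.apply_one_three, add_mul, mul_add, smul_add, smul_mul_assoc,
      mul_smul_comm, m1, m2, m5, m6, q1] at h1
    rw [← sub_eq_zero] at h1 ⊢
    rw [← h1]
    match_scalars
    · ring
    · ring
    · ring
    · linear_combination (-ρ 1 3) * h.sq
    · linear_combination (-ρ 1 2) * h.sq
    · ring
  have hUb : U * C 0 2 = C 0 2 * U := by
    have h1 := hT 0 2
    rw [hU] at h1
    simp only [Fin.sum_univ_four, hd, hρ 2 0, hρ 2 1, h.swap (show (3 : Fin 4) ≠ 2 by decide),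
      h.diag, h.apply_one_two,
      h.apply_two_three, add_mul, mul_add, smul_add, smul_mul_assoc,
      mul_smul_comm, m1, m2, m3, m4, q2] at h1
    rw [← sub_eq_zero] at h1 ⊢
    rw [← h1]
    match_scalars
    · ring
    · ring
    · linear_combination (-ρ 2 3) * h.sq
    · ring
    · linear_combination (ρ 1 2) * h.sq
    · ring
  obtain ⟨z, hz⟩ := eq_smul_one_of_commute hW q1 q2 hab hUa hUb
  -- The three units are trace-free, so only the scalar z contributes to the action on Λ². There it
  -- acts as 2z, whence z = F/2.
  have ta := alternating_apply_add_eq_zero hW q1 q2 hab B hB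
  have tb := alternating_apply_add_eq_zero hW q2 q3 hbc B hB
  have tc := alternating_apply_add_eq_zero hW q3 q1 hca B hB
  obtain ⟨v, w, hvw⟩ := hB0
  have h2 := hF v w
  rw [hU, hz] at h2
  simp only [LinearMap.add_apply, LinearMap.smul_apply, Module.End.one_apply, map_add,
    map_smul] at h2
  have h3 : (2 * z - F) • B v w = 0 := by
    rw [sub_smul, ← h2, eq_neg_of_add_eq_zero_left (ta v w), eq_neg_of_add_eq_zero_left (tb v w),
      eq_neg_of_add_eq_zero_left (tc v w)]
    module
  have h4 : 2 * z - F = 0 := (smul_eq_zero.1 h3).resolve_right hvw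
  rw [h.sum_smul hρ, hU, hz, show F / 2 = z by linear_combination (-1 / 2) * h4]

/-- The zeroth order term of the Weitzenböck formula. -/
theorem IsCliffordTable.sum_mul_curvature (h : IsCliffordTable s C)
    {R : Fin 4 → Fin 4 → Fin 4 → Fin 4 → ℂ} (hR : IsCurvatureTensor R)
    {K : Fin 4 → Fin 4 → Module.End ℂ W} {F : Fin 4 → Fin 4 → ℂ}
    (hK : ∀ i j, K i j = (F i j / 2) • 1 + (1 / 4 : ℂ) • ∑ k, ∑ l, R i j k l • C k l) :
    ∑ i, ∑ j, C i j * K i j = (1 / 2 : ℂ) • ∑ i, ∑ j, F i j • C i j +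
      (1 / 2 * ∑ i, ∑ j, R i j j i) • 1 := by
  have h1 := h.sum_curvature hR
  simp only [hK, mul_add, mul_smul_comm, mul_one, Finset.sum_add_distrib, ← Finset.smul_sum, h1]
  congr 1
  · simp only [Finset.smul_sum, smul_smul]
    exact Finset.sum_congr rfl fun i _ ↦ Finset.sum_congr rfl fun j _ ↦ by congr 1; ring
  · rw [smul_smul]
    congr 1
    ring

/-- On positive spinors a 2-form acts through its self-dual part. -/
theorem IsCliffordTable.sum_selfDual (h : IsCliffordTable s C) {F S : Fin 4 → Fin 4 → ℂ}
    (hF : ∀ i j, F i j = -F j i) (h1 : S 0 1 = s * F 2 3) (h2 : S 2 3 = s * F 0 1)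
    (h3 : S 0 2 = -(s * F 1 3)) (h4 : S 1 3 = -(s * F 0 2)) (h5 : S 0 3 = s * F 1 2)
    (h6 : S 1 2 = s * F 0 3) :
    ∑ i, ∑ j ∈ Finset.Ioi i, (1 / 2 * (F i j + S i j)) • C i j =
      (1 / 2 : ℂ) • ∑ i, ∑ j, F i j • C i j := by
  rw [h.sum_smul hF, h.sum_Ioi_smul fun i j ↦ 1 / 2 * (F i j + S i j), h1, h2, h3, h4, h5, h6]
  match_scalars
  · linear_combination (1 / 2 * F 0 1) * h.sq
  · linear_combination (1 / 2 * F 0 2) * h.sq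
  · linear_combination (1 / 2 * F 0 3) * h.sq

end SpinCurvature

/-! ### Unitary connections as real metric connections. -/

theorem mvfderiv_comp_of_hasFDerivAt {E : Type*} [NormedAddCommGroup E] [NormedSpace ℝ E]
    {H : Type*} [TopologicalSpace H] {I : ModelWithCorners ℝ E H} {M : Type*} [TopologicalSpace M]
    [ChartedSpace H M] {W W' : Type*} [NormedAddCommGroup W] [NormedSpace ℝ W]
    [NormedAddCommGroup W'] [NormedSpace ℝ W'] {g : M → W} {k : W → W'} {k' : W →L[ℝ] W'} {x : M}
    (hk : HasFDerivAt k k' (g x)) (hg : MDifferentiableAt I 𝓘(ℝ, W) g x) (v : TangentSpace I x) :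
    mvfderiv I (fun y ↦ k (g y)) x v = k' (mvfderiv I g x v) := by
  have h1 := (hk.hasMFDerivAt.comp x hg.hasMFDerivAt).mfderiv
  exact DFunLike.congr_fun h1 v

section UnitaryConnections

variable {M : Type*} [TopologicalSpace M] [ChartedSpace (EuclideanSpace ℝ (Fin 4)) M]
  [IsManifold (𝓡 4) ∞ M] [T2Space M]
  {F : Type*} [NormedAddCommGroup F] [NormedSpace ℝ F]
  {V : M → Type*} [TopologicalSpace (TotalSpace F V)] [∀ x, NormedAddCommGroup (V x)]
  [∀ x, InnerProductSpace ℂ (V x)] [FiberBundle F V] [VectorBundle ℝ F V]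
  [NormedSpace ℂ F] [SMulCommClass ℝ ℂ F] [VectorBundle ℂ F V]
  [ContMDiffVectorBundle ∞ F V (𝓡 4)] [IsSmoothHermitianBundle F V]

theorem ContMDiff.inner_hermitian {σ τ : Π x : M, V x}
    (hσ : ContMDiff (𝓡 4) ((𝓡 4).prod 𝓘(ℝ, F)) ∞ (fun y ↦ TotalSpace.mk' F y (σ y)))
    (hτ : ContMDiff (𝓡 4) ((𝓡 4).prod 𝓘(ℝ, F)) ∞ (fun y ↦ TotalSpace.mk' F y (τ y))) :
    ContMDiff (𝓡 4) 𝓘(ℝ, ℂ) ∞ (fun y ↦ (inner ℂ (σ y) (τ y) : ℂ)) := by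
  obtain ⟨h, hh, hi⟩ := IsSmoothHermitianBundle.exists_contMDiff (F := F) (V := V)
  have h1 := ContMDiff.clm_bundle_apply₂ (E₃ := fun _ : M ↦ ℂ) (F₃ := ℂ) hh hσ hτ
  intro x
  have h2 := h1 x
  rw [contMDiffAt_totalSpace] at h2
  simpa [hi] using h2.2

/-- The trivializations are complex-linear, so in them multiplication by i is the same constant
real-linear map of the model fibre. -/
theorem ContMDiff.I_smul_section {σ : Π x : M, V x}
    (hσ : ContMDiff (𝓡 4) ((𝓡 4).prod 𝓘(ℝ, F)) ∞ (fun y ↦ TotalSpace.mk' F y (σ y))) :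
    ContMDiff (𝓡 4) ((𝓡 4).prod 𝓘(ℝ, F)) ∞
      (fun y ↦ TotalSpace.mk' F y (Complex.I • σ y)) := by
  intro x
  have h1 := hσ x
  rw [Bundle.contMDiffAt_section] at h1 ⊢
  have h2 := ((Complex.I • ContinuousLinearMap.id ℝ F).contMDiff (n := ∞)).contMDiffAt.comp x h1
  refine h2.congr_of_eventuallyEq ?_
  filter_upwards [(trivializationAt F V x).open_baseSet.mem_nhds
    (FiberBundle.mem_baseSet_trivializationAt F V x)] with y hy
  exact ((trivializationAt F V x).linear ℂ hy).map_smul Complex.I (σ y)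

namespace IsUnitaryConnection

variable {cov : CovariantDerivative (𝓡 4) F V} (h : IsUnitaryConnection cov)
include h

/-- The real part of the Hermitian product is a parallel nondegenerate real form, so the real theory
above applies; complex linearity of the curvature is recovered separately from its commuting with i.
-/
theorem isSmoothMetricConnection :
    IsSmoothMetricConnection cov (fun x (v w : V x) ↦ (inner ℂ v w : ℂ).re) where
  contMDiff {σ X} hσ hX := by
    have h1 := h.contMDiff.contMDiff.contMDiff (σ := σ) hσ.contMDiffOn
    rw [contMDiffOn_univ] at h1
    exact h1.clm_bundle_apply hX
  add_left x v v' w := by simp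
  add_right x v w w' := by simp
  nondegenerate x v hv := by
    have h1 := hv v
    rw [inner_self_eq_norm_sq_to_K] at h1
    simpa [← Complex.ofReal_pow] using h1
  contMDiff_form hσ hτ := Complex.reCLM.contMDiff.comp (hσ.inner_hermitian hτ)
  parallel {σ τ} hσ hτ x v := by
    have h1 := h.metric (hσ.mdiffAt_section x) (hτ.mdiffAt_section x) v
    have h2 := ((hσ.inner_hermitian hτ) x).mdifferentiableAt (by simp)
    have h3 : mvfderiv (𝓡 4) (fun y ↦ (inner ℂ (σ y) (τ y) : ℂ).re) x v =
        (mvfderiv (𝓡 4) (fun y ↦ (inner ℂ (σ y) (τ y) : ℂ)) x v).re := by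
      exact mvfderiv_comp_of_hasFDerivAt (Complex.reCLM.hasFDerivAt) h2 v
    rw [h3, h1, Complex.add_re]

theorem curvature_smul_I (x : M) (u v : TangentSpace (𝓡 4) x) (s : V x) :
    curvature cov x u v (Complex.I • s) = Complex.I • curvature cov x u v s := by
  have hm := h.isSmoothMetricConnection
  obtain ⟨X, hX, rfl⟩ := exists_contMDiff_section (I := 𝓡 4) (F := EuclideanSpace ℝ (Fin 4)) u
  obtain ⟨Y, hY, rfl⟩ := exists_contMDiff_section (I := 𝓡 4) (F := EuclideanSpace ℝ (Fin 4)) v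
  obtain ⟨σ, hσ, rfl⟩ := exists_contMDiff_section (I := 𝓡 4) (F := F) s
  have hc {τ : Π x : M, V x}
      (hτ : ContMDiff (𝓡 4) ((𝓡 4).prod 𝓘(ℝ, F)) ∞ (fun y ↦ TotalSpace.mk' F y (τ y))) (y : M)
      (v : TangentSpace (𝓡 4) y) :
      cov (fun y ↦ Complex.I • τ y) y v = Complex.I • cov τ y v := h.smul_I (hτ.mdiffAt_section y) v
  refine (hm.curvature_eq_curvatureOp hX hY (hσ.I_smul_section) x).trans ?_
  rw [hm.curvature_eq_curvatureOp hX hY hσ]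
  simp only [curvatureOp, hc hσ, hc (hm.contMDiff hσ hX), hc (hm.contMDiff hσ hY), smul_sub]

/-- The curvature of a unitary connection as a complex-linear endomorphism. -/
def curvatureEnd (x : M) (u v : TangentSpace (𝓡 4) x) : Module.End ℂ (V x) where
  toFun s := curvature cov x u v s
  map_add' := h.isSmoothMetricConnection.curvature_add_right x u v
  map_smul' z s := by
    have hm := h.isSmoothMetricConnection
    conv_lhs => rw [← Complex.re_add_im z]
    rw [add_smul, hm.curvature_add_right, mul_smul, Complex.coe_smul, Complex.coe_smul,
      hm.curvature_smul_right, hm.curvature_smul_right, h.curvature_smul_I]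
    conv_rhs => rw [RingHom.id_apply, ← Complex.re_add_im z]
    rw [add_smul, mul_smul, Complex.coe_smul, Complex.coe_smul]

end IsUnitaryConnection
end UnitaryConnections

/-! ### The Hodge star in an orthonormal basis of either orientation. -/

section VolumeForm

variable {U : Type*} [AddCommGroup U] [Module ℝ U]

/-- Only permutations of e₀, e₁, e₂, e₃ survive in G. Keeping the factor G e avoids assuming the
basis oriented; for the volume form it is the sign s of the Clifford table. -/
theorem AlternatingMap.hodge_sum {G : U [⋀^Fin 4]→ₗ[ℝ] ℝ} (e : Fin 4 → U) {α : Fin 4 → Fin 4 → ℂ}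
    (hα : ∀ i j, α i j = -α j i) :
    let V (k l : Fin 4) : ℂ := 1 / 2 * ∑ i, ∑ j, α i j * (G ![e i, e j, e k, e l] : ℝ)
    V 0 1 = G e * α 2 3 ∧ V 2 3 = G e * α 0 1 ∧ V 0 2 = -(G e * α 1 3) ∧
      V 1 3 = -(G e * α 0 2) ∧ V 0 3 = G e * α 1 2 ∧ V 1 2 = G e * α 0 3 := by
  have s1 (a b c d : U) : G ![b, a, c, d] = -G ![a, b, c, d] := by
    rw [← G.map_swap _ (show (0 : Fin 4) ≠ 1 by decide)]
    congr 1
    ext i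
    fin_cases i <;> rfl
  have s2 (a b c d : U) : G ![a, c, b, d] = -G ![a, b, c, d] := by
    rw [← G.map_swap _ (show (1 : Fin 4) ≠ 2 by decide)]
    congr 1
    ext i
    fin_cases i <;> rfl
  have s3 (a b c d : U) : G ![a, b, d, c] = -G ![a, b, c, d] := by
    rw [← G.map_swap _ (show (2 : Fin 4) ≠ 3 by decide)]
    congr 1
    ext i
    fin_cases i <;> rfl
  have z1 (a b c : U) : G ![a, a, b, c] = 0 := self_eq_neg.1 (s1 a a b c)
  have z2 (a b c : U) : G ![b, a, a, c] = 0 := self_eq_neg.1 (s2 b a a c)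
  have z4 (a b c : U) : G ![a, b, a, c] = 0 := by rw [s1, z2, neg_zero]
  have z5 (a b c : U) : G ![a, b, c, a] = 0 := by rw [s3, z4, neg_zero]
  have z6 (a b c : U) : G ![b, a, c, a] = 0 := by rw [s3, z2, neg_zero]
  have he : G e = G ![e 0, e 1, e 2, e 3] := by
    congr 1
    ext i
    fin_cases i <;> rfl
  have v1 : G ![e 2, e 3, e 0, e 1] = G e := by rw [he, s2, s1, s3, s2]; ring
  have v2 : G ![e 1, e 3, e 0, e 2] = -G e := by rw [he, s2, s3, s1]; ring
  have v3 : G ![e 1, e 2, e 0, e 3] = G e := by rw [he, s2, s1]; ring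
  have v4 : G ![e 0, e 2, e 1, e 3] = -G e := by rw [he, s2]
  have v5 : G ![e 0, e 3, e 1, e 2] = G e := by rw [he, s2, s3]; ring
  intro V
  refine ⟨?_, ?_, ?_, ?_, ?_, ?_⟩ <;>
    simp only [V, Fin.sum_univ_four, z1, z2, z4, z5, z6, ← he, v1, v2, v3, v4, v5,
      s1 (e 0) (e 1), s1 (e 0) (e 2), s1 (e 0) (e 3), s1 (e 1) (e 2), s1 (e 1) (e 3),
      s1 (e 2) (e 3), hα 1 0, hα 2 0, hα 3 0, hα 2 1, hα 3 1, hα 3 2] <;> push_cast <;> ring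

end VolumeForm

/-! ### Clifford multiplication of a spin-c structure in a fixed basis. -/

section Spinc

variable {M : Type*} [TopologicalSpace M] [ChartedSpace (EuclideanSpace ℝ (Fin 4)) M]
  [IsManifold (𝓡 4) ∞ M]
  [RiemannianBundle (fun x : M ↦ TangentSpace (𝓡 4) x)]
  [IsContMDiffRiemannianBundle (𝓡 4) ∞ (EuclideanSpace ℝ (Fin 4))
    (fun x : M ↦ TangentSpace (𝓡 4) x)]
variable
  {Wp : M → Type*} [TopologicalSpace (TotalSpace (EuclideanSpace ℂ (Fin 2)) Wp)]
  [∀ x, NormedAddCommGroup (Wp x)] [∀ x, InnerProductSpace ℂ (Wp x)]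
  [FiberBundle (EuclideanSpace ℂ (Fin 2)) Wp] [VectorBundle ℂ (EuclideanSpace ℂ (Fin 2)) Wp]
  [VectorBundle ℝ (EuclideanSpace ℂ (Fin 2)) Wp]
  [ContMDiffVectorBundle ∞ (EuclideanSpace ℂ (Fin 2)) Wp (𝓡 4)]
  [IsSmoothHermitianBundle (EuclideanSpace ℂ (Fin 2)) Wp]
  {Wm : M → Type*} [TopologicalSpace (TotalSpace (EuclideanSpace ℂ (Fin 2)) Wm)]
  [∀ x, NormedAddCommGroup (Wm x)] [∀ x, InnerProductSpace ℂ (Wm x)]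
  [FiberBundle (EuclideanSpace ℂ (Fin 2)) Wm] [VectorBundle ℂ (EuclideanSpace ℂ (Fin 2)) Wm]
  [VectorBundle ℝ (EuclideanSpace ℂ (Fin 2)) Wm]
  [ContMDiffVectorBundle ∞ (EuclideanSpace ℂ (Fin 2)) Wm (𝓡 4)]
  [IsSmoothHermitianBundle (EuclideanSpace ℂ (Fin 2)) Wm]
  {L : M → Type*} [TopologicalSpace (TotalSpace ℂ L)]
  [∀ x, NormedAddCommGroup (L x)] [∀ x, InnerProductSpace ℂ (L x)]
  [FiberBundle ℂ L] [VectorBundle ℂ ℂ L] [VectorBundle ℝ ℂ L]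
  [ContMDiffVectorBundle ∞ ℂ L (𝓡 4)] [IsSmoothHermitianBundle ℂ L]

/-- The standard orthonormal basis of a tangent space, indexed by `Fin 4`. -/
def tangentBasis (x : M) : OrthonormalBasis (Fin 4) ℝ (TangentSpace (𝓡 4) x) :=
  (stdOrthonormalBasis ℝ (TangentSpace (𝓡 4) x)).reindex
    (finCongr (instFactFinrankTangentSpace x).out)

theorem sum_tangentBasis {W : Type*} [AddCommMonoid W] (x : M)
    (G : TangentSpace (𝓡 4) x → TangentSpace (𝓡 4) x → W) :
    ∑ i, ∑ j, G (stdOrthonormalBasis ℝ (TangentSpace (𝓡 4) x) i)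
      (stdOrthonormalBasis ℝ (TangentSpace (𝓡 4) x) j) =
    ∑ i, ∑ j, G (tangentBasis x i) (tangentBasis x j) := by
  refine Fintype.sum_equiv (finCongr (instFactFinrankTangentSpace x).out) _ _ fun i ↦ ?_
  refine Fintype.sum_equiv (finCongr (instFactFinrankTangentSpace x).out) _ _ fun j ↦ ?_
  simp [tangentBasis]

theorem sum_Ioi_tangentBasis {W : Type*} [AddCommMonoid W] (x : M)
    (G : TangentSpace (𝓡 4) x → TangentSpace (𝓡 4) x → W) :
    ∑ i, ∑ j ∈ Finset.Ioi i, G (stdOrthonormalBasis ℝ (TangentSpace (𝓡 4) x) i)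
      (stdOrthonormalBasis ℝ (TangentSpace (𝓡 4) x) j) =
    ∑ i, ∑ j ∈ Finset.Ioi i, G (tangentBasis x i) (tangentBasis x j) := by
  -- The index type is `Fin` of the rank and `Finset.Ioi` depends on its order. Generalizing the
  -- rank to n allows `subst`, after which the reindexing is the identity.
  have key (n : ℕ) (hn : n = 4) (b : OrthonormalBasis (Fin n) ℝ (TangentSpace (𝓡 4) x)) :
      ∑ i, ∑ j ∈ Finset.Ioi i, G (b i) (b j) = ∑ i, ∑ j ∈ Finset.Ioi i,
        G (b.reindex (finCongr hn) i) (b.reindex (finCongr hn) j) := by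
    subst hn
    simp
  exact key _ _ _

namespace SpincStructure

variable {o : ManifoldOrientation M} (S : SpincStructure Wp Wm L o)

/-- The product `u · v ·` on `W⁺` as a complex-linear endomorphism. -/
def cliffordEnd (x : M) (u v : TangentSpace (𝓡 4) x) : Module.End ℂ (Wp x) where
  toFun φ := S.cm x u (S.cp x v φ)
  map_add' φ φ' := by simp
  map_smul' z φ := by simp [S.cp_smul, S.cm_smul]

theorem cliffordEnd_apply (x : M) (u v : TangentSpace (𝓡 4) x) (φ : Wp x) :
    S.cliffordEnd x u v φ = S.cm x u (S.cp x v φ) := rfl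

theorem cp_cm_of_inner_eq_zero {x : M} {u v : TangentSpace (𝓡 4) x} (h : inner ℝ u v = 0)
    (χ : Wm x) : S.cp x u (S.cm x v χ) = -S.cp x v (S.cm x u χ) := by
  have := S.clifford_m x u v χ
  rw [h, mul_zero, zero_smul] at this
  exact eq_neg_of_add_eq_zero_left this

theorem cm_cp_of_inner_eq_zero {x : M} {u v : TangentSpace (𝓡 4) x} (h : inner ℝ u v = 0)
    (φ : Wp x) : S.cm x u (S.cp x v φ) = -S.cm x v (S.cp x u φ) := by
  have := S.clifford_p x u v φ
  rw [h, mul_zero, zero_smul] at this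
  exact eq_neg_of_add_eq_zero_left this

theorem cm_cp_self {x : M} {u : TangentSpace (𝓡 4) x} (h : ‖u‖ = 1)
    (φ : Wp x) : S.cm x u (S.cp x u φ) = -φ := by
  have h1 := S.clifford_p x u u φ
  rw [real_inner_self_eq_norm_sq, h, ← two_smul ℝ] at h1
  have h2 : (2 : ℝ) • (S.cm x u (S.cp x u φ) + φ) = 0 := by
    rw [smul_add, h1]
    module
  exact eq_neg_of_add_eq_zero_left ((smul_eq_zero.1 h2).resolve_left two_ne_zero)

/-- Orienting e changes its vectors by signs whose product is the volume of e. The chirality axiom,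
stated for oriented bases, then gives e₀e₁e₂e₃ = -s for an arbitrary one. -/
theorem isCliffordTable (x : M) (e : OrthonormalBasis (Fin 4) ℝ (TangentSpace (𝓡 4) x)) :
    IsCliffordTable (((o.at_ x).volumeForm e : ℝ) : ℂ) fun i j ↦ S.cliffordEnd x (e i) (e j) := by
  have hs (i) : ∃ r : ℝ, r * r = 1 ∧ e.adjustToOrientation (o.at_ x) i = r • e i := by
    rcases e.adjustToOrientation_apply_eq_or_eq_neg (o.at_ x) i with h | h
    · exact ⟨1, by simp, by simp [h]⟩
    · exact ⟨-1, by simp, by simp [h]⟩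
  choose r hr hre using hs
  have ho := e.orientation_adjustToOrientation (o.at_ x)
  have h1 : (∏ i, r i) * (o.at_ x).volumeForm e = 1 := by
    have h2 := (o.at_ x).volumeForm_robust _ ho
    have h3 : (o.at_ x).volumeForm (e.adjustToOrientation (o.at_ x)) = 1 := by
      rw [h2, ← OrthonormalBasis.coe_toBasis, Module.Basis.det_self]
    rw [← h3, funext hre, ← smul_eq_mul]
    exact ((o.at_ x).volumeForm.toMultilinearMap.map_smul_univ r e).symm
  have h2 : (∏ i, r i) * (∏ i, r i) = 1 := by
    rw [← Finset.prod_mul_distrib]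
    exact Finset.prod_eq_one fun i _ ↦ hr i
  have h3 : (o.at_ x).volumeForm e = ∏ i, r i := by
    linear_combination (∏ i, r i) * h1 - (o.at_ x).volumeForm e * h2
  have hn (i) : ‖e i‖ = 1 := e.orthonormal.1 i
  have hi {i j} (hij : i ≠ j) : inner ℝ (e i) (e j) = 0 := e.orthonormal.2 hij
  rw [h3]
  constructor
  · rw [pow_two]
    exact_mod_cast h2
  · intro i
    ext φ
    exact S.cm_cp_self (hn i) φ
  · intro i j hij
    ext φ
    exact S.cm_cp_of_inner_eq_zero (hi hij) φ
  · intro i j hij k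
    ext φ
    simp only [Module.End.mul_apply, cliffordEnd_apply]
    rw [S.cp_cm_of_inner_eq_zero (hi hij.symm), map_neg, S.cm_cp_self (hn i), neg_neg]
  · ext φ
    have h4 := S.chirality_p x _ ho φ
    simp only [hre, map_smul, smul_apply, smul_smul] at h4
    have h5 : -((∏ i, r i) • S.cm x (e 0) (S.cp x (e 1) (S.cm x (e 2) (S.cp x (e 3) φ)))) = φ := by
      rw [Fin.prod_univ_four]
      convert h4 using 3
      ring
    simp only [Module.End.mul_apply, cliffordEnd_apply, LinearMap.neg_apply, LinearMap.smul_apply,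
      Module.End.one_apply, Complex.coe_smul]
    conv_rhs => rw [← h5]
    rw [smul_neg, smul_smul, h2, one_smul, neg_neg]

/-- Anti-self-dual forms act by zero on W⁺, so the projection loses nothing. The factor ½ passes
from pairs i < j to all pairs. -/
theorem cliffordTwoForm_selfDualPart (x : M) {α : TangentSpace (𝓡 4) x → TangentSpace (𝓡 4) x → ℂ}
    (hα : ∀ u v, α u v = -α v u) (φ : Wp x) :
    S.cliffordTwoForm x (selfDualPart o x α) φ = (1 / 2 : ℂ) • ∑ i, ∑ j,
      α (tangentBasis x i) (tangentBasis x j) •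
        S.cliffordEnd x (tangentBasis x i) (tangentBasis x j) φ := by
  let e := tangentBasis x
  have hs (u v : TangentSpace (𝓡 4) x) : hodgeStarTwoForm o x α u v =
      1 / 2 * ∑ i, ∑ j, α (e i) (e j) * ((o.at_ x).volumeForm ![e i, e j, u, v] : ℝ) := by
    rw [hodgeStarTwoForm]
    exact congr_arg _ (sum_tangentBasis x fun a b ↦ α a b *
      ((o.at_ x).volumeForm ![a, b, u, v] : ℝ))
  obtain ⟨h1, h2, h3, h4, h5, h6⟩ := AlternatingMap.hodge_sum (G := (o.at_ x).volumeForm) e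
    (α := fun i j ↦ α (e i) (e j)) fun i j ↦ hα _ _
  simp only [← hs] at h1 h2 h3 h4 h5 h6
  have h7 := (S.isCliffordTable x e).sum_selfDual (F := fun i j ↦ α (e i) (e j))
    (S := fun i j ↦ hodgeStarTwoForm o x α (e i) (e j)) (fun i j ↦ hα _ _) h1 h2 h3 h4 h5 h6
  have h8 := LinearMap.congr_fun h7 φ
  simp only [LinearMap.sum_apply, LinearMap.smul_apply] at h8
  rw [← h8]
  exact sum_Ioi_tangentBasis x fun a b ↦ selfDualPart o x α a b • S.cm x a (S.cp x b φ)

end SpincStructure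

end Spinc

/-! ### The curvature of the spin-c connection. -/

section SpinConnection

variable {M : Type*} [TopologicalSpace M] [ChartedSpace (EuclideanSpace ℝ (Fin 4)) M]
  [IsManifold (𝓡 4) ∞ M] [T2Space M]
  [RiemannianBundle (fun x : M ↦ TangentSpace (𝓡 4) x)]
  [IsContMDiffRiemannianBundle (𝓡 4) ∞ (EuclideanSpace ℝ (Fin 4))
    (fun x : M ↦ TangentSpace (𝓡 4) x)]
variable
  {Wp : M → Type*} [TopologicalSpace (TotalSpace (EuclideanSpace ℂ (Fin 2)) Wp)]
  [∀ x, NormedAddCommGroup (Wp x)] [∀ x, InnerProductSpace ℂ (Wp x)]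
  [FiberBundle (EuclideanSpace ℂ (Fin 2)) Wp] [VectorBundle ℂ (EuclideanSpace ℂ (Fin 2)) Wp]
  [VectorBundle ℝ (EuclideanSpace ℂ (Fin 2)) Wp]
  [ContMDiffVectorBundle ∞ (EuclideanSpace ℂ (Fin 2)) Wp (𝓡 4)]
  [IsSmoothHermitianBundle (EuclideanSpace ℂ (Fin 2)) Wp]
  {Wm : M → Type*} [TopologicalSpace (TotalSpace (EuclideanSpace ℂ (Fin 2)) Wm)]
  [∀ x, NormedAddCommGroup (Wm x)] [∀ x, InnerProductSpace ℂ (Wm x)]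
  [FiberBundle (EuclideanSpace ℂ (Fin 2)) Wm] [VectorBundle ℂ (EuclideanSpace ℂ (Fin 2)) Wm]
  [VectorBundle ℝ (EuclideanSpace ℂ (Fin 2)) Wm]
  [ContMDiffVectorBundle ∞ (EuclideanSpace ℂ (Fin 2)) Wm (𝓡 4)]
  [IsSmoothHermitianBundle (EuclideanSpace ℂ (Fin 2)) Wm]
  {L : M → Type*} [TopologicalSpace (TotalSpace ℂ L)]
  [∀ x, NormedAddCommGroup (L x)] [∀ x, InnerProductSpace ℂ (L x)]
  [FiberBundle ℂ L] [VectorBundle ℂ ℂ L] [VectorBundle ℝ ℂ L]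
  [ContMDiffVectorBundle ∞ ℂ L (𝓡 4)] [IsSmoothHermitianBundle ℂ L]

theorem finrank_fiber {F : Type*} [NormedAddCommGroup F] [NormedSpace ℂ F] {V : M → Type*}
    [TopologicalSpace (TotalSpace F V)] [∀ x, NormedAddCommGroup (V x)]
    [∀ x, InnerProductSpace ℂ (V x)] [FiberBundle F V] [VectorBundle ℂ F V] (x : M) :
    Module.finrank ℂ (V x) = Module.finrank ℂ F :=
  ((trivializationAt F V x).continuousLinearEquivAt ℂ x
    (FiberBundle.mem_baseSet_trivializationAt F V x)).toLinearEquiv.finrank_eq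

/-- A complex-linear endomorphism of a line is a scalar, and pairing with a unit vector reads it
off. -/
theorem IsUnitaryConnection.curvature_eq_curvatureForm_smul {A : CovariantDerivative (𝓡 4) ℂ L}
    (hA : IsUnitaryConnection A) (x : M) (u v : TangentSpace (𝓡 4) x) (t : L x) :
    curvature A x u v t = curvatureForm A x u v • t := by
  have : FiniteDimensional ℂ (L x) := VectorBundle.finiteDimensional ℂ ℂ L x
  have h1 : Module.finrank ℂ (L x) = 1 := by rw [finrank_fiber (F := ℂ) x, Module.finrank_self]
  obtain ⟨c, hc⟩ : ∃ c : ℂ, hA.curvatureEnd x u v = c • LinearMap.id := by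
    obtain ⟨w, hw, hw'⟩ := finrank_eq_one_iff'.1 h1
    obtain ⟨c, hc⟩ := hw' (hA.curvatureEnd x u v w)
    refine ⟨c, LinearMap.ext fun t ↦ ?_⟩
    obtain ⟨d, rfl⟩ := hw' t
    rw [map_smul, ← hc, LinearMap.smul_apply, LinearMap.id_apply, smul_comm]
  have hc' (t : L x) : curvature A x u v t = c • t := LinearMap.congr_fun hc t
  have h2 : curvatureForm A x u v = c := by
    simp only [curvatureForm, hc', inner_smul_right, inner_self_eq_norm_sq_to_K,
      (stdOrthonormalBasis ℂ (L x)).orthonormal.1]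
    simp [h1]
  rw [h2, hc']

theorem IsUnitaryConnection.curvatureForm_swap {A : CovariantDerivative (𝓡 4) ℂ L}
    (hA : IsUnitaryConnection A) (x : M) (u v : TangentSpace (𝓡 4) x) :
    curvatureForm A x u v = -curvatureForm A x v u := by
  simp only [curvatureForm, ← Finset.sum_neg_distrib, ← inner_neg_right]
  refine Finset.sum_congr rfl fun i _ ↦ ?_
  rw [hA.isSmoothMetricConnection.curvature_swap]

variable (M) in
theorem isCurvatureTensor_leviCivita {x : M}
    (e : OrthonormalBasis (Fin 4) ℝ (TangentSpace (𝓡 4) x)) :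
    IsCurvatureTensor fun i j k l ↦
      ((inner ℝ (curvature (leviCivita (𝓡 4) M) x (e i) (e j) (e k)) (e l) : ℝ) : ℂ) where
  skew_left i j k l := by
    rw [(isSmoothMetricConnection_leviCivita (𝓡 4) M).curvature_swap, inner_neg_left,
      Complex.ofReal_neg]
  skew_right i j k l := by
    have := (isSmoothMetricConnection_leviCivita (𝓡 4) M).curvature_skew x (e i) (e j) (e k) (e l)
    rw [real_inner_comm _ (e k)] at this
    rw [← Complex.ofReal_neg, eq_neg_of_add_eq_zero_left this]
  bianchi i j k l := by
    rw [← Complex.ofReal_add, ← Complex.ofReal_add, ← inner_add_left, ← inner_add_left,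
      curvature_leviCivita_bianchi, inner_zero_left, Complex.ofReal_zero]

namespace SpincStructure

variable {o : ManifoldOrientation M} (S : SpincStructure Wp Wm L o)

/-- The identification of `Λ² W⁺` with `L` as a complex-bilinear map. -/
def detBilin (x : M) : Wp x →ₗ[ℂ] Wp x →ₗ[ℂ] L x :=
  have hswap (φ χ : Wp x) : S.det x φ χ = -S.det x χ φ := by
    have := S.det_self x (φ + χ)
    simp only [map_add, add_apply, S.det_self, zero_add, add_zero] at this
    exact eq_neg_of_add_eq_zero_right this
  LinearMap.mk₂ ℂ (fun φ χ ↦ S.det x φ χ) (by simp) (S.det_smul x) (by simp)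
    (fun z φ χ ↦ by rw [hswap, S.det_smul, hswap φ, smul_neg])

theorem detBilin_apply (x : M) (φ χ : Wp x) : S.detBilin x φ χ = S.det x φ χ := rfl

theorem exists_det_ne_zero (x : M) : ∃ φ χ, S.det x φ χ ≠ 0 := by
  have : FiniteDimensional ℂ (Wp x) :=
    VectorBundle.finiteDimensional ℂ (EuclideanSpace ℂ (Fin 2)) Wp x
  have h1 : Module.finrank ℂ (Wp x) = 2 := by
    rw [finrank_fiber (F := EuclideanSpace ℂ (Fin 2)) x, finrank_euclideanSpace_fin]
  let b := (stdOrthonormalBasis ℂ (Wp x)).reindex (finCongr h1)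
  refine ⟨b 0, b 1, fun h ↦ ?_⟩
  have h2 := S.norm_det x (b 0) (b 1)
  rw [h, b.orthonormal.1, b.orthonormal.1, b.orthonormal.2 (by decide)] at h2
  simp at h2

theorem contMDiff_cp_apply {Y : Π x : M, TangentSpace (𝓡 4) x} {φ : Π x : M, Wp x}
    (hY : ContMDiff (𝓡 4) ((𝓡 4).prod 𝓘(ℝ, EuclideanSpace ℝ (Fin 4))) ∞
      (fun y ↦ TotalSpace.mk' (EuclideanSpace ℝ (Fin 4)) y (Y y)))
    (hφ : ContMDiff (𝓡 4) ((𝓡 4).prod 𝓘(ℝ, EuclideanSpace ℂ (Fin 2))) ∞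
      (fun y ↦ TotalSpace.mk' (EuclideanSpace ℂ (Fin 2)) y (φ y))) :
    ContMDiff (𝓡 4) ((𝓡 4).prod 𝓘(ℝ, EuclideanSpace ℂ (Fin 2))) ∞
      (fun y ↦ TotalSpace.mk' (EuclideanSpace ℂ (Fin 2)) y (S.cp y (Y y) (φ y))) :=
  S.contMDiff_cp.clm_bundle_apply₂ hY hφ

theorem contMDiff_cm_apply {Y : Π x : M, TangentSpace (𝓡 4) x} {φ : Π x : M, Wm x}
    (hY : ContMDiff (𝓡 4) ((𝓡 4).prod 𝓘(ℝ, EuclideanSpace ℝ (Fin 4))) ∞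
      (fun y ↦ TotalSpace.mk' (EuclideanSpace ℝ (Fin 4)) y (Y y)))
    (hφ : ContMDiff (𝓡 4) ((𝓡 4).prod 𝓘(ℝ, EuclideanSpace ℂ (Fin 2))) ∞
      (fun y ↦ TotalSpace.mk' (EuclideanSpace ℂ (Fin 2)) y (φ y))) :
    ContMDiff (𝓡 4) ((𝓡 4).prod 𝓘(ℝ, EuclideanSpace ℂ (Fin 2))) ∞
      (fun y ↦ TotalSpace.mk' (EuclideanSpace ℂ (Fin 2)) y (S.cm y (Y y) (φ y))) :=
  S.contMDiff_cm.clm_bundle_apply₂ hY hφ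

theorem contMDiff_det_apply {φ χ : Π x : M, Wp x}
    (hφ : ContMDiff (𝓡 4) ((𝓡 4).prod 𝓘(ℝ, EuclideanSpace ℂ (Fin 2))) ∞
      (fun y ↦ TotalSpace.mk' (EuclideanSpace ℂ (Fin 2)) y (φ y)))
    (hχ : ContMDiff (𝓡 4) ((𝓡 4).prod 𝓘(ℝ, EuclideanSpace ℂ (Fin 2))) ∞
      (fun y ↦ TotalSpace.mk' (EuclideanSpace ℂ (Fin 2)) y (χ y))) :
    ContMDiff (𝓡 4) ((𝓡 4).prod 𝓘(ℝ, ℂ)) ∞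
      (fun y ↦ TotalSpace.mk' ℂ y (S.det y (φ y) (χ y))) :=
  S.contMDiff_det.clm_bundle_apply₂ hφ hχ

namespace IsSpinConnection

variable {S} {A : CovariantDerivative (𝓡 4) ℂ L}
  {covp : CovariantDerivative (𝓡 4) (EuclideanSpace ℂ (Fin 2)) Wp}
  {covm : CovariantDerivative (𝓡 4) (EuclideanSpace ℂ (Fin 2)) Wm}
  (h : S.IsSpinConnection A covp covm)
include h

/-- Clifford multiplication is a parallel pairing of TM with W⁺, so curvature acts on it as a
derivation. With its analogues for W⁻ and the determinant, this is all that `eq_of_commutator`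
needs. -/
theorem curvature_cp (x : M) (u v w : TangentSpace (𝓡 4) x) (φ : Wp x) :
    curvature covm x u v (S.cp x w φ) =
      S.cp x (curvature (leviCivita (𝓡 4) M) x u v w) φ + S.cp x w (curvature covp x u v φ) := by
  have hl := isSmoothMetricConnection_leviCivita (𝓡 4) M
  have hp := h.unitary_p.isSmoothMetricConnection
  have hm := h.unitary_m.isSmoothMetricConnection
  obtain ⟨X, hX, rfl⟩ := exists_contMDiff_section (I := 𝓡 4) (F := EuclideanSpace ℝ (Fin 4)) u
  obtain ⟨Y, hY, rfl⟩ := exists_contMDiff_section (I := 𝓡 4) (F := EuclideanSpace ℝ (Fin 4)) v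
  obtain ⟨Z, hZ, rfl⟩ := exists_contMDiff_section (I := 𝓡 4) (F := EuclideanSpace ℝ (Fin 4)) w
  obtain ⟨σ, hσ, rfl⟩ := exists_contMDiff_section (I := 𝓡 4) (F := EuclideanSpace ℂ (Fin 2)) φ
  refine (hm.curvature_eq_curvatureOp hX hY (S.contMDiff_cp_apply hZ hσ) x).trans ?_
  rw [hl.curvature_eq_curvatureOp hX hY hZ, hp.curvature_eq_curvatureOp hX hY hσ]
  exact curvatureOp_pairing (B := fun x v w ↦ S.cp x v w) (by simp) (by simp)
    (S₁ := {σ | ContMDiff (𝓡 4) ((𝓡 4).prod 𝓘(ℝ, EuclideanSpace ℝ (Fin 4))) ∞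
      (fun y ↦ TotalSpace.mk' (EuclideanSpace ℝ (Fin 4)) y (σ y))})
    (S₂ := {σ | ContMDiff (𝓡 4) ((𝓡 4).prod 𝓘(ℝ, EuclideanSpace ℂ (Fin 2))) ∞
      (fun y ↦ TotalSpace.mk' (EuclideanSpace ℂ (Fin 2)) y (σ y))})
    (fun σ hσ τ hτ x v ↦ h.clifford_p (hσ.mdiffAt_section x) (hτ.mdiffAt_section x) v)
    (fun σ hσ τ hτ σ' hσ' τ' hτ' x v ↦ DFunLike.congr_fun
      (covm.isCovariantDerivativeOnUniv.add ((S.contMDiff_cp_apply hσ hτ).mdiffAt_section x)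
        ((S.contMDiff_cp_apply hσ' hτ').mdiffAt_section x)) v)
    hZ hσ (hl.contMDiff hZ hX) (hl.contMDiff hZ hY) (hp.contMDiff hσ hX) (hp.contMDiff hσ hY) x

theorem curvature_cm (x : M) (u v w : TangentSpace (𝓡 4) x) (φ : Wm x) :
    curvature covp x u v (S.cm x w φ) =
      S.cm x (curvature (leviCivita (𝓡 4) M) x u v w) φ + S.cm x w (curvature covm x u v φ) := by
  have hl := isSmoothMetricConnection_leviCivita (𝓡 4) M
  have hp := h.unitary_p.isSmoothMetricConnection
  have hm := h.unitary_m.isSmoothMetricConnection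
  obtain ⟨X, hX, rfl⟩ := exists_contMDiff_section (I := 𝓡 4) (F := EuclideanSpace ℝ (Fin 4)) u
  obtain ⟨Y, hY, rfl⟩ := exists_contMDiff_section (I := 𝓡 4) (F := EuclideanSpace ℝ (Fin 4)) v
  obtain ⟨Z, hZ, rfl⟩ := exists_contMDiff_section (I := 𝓡 4) (F := EuclideanSpace ℝ (Fin 4)) w
  obtain ⟨σ, hσ, rfl⟩ := exists_contMDiff_section (I := 𝓡 4) (F := EuclideanSpace ℂ (Fin 2)) φ
  refine (hp.curvature_eq_curvatureOp hX hY (S.contMDiff_cm_apply hZ hσ) x).trans ?_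
  rw [hl.curvature_eq_curvatureOp hX hY hZ, hm.curvature_eq_curvatureOp hX hY hσ]
  exact curvatureOp_pairing (B := fun x v w ↦ S.cm x v w) (by simp) (by simp)
    (S₁ := {σ | ContMDiff (𝓡 4) ((𝓡 4).prod 𝓘(ℝ, EuclideanSpace ℝ (Fin 4))) ∞
      (fun y ↦ TotalSpace.mk' (EuclideanSpace ℝ (Fin 4)) y (σ y))})
    (S₂ := {σ | ContMDiff (𝓡 4) ((𝓡 4).prod 𝓘(ℝ, EuclideanSpace ℂ (Fin 2))) ∞
      (fun y ↦ TotalSpace.mk' (EuclideanSpace ℂ (Fin 2)) y (σ y))})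
    (fun σ hσ τ hτ x v ↦ h.clifford_m (hσ.mdiffAt_section x) (hτ.mdiffAt_section x) v)
    (fun σ hσ τ hτ σ' hσ' τ' hτ' x v ↦ DFunLike.congr_fun
      (covp.isCovariantDerivativeOnUniv.add ((S.contMDiff_cm_apply hσ hτ).mdiffAt_section x)
        ((S.contMDiff_cm_apply hσ' hτ').mdiffAt_section x)) v)
    hZ hσ (hl.contMDiff hZ hX) (hl.contMDiff hZ hY) (hm.contMDiff hσ hX) (hm.contMDiff hσ hY) x

theorem curvature_det (hA : IsUnitaryConnection A) (x : M) (u v : TangentSpace (𝓡 4) x)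
    (φ χ : Wp x) : curvature A x u v (S.det x φ χ) =
      S.det x (curvature covp x u v φ) χ + S.det x φ (curvature covp x u v χ) := by
  have hp := h.unitary_p.isSmoothMetricConnection
  obtain ⟨X, hX, rfl⟩ := exists_contMDiff_section (I := 𝓡 4) (F := EuclideanSpace ℝ (Fin 4)) u
  obtain ⟨Y, hY, rfl⟩ := exists_contMDiff_section (I := 𝓡 4) (F := EuclideanSpace ℝ (Fin 4)) v
  obtain ⟨σ, hσ, rfl⟩ := exists_contMDiff_section (I := 𝓡 4) (F := EuclideanSpace ℂ (Fin 2)) φ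
  obtain ⟨τ, hτ, rfl⟩ := exists_contMDiff_section (I := 𝓡 4) (F := EuclideanSpace ℂ (Fin 2)) χ
  refine (hA.isSmoothMetricConnection.curvature_eq_curvatureOp hX hY
    (S.contMDiff_det_apply hσ hτ) x).trans ?_
  rw [hp.curvature_eq_curvatureOp hX hY hσ, hp.curvature_eq_curvatureOp hX hY hτ]
  exact curvatureOp_pairing (B := fun x v w ↦ S.det x v w) (by simp) (by simp)
    (S₁ := {σ | ContMDiff (𝓡 4) ((𝓡 4).prod 𝓘(ℝ, EuclideanSpace ℂ (Fin 2))) ∞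
      (fun y ↦ TotalSpace.mk' (EuclideanSpace ℂ (Fin 2)) y (σ y))})
    (S₂ := {σ | ContMDiff (𝓡 4) ((𝓡 4).prod 𝓘(ℝ, EuclideanSpace ℂ (Fin 2))) ∞
      (fun y ↦ TotalSpace.mk' (EuclideanSpace ℂ (Fin 2)) y (σ y))})
    (fun σ hσ τ hτ x v ↦ h.det (hσ.mdiffAt_section x) (hτ.mdiffAt_section x) v)
    (fun σ hσ τ hτ σ' hσ' τ' hτ' x v ↦ DFunLike.congr_fun
      (A.isCovariantDerivativeOnUniv.add ((S.contMDiff_det_apply hσ hτ).mdiffAt_section x)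
        ((S.contMDiff_det_apply hσ' hτ').mdiffAt_section x)) v)
    hσ hτ (hp.contMDiff hσ hX) (hp.contMDiff hσ hY) (hp.contMDiff hτ hX) (hp.contMDiff hτ hY) x

/-- The curvature of the spin-c connection in terms of the Riemann tensor and of `F_A`. -/
theorem curvatureEnd_eq (hA : IsUnitaryConnection A) (x : M)
    (e : OrthonormalBasis (Fin 4) ℝ (TangentSpace (𝓡 4) x)) (i j : Fin 4) :
    h.unitary_p.curvatureEnd x (e i) (e j) = (curvatureForm A x (e i) (e j) / 2) • 1 +
      (1 / 4 : ℂ) • ∑ k, ∑ l,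
        ((inner ℝ (curvature (leviCivita (𝓡 4) M) x (e i) (e j) (e k)) (e l) : ℝ) : ℂ) •
          S.cliffordEnd x (e k) (e l) := by
  have h1 : Module.finrank ℂ (Wp x) = 2 := by
    rw [finrank_fiber (F := EuclideanSpace ℂ (Fin 2)) x, finrank_euclideanSpace_fin]
  refine (S.isCliffordTable x e).eq_of_commutator h1
    (fun k l ↦ (isCurvatureTensor_leviCivita M e).skew_right i j k l) (fun k l ↦ ?_)
    (S.detBilin x) (S.det_self x) (S.exists_det_ne_zero x) fun φ χ ↦ ?_
  · ext φ
    have hR (k) : curvature (leviCivita (𝓡 4) M) x (e i) (e j) (e k) =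
        ∑ m, (inner ℝ (curvature (leviCivita (𝓡 4) M) x (e i) (e j) (e k)) (e m) : ℝ) • e m := by
      conv_lhs => rw [← e.sum_repr' (curvature (leviCivita (𝓡 4) M) x (e i) (e j) (e k))]
      exact Finset.sum_congr rfl fun m _ ↦ by rw [real_inner_comm]
    -- The derivation rule, applied through W⁻ and back: the commutator with e_k e_l replaces each
    -- of the two vectors in turn by its image under R(eᵢ, eⱼ).
    have h2 : curvature covp x (e i) (e j) (S.cm x (e k) (S.cp x (e l) φ)) =
        S.cm x (e k) (S.cp x (e l) (curvature covp x (e i) (e j) φ)) +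
        ∑ m, (inner ℝ (curvature (leviCivita (𝓡 4) M) x (e i) (e j) (e k)) (e m) : ℝ) •
          S.cm x (e m) (S.cp x (e l) φ) +
        ∑ m, (inner ℝ (curvature (leviCivita (𝓡 4) M) x (e i) (e j) (e l)) (e m) : ℝ) •
          S.cm x (e k) (S.cp x (e m) φ) := by
      rw [h.curvature_cm, h.curvature_cp]
      conv_lhs => rw [hR k, hR l]
      simp only [map_add, map_sum, map_smul, sum_apply, smul_apply]
      abel
    simp only [LinearMap.add_apply, Module.End.mul_apply, LinearMap.sum_apply,
      LinearMap.smul_apply, Complex.coe_smul]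
    exact h2
  · rw [S.detBilin_apply, S.detBilin_apply, S.detBilin_apply,
      ← hA.curvature_eq_curvatureForm_smul, h.curvature_det hA]
    rfl

/-- The zeroth order term of the Weitzenböck formula for the spin-c Dirac operator. -/
theorem sum_cliffordEnd_curvature (hA : IsUnitaryConnection A) (x : M) (φ : Wp x) :
    ∑ i, ∑ j, S.cm x (tangentBasis x i) (S.cp x (tangentBasis x j)
        (curvature covp x (tangentBasis x i) (tangentBasis x j) φ)) =
      S.cliffordTwoForm x (selfDualPart o x (curvatureForm A x)) φ +
        (1 / 2 * scalarCurvature (𝓡 4) x) • φ := by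
  have h1 := (S.isCliffordTable x (tangentBasis x)).sum_mul_curvature
    (isCurvatureTensor_leviCivita M (tangentBasis x)) (h.curvatureEnd_eq hA x (tangentBasis x))
  have h2 := LinearMap.congr_fun h1 φ
  rw [S.cliffordTwoForm_selfDualPart x (hA.curvatureForm_swap x),
    scalarCurvature_eq_sum (tangentBasis x), ← Complex.coe_smul]
  simp only [LinearMap.sum_apply, LinearMap.add_apply, LinearMap.smul_apply,
    Module.End.mul_apply, Module.End.one_apply] at h2
  push_cast
  exact h2

end IsSpinConnection

end SpincStructure

end SpinConnection

/-! ### The Weitzenböck formula for harmonic spinors. -/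

theorem CovariantDerivative.sum_apply {E : Type*} [NormedAddCommGroup E] [NormedSpace ℝ E]
    {H : Type*} [TopologicalSpace H] {I : ModelWithCorners ℝ E H} {M : Type*} [TopologicalSpace M]
    [ChartedSpace H M] [IsManifold I ∞ M] {F : Type*} [NormedAddCommGroup F] [NormedSpace ℝ F]
    {V : M → Type*} [TopologicalSpace (TotalSpace F V)] [∀ x, AddCommGroup (V x)]
    [∀ x, Module ℝ (V x)] [∀ x, TopologicalSpace (V x)] [∀ x, IsTopologicalAddGroup (V x)]
    [∀ x, ContinuousSMul ℝ (V x)] [FiberBundle F V] [VectorBundle ℝ F V]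
    (cov : CovariantDerivative I F V) {ι : Type*} (s : Finset ι) {σ : ι → Π x : M, V x} {x : M}
    (hσ : ∀ i, MDiffAt (T% (σ i)) x) (v : TangentSpace I x) :
    cov (fun y ↦ ∑ i ∈ s, σ i y) x v = ∑ i ∈ s, cov (σ i) x v := by
  classical
  induction s using Finset.induction_on with
  | empty =>
    have h := cov.zero
    have h' : (fun y : M ↦ ∑ i ∈ (∅ : Finset ι), σ i y) = 0 := by ext y; simp
    rw [h', h]
    simp
  | insert i s hi ih =>
    simp only [Finset.sum_insert hi]
    rw [← ih]
    exact DFunLike.congr_fun (cov.isCovariantDerivativeOnUniv.add (hσ i)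
      (MDifferentiableAt.sum_section fun i _ ↦ hσ i)) v

section DiracOperator

variable {M : Type*} [TopologicalSpace M] [ChartedSpace (EuclideanSpace ℝ (Fin 4)) M]
  [IsManifold (𝓡 4) ∞ M] [T2Space M]
  [RiemannianBundle (fun x : M ↦ TangentSpace (𝓡 4) x)]
  [IsContMDiffRiemannianBundle (𝓡 4) ∞ (EuclideanSpace ℝ (Fin 4))
    (fun x : M ↦ TangentSpace (𝓡 4) x)]
variable
  {Wp : M → Type*} [TopologicalSpace (TotalSpace (EuclideanSpace ℂ (Fin 2)) Wp)]
  [∀ x, NormedAddCommGroup (Wp x)] [∀ x, InnerProductSpace ℂ (Wp x)]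
  [FiberBundle (EuclideanSpace ℂ (Fin 2)) Wp] [VectorBundle ℂ (EuclideanSpace ℂ (Fin 2)) Wp]
  [VectorBundle ℝ (EuclideanSpace ℂ (Fin 2)) Wp]
  [ContMDiffVectorBundle ∞ (EuclideanSpace ℂ (Fin 2)) Wp (𝓡 4)]
  [IsSmoothHermitianBundle (EuclideanSpace ℂ (Fin 2)) Wp]
  {Wm : M → Type*} [TopologicalSpace (TotalSpace (EuclideanSpace ℂ (Fin 2)) Wm)]
  [∀ x, NormedAddCommGroup (Wm x)] [∀ x, InnerProductSpace ℂ (Wm x)]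
  [FiberBundle (EuclideanSpace ℂ (Fin 2)) Wm] [VectorBundle ℂ (EuclideanSpace ℂ (Fin 2)) Wm]
  [VectorBundle ℝ (EuclideanSpace ℂ (Fin 2)) Wm]
  [ContMDiffVectorBundle ∞ (EuclideanSpace ℂ (Fin 2)) Wm (𝓡 4)]
  [IsSmoothHermitianBundle (EuclideanSpace ℂ (Fin 2)) Wm]
  {L : M → Type*} [TopologicalSpace (TotalSpace ℂ L)]
  [∀ x, NormedAddCommGroup (L x)] [∀ x, InnerProductSpace ℂ (L x)]
  [FiberBundle ℂ L] [VectorBundle ℂ ℂ L] [VectorBundle ℝ ℂ L]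
  [ContMDiffVectorBundle ∞ ℂ L (𝓡 4)] [IsSmoothHermitianBundle ℂ L]

/-- The second covariant derivative `∇_v ∇_X φ - ∇_{∇_v X} φ`. -/
def secondCovariantDerivative {F : Type*} [NormedAddCommGroup F] [NormedSpace ℝ F]
    {V : M → Type*} [TopologicalSpace (TotalSpace F V)] [∀ x, AddCommGroup (V x)]
    [∀ x, Module ℝ (V x)] [∀ x, TopologicalSpace (V x)] [∀ x, IsTopologicalAddGroup (V x)]
    [∀ x, ContinuousSMul ℝ (V x)] [FiberBundle F V] (cov : CovariantDerivative (𝓡 4) F V)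
    (φ : Π x : M, V x) (X : Π x : M, TangentSpace (𝓡 4) x) (x : M) (v : TangentSpace (𝓡 4) x) :
    V x :=
  cov (fun y ↦ cov φ y (X y)) x v - cov φ x (leviCivita (𝓡 4) M X x v)

/-- The connection matrix of an orthonormal frame is skew. -/
theorem inner_leviCivita_frame {x : M} {X : Fin 4 → Π y : M, TangentSpace (𝓡 4) y}
    (hX : ∀ i, ContMDiff (𝓡 4) ((𝓡 4).prod 𝓘(ℝ, EuclideanSpace ℝ (Fin 4))) ∞
      (fun y ↦ TotalSpace.mk' (EuclideanSpace ℝ (Fin 4)) y (X i y)))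
    (hb : ∀ᶠ y in 𝓝 x, ∃ b : OrthonormalBasis (Fin 4) ℝ (TangentSpace (𝓡 4) y), ∀ i, b i = X i y)
    {v : TangentSpace (𝓡 4) x} (i k : Fin 4) :
    inner ℝ (X k x) (leviCivita (𝓡 4) M (X i) x v) =
      -inner ℝ (X i x) (leviCivita (𝓡 4) M (X k) x v) := by
  obtain ⟨Z, hZ, rfl⟩ := exists_contMDiff_section (I := 𝓡 4) (F := EuclideanSpace ℝ (Fin 4)) v
  have h1 := leviCivita_metric (hZ.mdiffAt_section x) ((hX i).mdiffAt_section x)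
    ((hX k).mdiffAt_section x)
  have h2 : (fun y ↦ inner ℝ (X i y) (X k y)) =ᶠ[𝓝 x] fun _ ↦ if i = k then (1 : ℝ) else 0 := by
    filter_upwards [hb] with y ⟨b, hb⟩
    rw [← hb, ← hb]
    exact orthonormal_iff_ite.1 b.orthonormal i k
  have h3 : mvfderiv (𝓡 4) (fun y ↦ inner ℝ (X i y) (X k y)) x = 0 := by
    have h4 : mvfderiv (𝓡 4) (fun y ↦ inner ℝ (X i y) (X k y)) x =
        mvfderiv (𝓡 4) (fun _ : M ↦ if i = k then (1 : ℝ) else 0) x := h2.mfderiv_eq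
    rw [h4, mvfderiv_const]
  rw [h3, zero_apply, real_inner_comm] at h1
  linarith

namespace SpincStructure

variable {o : ManifoldOrientation M} (S : SpincStructure Wp Wm L o)

theorem dirac_eq_sum (covp : CovariantDerivative (𝓡 4) (EuclideanSpace ℂ (Fin 2)) Wp)
    (φ : Π x : M, Wp x) {x : M} (b : OrthonormalBasis (Fin 4) ℝ (TangentSpace (𝓡 4) x)) :
    S.dirac covp φ x = ∑ i, S.cp x (b i) (covp φ x (b i)) := by
  let B : TangentSpace (𝓡 4) x →ₗ[ℝ] TangentSpace (𝓡 4) x →ₗ[ℝ] Wm x :=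
    LinearMap.mk₂ ℝ (fun u v ↦ S.cp x u (covp φ x v)) (by simp) (by simp) (by simp) (by simp)
  exact OrthonormalBasis.sum_apply_apply_eq B (stdOrthonormalBasis ℝ (TangentSpace (𝓡 4) x)) b

namespace IsSpinConnection

variable {S} {A : CovariantDerivative (𝓡 4) ℂ L}
  {covp : CovariantDerivative (𝓡 4) (EuclideanSpace ℂ (Fin 2)) Wp}
  {covm : CovariantDerivative (𝓡 4) (EuclideanSpace ℂ (Fin 2)) Wm}
  (h : S.IsSpinConnection A covp covm)
include h

/-- This is the derivative of D φ = 0 along v. The frame is not parallel at x, but skewness of its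
connection matrix converts the derivatives of the frame into exactly the correction terms of the
second covariant derivative. -/
theorem sum_cp_secondCovariantDerivative {φ : Π x : M, Wp x}
    (hφ : ContMDiff (𝓡 4) ((𝓡 4).prod 𝓘(ℝ, EuclideanSpace ℂ (Fin 2))) ∞
      (fun y ↦ TotalSpace.mk' (EuclideanSpace ℂ (Fin 2)) y (φ y)))
    (hD : ∀ x, S.dirac covp φ x = 0) {x : M} {X : Fin 4 → Π y : M, TangentSpace (𝓡 4) y}
    (hX : ∀ i, ContMDiff (𝓡 4) ((𝓡 4).prod 𝓘(ℝ, EuclideanSpace ℝ (Fin 4))) ∞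
      (fun y ↦ TotalSpace.mk' (EuclideanSpace ℝ (Fin 4)) y (X i y)))
    (hb : ∀ᶠ y in 𝓝 x, ∃ b : OrthonormalBasis (Fin 4) ℝ (TangentSpace (𝓡 4) y), ∀ i, b i = X i y)
    (v : TangentSpace (𝓡 4) x) :
    ∑ i, S.cp x (X i x) (secondCovariantDerivative covp φ (X i) x v) = 0 := by
  have hp := h.unitary_p.isSmoothMetricConnection
  have hs (i) := S.contMDiff_cp_apply (hX i) (hp.contMDiff hφ (hX i))
  have h1 : covm (fun y ↦ ∑ i, S.cp y (X i y) (covp φ y (X i y))) x = 0 := by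
    have h2 : ∀ᶠ y in 𝓝 x, ∑ i, S.cp y (X i y) (covp φ y (X i y)) = 0 := by
      filter_upwards [hb] with y ⟨b, hb⟩
      rw [← hD y, S.dirac_eq_sum covp φ b]
      simp only [hb]
    have h3 : covm (0 : Π y : M, Wm y) = 0 := covm.zero
    rw [← Pi.zero_apply (M := fun y : M ↦ TangentSpace (𝓡 4) y →L[ℝ] Wm y) x, ← h3]
    have h4 := MDifferentiableAt.sum_section (s := Finset.univ)
      (fun i _ ↦ (hs i).mdiffAt_section x)
    refine covm.isCovariantDerivativeOnUniv.congr_of_eventuallyEq h4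
      (h4.congr_of_eventuallyEq ?_) Filter.univ_mem h2
    filter_upwards [h2] with z hz
    rw [hz]
    rfl
  have h5 := covm.sum_apply Finset.univ (fun i ↦ (hs i).mdiffAt_section x) v
  simp only [h1, zero_apply, h.clifford_p ((hX _).mdiffAt_section x)
    ((hp.contMDiff hφ (hX _)).mdiffAt_section x), Finset.sum_add_distrib] at h5
  obtain ⟨b, hbx⟩ := hb.self_of_nhds
  have hR (k) : leviCivita (𝓡 4) M (X k) x v =
      ∑ m, (inner ℝ (X m x) (leviCivita (𝓡 4) M (X k) x v) : ℝ) • X m x := by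
    conv_lhs => rw [← b.sum_repr' (leviCivita (𝓡 4) M (X k) x v)]
    simp only [hbx]
  have h6 : ∑ i, S.cp x (leviCivita (𝓡 4) M (X i) x v) (covp φ x (X i x)) =
      -∑ i, S.cp x (X i x) (covp φ x (leviCivita (𝓡 4) M (X i) x v)) := by
    calc _ = ∑ i, ∑ m, (inner ℝ (X m x) (leviCivita (𝓡 4) M (X i) x v) : ℝ) •
          S.cp x (X m x) (covp φ x (X i x)) := by
          refine Finset.sum_congr rfl fun i _ ↦ ?_
          conv_lhs => rw [hR i]
          simp only [map_sum, map_smul, sum_apply, smul_apply]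
      _ = -∑ m, ∑ i, (inner ℝ (X i x) (leviCivita (𝓡 4) M (X m) x v) : ℝ) •
          S.cp x (X m x) (covp φ x (X i x)) := by
          rw [Finset.sum_comm]
          simp only [← Finset.sum_neg_distrib, ← neg_smul]
          exact Finset.sum_congr rfl fun i _ ↦ Finset.sum_congr rfl fun m _ ↦ by
            rw [inner_leviCivita_frame hX hb]
      _ = _ := by
          congr 1
          refine Finset.sum_congr rfl fun i _ ↦ ?_
          conv_rhs => rw [hR i]
          simp only [map_sum, map_smul]
  simp only [secondCovariantDerivative, map_sub, Finset.sum_sub_distrib]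
  rw [h6] at h5
  rw [sub_eq_add_neg, add_comm]
  exact h5.symm

/-- The Weitzenböck formula for a harmonic spinor. -/
theorem sum_secondCovariantDerivative (hA : IsUnitaryConnection A) {φ : Π x : M, Wp x}
    (hφ : ContMDiff (𝓡 4) ((𝓡 4).prod 𝓘(ℝ, EuclideanSpace ℂ (Fin 2))) ∞
      (fun y ↦ TotalSpace.mk' (EuclideanSpace ℂ (Fin 2)) y (φ y)))
    (hD : ∀ x, S.dirac covp φ x = 0) {x : M} {X : Fin 4 → Π y : M, TangentSpace (𝓡 4) y}
    (hX : ∀ i, ContMDiff (𝓡 4) ((𝓡 4).prod 𝓘(ℝ, EuclideanSpace ℝ (Fin 4))) ∞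
      (fun y ↦ TotalSpace.mk' (EuclideanSpace ℝ (Fin 4)) y (X i y))) (hXe : ∀ i, X i x = tangentBasis x i)
    (hb : ∀ᶠ y in 𝓝 x, ∃ b : OrthonormalBasis (Fin 4) ℝ (TangentSpace (𝓡 4) y), ∀ i, b i = X i y) :
    ∑ i, secondCovariantDerivative covp φ (X i) x (X i x) =
      (1 / 2 : ℝ) • S.cliffordTwoForm x (selfDualPart o x (curvatureForm A x)) (φ x) +
        (1 / 4 * scalarCurvature (𝓡 4) x) • φ x := by
  have hp := h.unitary_p.isSmoothMetricConnection
  have h0 := h.sum_cliffordEnd_curvature hA x (φ x)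
  simp only [← hXe] at h0
  let G (j i : Fin 4) : Wp x := secondCovariantDerivative covp φ (X i) x (X j x)
  let c (i j : Fin 4) (s : Wp x) : Wp x := S.cm x (X i x) (S.cp x (X j x) s)
  -- This is D²φ = 0 in the frame. Transposing the indices of G produces curvature, since the
  -- connection is torsion-free (h2); transposing those of c produces the trace, by the Clifford
  -- relations (h3).
  have h1 : ∑ j, ∑ i, c j i (G j i) = 0 := by
    refine Finset.sum_eq_zero fun j _ ↦ ?_
    simp only [c]
    rw [← map_sum, h.sum_cp_secondCovariantDerivative hφ hD hX hb, map_zero]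
  have h2 (j i) : G j i - G i j = curvature covp x (X j x) (X i x) (φ x) := by
    rw [hp.curvature_eq_curvatureOp (hX j) (hX i) hφ, curvatureOp,
      ← leviCivita_torsion ((hX j).mdiffAt_section x) ((hX i).mdiffAt_section x)]
    simp only [G, secondCovariantDerivative, map_sub]
    abel
  have h3 (j i) (s : Wp x) : c j i s + c i j s = if j = i then (-2 : ℝ) • s else 0 := by
    simp only [c]
    rw [S.clifford_p, hXe, hXe, orthonormal_iff_ite.1 (tangentBasis x).orthonormal]
    split_ifs <;> simp
  have h4 : ∑ j, ∑ i, c j i (G i j) = -((2 : ℝ) • ∑ i, G i i) := by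
    have h5 : ∑ j, ∑ i, c j i (G i j) + ∑ j, ∑ i, c i j (G i j) = -((2 : ℝ) • ∑ i, G i i) := by
      simp only [← Finset.sum_add_distrib, h3, Finset.sum_ite_eq, Finset.mem_univ, if_true,
        Finset.smul_sum, ← Finset.sum_neg_distrib, neg_smul]
    rw [← h5, Finset.sum_comm (f := fun j i ↦ c i j (G i j)), h1, add_zero]
  have h6 : ∑ i, ∑ j, c i j (curvature covp x (X i x) (X j x) (φ x)) = (2 : ℝ) • ∑ i, G i i := by
    simp only [← h2, c, map_sub, Finset.sum_sub_distrib]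
    rw [h1, h4, zero_sub, neg_neg]
  have h7 : ∑ i, G i i = (1 / 2 : ℝ) •
      ∑ i, ∑ j, c i j (curvature covp x (X i x) (X j x) (φ x)) := by
    rw [h6, smul_smul]
    norm_num
  refine h7.trans ?_
  rw [h0]
  module

end IsSpinConnection

end SpincStructure

end DiracOperator

/-! ### Second derivatives of products and exponentials. -/

section Hessian

variable {E : Type*} [NormedAddCommGroup E] [NormedSpace ℝ E] [FiniteDimensional ℝ E]
  {H : Type*} [TopologicalSpace H] {I : ModelWithCorners ℝ E H}
  {M : Type*} [TopologicalSpace M] [ChartedSpace H M] [IsManifold I ∞ M] [T2Space M]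
  [RiemannianBundle (fun x : M ↦ TangentSpace I x)]
  [IsContMDiffRiemannianBundle I ∞ E (fun x : M ↦ TangentSpace I x)]

theorem hessianAlong_mul {X : Π x : M, TangentSpace I x} (hX : CMDiff ∞ (T% X)) {a u : M → ℝ}
    (ha : CMDiff ∞ a) (hu : CMDiff ∞ u) (x : M) :
    hessianAlong I X (fun y ↦ a y * u y) x = a x * hessianAlong I X u x +
      2 * (mvfderiv I a x (X x) * mvfderiv I u x (X x)) + u x * hessianAlong I X a x := by
  have hd {g : M → ℝ} (hg : CMDiff ∞ g) (y : M) : MDiffAt g y :=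
    (hg y).mdifferentiableAt (by simp)
  have h1 (y : M) (v : TangentSpace I y) : mvfderiv I (fun y ↦ a y * u y) y v =
      a y * mvfderiv I u y v + u y * mvfderiv I a y v := by
    rw [mvfderiv_fun_mul (hd ha y) (hd hu y)]
    simp
  have h2 : CMDiff ∞ (fun y ↦ a y * mvfderiv I u y (X y)) := ha.mul (hu.mvfderiv_apply hX)
  have h3 : CMDiff ∞ (fun y ↦ u y * mvfderiv I a y (X y)) := hu.mul (ha.mvfderiv_apply hX)
  simp only [hessianAlong, h1]
  rw [mvfderiv_fun_add (hd h2 x) (hd h3 x), mvfderiv_fun_mul (hd ha x) (hd (hu.mvfderiv_apply hX) x),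
    mvfderiv_fun_mul (hd hu x) (hd (ha.mvfderiv_apply hX) x)]
  simp only [add_apply, smul_apply, smul_eq_mul]
  ring

theorem mvfderiv_exp_neg {f : M → ℝ} (hf : CMDiff ∞ f) (x : M) (v : TangentSpace I x) :
    mvfderiv I (fun y ↦ Real.exp (-f y)) x v = -(Real.exp (-f x) * mvfderiv I f x v) := by
  rw [mvfderiv_comp_of_hasFDerivAt (k := fun t ↦ Real.exp (-t))
    ((Real.hasDerivAt_exp (-f x)).comp (f x) (hasDerivAt_neg (f x))).hasFDerivAt
    ((hf x).mdifferentiableAt (by simp)) v]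
  simp
  ring

theorem contMDiff_exp_neg {f : M → ℝ} (hf : CMDiff ∞ f) : CMDiff ∞ (fun y ↦ Real.exp (-f y)) :=
  (Real.contDiff_exp.comp contDiff_neg).contMDiff.comp hf

theorem hessianAlong_exp_neg {X : Π x : M, TangentSpace I x} (hX : CMDiff ∞ (T% X)) {f : M → ℝ}
    (hf : CMDiff ∞ f) (x : M) : hessianAlong I X (fun y ↦ Real.exp (-f y)) x =
      Real.exp (-f x) * (mvfderiv I f x (X x) ^ 2 - hessianAlong I X f x) := by
  have hd {g : M → ℝ} (hg : CMDiff ∞ g) (y : M) : MDiffAt g y :=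
    (hg y).mdifferentiableAt (by simp)
  have he := contMDiff_exp_neg hf
  simp only [hessianAlong, mvfderiv_exp_neg hf]
  have h1 : mvfderiv I (fun y ↦ -(Real.exp (-f y) * mvfderiv I f y (X y))) x =
      -mvfderiv I (fun y ↦ Real.exp (-f y) * mvfderiv I f y (X y)) x := mvfderiv_neg
  rw [h1, mvfderiv_fun_mul (hd he x) (hd (hf.mvfderiv_apply hX) x)]
  simp only [neg_apply, add_apply, smul_apply, smul_eq_mul, mvfderiv_exp_neg hf]
  ring

theorem IsLocalMax.hessianAlong_nonpos [BoundarylessManifold I M] {u : M → ℝ} (hu : CMDiff ∞ u)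
    {x : M} (hx : IsLocalMax u x) {X : Π x : M, TangentSpace I x} (hX : CMDiff ∞ (T% X)) :
    hessianAlong I X u x ≤ 0 := by
  rw [hessianAlong, hx.mvfderiv_eq_zero hu, zero_apply, sub_zero]
  exact hx.mvfderiv_mvfderiv_nonpos hu hX

theorem norm_riemannianGradient_sq {n : ℕ} {x : M}
    (e : OrthonormalBasis (Fin n) ℝ (TangentSpace I x)) (u : M → ℝ) :
    ‖riemannianGradient I u x‖ ^ 2 = ∑ i, mvfderiv I u x (e i) ^ 2 := by
  rw [← e.sum_sq_norm_inner_left]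
  exact Finset.sum_congr rfl fun i _ ↦ by rw [inner_riemannianGradient, Real.norm_eq_abs, sq_abs]

end Hessian

/-! ### The Bochner identity and the estimate at a maximum. -/

section Estimate

variable {M : Type*} [TopologicalSpace M] [ChartedSpace (EuclideanSpace ℝ (Fin 4)) M]
  [IsManifold (𝓡 4) ∞ M] [T2Space M]
  [RiemannianBundle (fun x : M ↦ TangentSpace (𝓡 4) x)]
  [IsContMDiffRiemannianBundle (𝓡 4) ∞ (EuclideanSpace ℝ (Fin 4))
    (fun x : M ↦ TangentSpace (𝓡 4) x)]
variable
  {Wp : M → Type*} [TopologicalSpace (TotalSpace (EuclideanSpace ℂ (Fin 2)) Wp)]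
  [∀ x, NormedAddCommGroup (Wp x)] [∀ x, InnerProductSpace ℂ (Wp x)]
  [FiberBundle (EuclideanSpace ℂ (Fin 2)) Wp] [VectorBundle ℂ (EuclideanSpace ℂ (Fin 2)) Wp]
  [VectorBundle ℝ (EuclideanSpace ℂ (Fin 2)) Wp]
  [ContMDiffVectorBundle ∞ (EuclideanSpace ℂ (Fin 2)) Wp (𝓡 4)]
  [IsSmoothHermitianBundle (EuclideanSpace ℂ (Fin 2)) Wp]
  {Wm : M → Type*} [TopologicalSpace (TotalSpace (EuclideanSpace ℂ (Fin 2)) Wm)]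
  [∀ x, NormedAddCommGroup (Wm x)] [∀ x, InnerProductSpace ℂ (Wm x)]
  [FiberBundle (EuclideanSpace ℂ (Fin 2)) Wm] [VectorBundle ℂ (EuclideanSpace ℂ (Fin 2)) Wm]
  [VectorBundle ℝ (EuclideanSpace ℂ (Fin 2)) Wm]
  [ContMDiffVectorBundle ∞ (EuclideanSpace ℂ (Fin 2)) Wm (𝓡 4)]
  [IsSmoothHermitianBundle (EuclideanSpace ℂ (Fin 2)) Wm]
  {L : M → Type*} [TopologicalSpace (TotalSpace ℂ L)]
  [∀ x, NormedAddCommGroup (L x)] [∀ x, InnerProductSpace ℂ (L x)]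
  [FiberBundle ℂ L] [VectorBundle ℂ ℂ L] [VectorBundle ℝ ℂ L]
  [ContMDiffVectorBundle ∞ ℂ L (𝓡 4)] [IsSmoothHermitianBundle ℂ L]

theorem ContMDiff.norm_sq_hermitian {F : Type*} [NormedAddCommGroup F] [NormedSpace ℝ F]
    {V : M → Type*} [TopologicalSpace (TotalSpace F V)] [∀ x, NormedAddCommGroup (V x)]
    [∀ x, InnerProductSpace ℂ (V x)] [FiberBundle F V] [VectorBundle ℝ F V]
    [NormedSpace ℂ F] [SMulCommClass ℝ ℂ F] [VectorBundle ℂ F V]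
    [ContMDiffVectorBundle ∞ F V (𝓡 4)] [IsSmoothHermitianBundle F V] {σ : Π x : M, V x}
    (hσ : ContMDiff (𝓡 4) ((𝓡 4).prod 𝓘(ℝ, F)) ∞ (fun y ↦ TotalSpace.mk' F y (σ y))) :
    ContMDiff (𝓡 4) 𝓘(ℝ, ℝ) ∞ (fun y ↦ ‖σ y‖ ^ 2) := by
  have h := Complex.reCLM.contMDiff.comp (hσ.inner_hermitian hσ)
  refine h.congr fun y ↦ ?_
  exact (inner_self_eq_norm_sq (𝕜 := ℂ) (σ y)).symm

/-- The Bochner identity for the norm of a section. -/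
theorem IsUnitaryConnection.hessianAlong_norm_sq {F : Type*} [NormedAddCommGroup F]
    [NormedSpace ℝ F]
    {V : M → Type*} [TopologicalSpace (TotalSpace F V)] [∀ x, NormedAddCommGroup (V x)]
    [∀ x, InnerProductSpace ℂ (V x)] [FiberBundle F V] [VectorBundle ℝ F V]
    [NormedSpace ℂ F] [SMulCommClass ℝ ℂ F] [VectorBundle ℂ F V]
    [ContMDiffVectorBundle ∞ F V (𝓡 4)] [IsSmoothHermitianBundle F V]
    {cov : CovariantDerivative (𝓡 4) F V} (h : IsUnitaryConnection cov) {σ : Π x : M, V x}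
    (hσ : ContMDiff (𝓡 4) ((𝓡 4).prod 𝓘(ℝ, F)) ∞ (fun y ↦ TotalSpace.mk' F y (σ y)))
    {X : Π x : M, TangentSpace (𝓡 4) x}
    (hX : ContMDiff (𝓡 4) ((𝓡 4).prod 𝓘(ℝ, EuclideanSpace ℝ (Fin 4))) ∞
      (fun y ↦ TotalSpace.mk' (EuclideanSpace ℝ (Fin 4)) y (X y))) (x : M) :
    (∀ v, mvfderiv (𝓡 4) (fun y ↦ ‖σ y‖ ^ 2) x v = 2 * (inner ℂ (cov σ x v) (σ x) : ℂ).re) ∧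
    hessianAlong (𝓡 4) X (fun y ↦ ‖σ y‖ ^ 2) x =
      2 * (inner ℂ (secondCovariantDerivative cov σ X x (X x)) (σ x) : ℂ).re +
        2 * ‖cov σ x (X x)‖ ^ 2 := by
  have hm := h.isSmoothMetricConnection
  have hn : (fun y ↦ ‖σ y‖ ^ 2) = fun y ↦ (inner ℂ (σ y) (σ y) : ℂ).re := by
    ext y
    exact (inner_self_eq_norm_sq (𝕜 := ℂ) (σ y)).symm
  have hs {y : M} (s t : V y) : (inner ℂ s t : ℂ).re = (inner ℂ t s : ℂ).re :=
    inner_re_symm (𝕜 := ℂ) s t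
  have h1 (y : M) (v : TangentSpace (𝓡 4) y) :
      mvfderiv (𝓡 4) (fun y ↦ (inner ℂ (σ y) (σ y) : ℂ).re) y v =
        2 * (inner ℂ (cov σ y v) (σ y) : ℂ).re := by
    rw [hm.parallel hσ hσ, hs (σ y), two_mul]
  have h2 : mvfderiv (𝓡 4) (fun y ↦ 2 * (inner ℂ (cov σ y (X y)) (σ y) : ℂ).re) x (X x) =
      2 * ((inner ℂ (cov (fun y ↦ cov σ y (X y)) x (X x)) (σ x) : ℂ).re +
        (inner ℂ (cov σ x (X x)) (cov σ x (X x)) : ℂ).re) := by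
    have h3 := hm.parallel (hm.contMDiff hσ hX) hσ x (X x)
    rw [← h3]
    have h4 := hm.contMDiff_form (hm.contMDiff hσ hX) hσ
    rw [mvfderiv_fun_mul mdifferentiableAt_const ((h4 x).mdifferentiableAt (by simp)),
      mvfderiv_const]
    simp
  rw [hn]
  refine ⟨h1 x, ?_⟩
  have h5 : (inner ℂ (cov σ x (X x)) (cov σ x (X x)) : ℂ).re = ‖cov σ x (X x)‖ ^ 2 :=
    inner_self_eq_norm_sq (𝕜 := ℂ) _
  simp only [hessianAlong, h1, h2, secondCovariantDerivative, inner_sub_left, Complex.sub_re, h5]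
  ring

namespace SpincStructure

variable {o : ManifoldOrientation M} {S : SpincStructure Wp Wm L o}

/-- The pointwise estimate at a maximum of `|ψ|²`. -/
theorem IsWeightedMonopole.norm_sq_le {f : M → ℝ} (hf : ContMDiff (𝓡 4) 𝓘(ℝ, ℝ) ∞ f)
    {A : CovariantDerivative (𝓡 4) ℂ L}
    {covp : CovariantDerivative (𝓡 4) (EuclideanSpace ℂ (Fin 2)) Wp}
    {covm : CovariantDerivative (𝓡 4) (EuclideanSpace ℂ (Fin 2)) Wm}
    {ψ : Π x : M, Wp x} (hψ : S.IsWeightedMonopole f A covp covm ψ) {x : M}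
    (hx : IsLocalMax (fun y ↦ ‖ψ y‖ ^ 2) x) (h0 : ψ x ≠ 0) :
    ‖ψ x‖ ^ 2 ≤ -(weightedScalarCurvature (𝓡 4) f x * Real.exp (f x)) := by
  have hc := hψ.spinConnection
  have hu := hψ.contMDiff.norm_sq_hermitian
  have ha := contMDiff_exp_neg hf
  -- This substitution removes the conjugation from the weighted Dirac operator: φ is harmonic for
  -- the unweighted one.
  let φ : Π y : M, Wp y := fun y ↦ Real.exp (-(f y / 2)) • ψ y
  have hφ : ContMDiff (𝓡 4) ((𝓡 4).prod 𝓘(ℝ, EuclideanSpace ℂ (Fin 2))) ∞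
      (fun y ↦ TotalSpace.mk' (EuclideanSpace ℂ (Fin 2)) y (φ y)) :=
    (contMDiff_exp_neg (hf.div_const 2)).smul_section hψ.contMDiff
  have hD (y : M) : S.dirac covp φ y = 0 :=
    (smul_eq_zero.1 (hψ.dirac_eq y)).resolve_left (Real.exp_ne_zero _)
  obtain ⟨X, hX, hXe, hb⟩ := exists_contMDiff_orthonormal (tangentBasis x)
  have hw : (fun y ↦ ‖φ y‖ ^ 2) = fun y ↦ Real.exp (-f y) * ‖ψ y‖ ^ 2 := by
    ext y
    simp only [φ, norm_smul, Real.norm_eq_abs, Real.abs_exp, mul_pow, ← Real.exp_nat_mul]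
    congr 2
    push_cast
    ring
  have hwx : ‖φ x‖ ^ 2 = Real.exp (-f x) * ‖ψ x‖ ^ 2 := congr_fun hw x
  have hw0 : 0 < ‖φ x‖ ^ 2 := by
    rw [hwx]
    have := norm_pos_iff.2 h0
    positivity
  have hdu := hx.mvfderiv_eq_zero hu
  have hdw (v : TangentSpace (𝓡 4) x) : mvfderiv (𝓡 4) (fun y ↦ ‖φ y‖ ^ 2) x v =
      -(‖φ x‖ ^ 2 * mvfderiv (𝓡 4) f x v) := by
    rw [hw, hwx, mvfderiv_fun_mul ((ha x).mdifferentiableAt (by simp))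
      ((hu x).mdifferentiableAt (by simp)), hdu]
    simp only [add_apply, smul_apply, zero_apply, smul_eq_mul, mvfderiv_exp_neg hf]
    ring
  -- In the Hessian of e^{-f}|ψ|² the cross term vanishes because |ψ|² is critical at x, and the
  -- term with the Hessian of |ψ|² has a favourable sign.
  have h1 (i) : hessianAlong (𝓡 4) (X i) (fun y ↦ ‖φ y‖ ^ 2) x ≤
      ‖φ x‖ ^ 2 * (mvfderiv (𝓡 4) f x (X i x) ^ 2 - hessianAlong (𝓡 4) (X i) f x) := by
    rw [hw, hessianAlong_mul (hX i) ha hu, hdu, hessianAlong_exp_neg (hX i) hf, hwx, zero_apply]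
    have h2 := mul_nonneg (Real.exp_nonneg (-f x)) (neg_nonneg.2 (hx.hessianAlong_nonpos hu (hX i)))
    linarith
  -- Kato's inequality: the derivative of |φ|² is both -|φ|² df and 2 Re⟨∇φ, φ⟩, so squaring and
  -- Cauchy–Schwarz give the bound after cancelling |φ|².
  have h3 (i) : ‖φ x‖ ^ 2 * mvfderiv (𝓡 4) f x (X i x) ^ 2 ≤ 4 * ‖covp φ x (X i x)‖ ^ 2 := by
    have h4 := (hc.unitary_p.hessianAlong_norm_sq hφ (hX i) x).1 (X i x)
    rw [hdw] at h4
    have h5 := (Complex.abs_re_le_norm _).trans (norm_inner_le_norm (𝕜 := ℂ) (covp φ x (X i x)) (φ x))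
    have h6 := sq_le_sq' (neg_le_of_abs_le h5) (le_of_abs_le h5)
    have h7 : ‖φ x‖ ^ 2 * (‖φ x‖ ^ 2 * mvfderiv (𝓡 4) f x (X i x) ^ 2) ≤
        ‖φ x‖ ^ 2 * (4 * ‖covp φ x (X i x)‖ ^ 2) := by
      calc _ = 4 * (inner ℂ (covp φ x (X i x)) (φ x) : ℂ).re ^ 2 := by
            linear_combination (2 * (inner ℂ (covp φ x (X i x)) (φ x) : ℂ).re -
              ‖φ x‖ ^ 2 * mvfderiv (𝓡 4) f x (X i x)) * h4
        _ ≤ 4 * (‖covp φ x (X i x)‖ * ‖φ x‖) ^ 2 := by linarith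
        _ = _ := by ring
    exact le_of_mul_le_mul_left h7 hw0
  have h8 := hc.sum_secondCovariantDerivative hψ.unitary hφ hD hX hXe hb
  -- φ is a real multiple of ψ, so ψ ⊗ ψ* - ½|ψ|² acts on it by |ψ|² - ½|ψ|² = ½|ψ|².
  have h9 : S.cliffordTwoForm x (selfDualPart o x (curvatureForm A x)) (φ x) =
      (1 / 2 * ‖φ x‖ ^ 2) • φ x := by
    have h10 : (inner ℂ (ψ x) (φ x) : ℂ) • ψ x = ‖ψ x‖ ^ 2 • φ x := by
      simp only [φ]
      rw [← Complex.coe_smul, inner_smul_right, inner_self_eq_norm_sq_to_K, mul_smul, smul_comm]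
      rw [Complex.coe_smul]
      norm_cast
    rw [hψ.curvature_eq, h10, hwx, ← sub_smul, smul_smul]
    congr 1
    ring
  have h11 : (inner ℂ (∑ i, secondCovariantDerivative covp φ (X i) x (X i x)) (φ x) : ℂ).re =
      (1 / 4 * ‖φ x‖ ^ 2 + 1 / 4 * scalarCurvature (𝓡 4) x) * ‖φ x‖ ^ 2 := by
    rw [h8, h9, smul_smul, ← add_smul, ← Complex.coe_smul, inner_smul_left, Complex.conj_ofReal,
      Complex.re_ofReal_mul]
    have h12 : (inner ℂ (φ x) (φ x) : ℂ).re = ‖φ x‖ ^ 2 := inner_self_eq_norm_sq (𝕜 := ℂ) _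
    rw [h12]
    ring
  have h13 : ∑ i, hessianAlong (𝓡 4) (X i) (fun y ↦ ‖φ y‖ ^ 2) x =
      2 * (inner ℂ (∑ i, secondCovariantDerivative covp φ (X i) x (X i x)) (φ x) : ℂ).re +
        2 * ∑ i, ‖covp φ x (X i x)‖ ^ 2 := by
    rw [sum_inner, Complex.re_sum, Finset.mul_sum, Finset.mul_sum, ← Finset.sum_add_distrib]
    exact Finset.sum_congr rfl fun i _ ↦ (hc.unitary_p.hessianAlong_norm_sq hφ (hX i) x).2
  have h14 := Finset.sum_le_sum fun i (_ : i ∈ Finset.univ) ↦ h1 i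
  have h15 := Finset.sum_le_sum fun i (_ : i ∈ Finset.univ) ↦ h3 i
  rw [← Finset.mul_sum, ← Finset.mul_sum] at h15
  rw [h13, h11, ← Finset.mul_sum, Finset.sum_sub_distrib,
    ← laplaceBeltrami_eq_sum_hessianAlong (tangentBasis x) hX hXe hf] at h14
  simp only [hXe] at h14 h15
  rw [← norm_riemannianGradient_sq (tangentBasis x) f] at h14 h15
  -- The Kato bound recovers ½|φ|²|∇f|² from 2|∇φ|². Combined with |φ|²(|∇f|² - Δf) on the other
  -- side, this is precisely R_f = R + 2Δf - |∇f|².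
  have h16 : ‖φ x‖ ^ 2 * (‖φ x‖ ^ 2 + weightedScalarCurvature (𝓡 4) f x) ≤ ‖φ x‖ ^ 2 * 0 := by
    rw [weightedScalarCurvature, weightedLaplacian, real_inner_self_eq_norm_sq]
    linarith
  have h17 := le_of_mul_le_mul_left h16 hw0
  have h18 : Real.exp (f x) * ‖φ x‖ ^ 2 = ‖ψ x‖ ^ 2 := by
    rw [hwx, ← mul_assoc, ← Real.exp_add, add_neg_cancel, Real.exp_zero, one_mul]
  have h19 := mul_le_mul_of_nonneg_left h17 (Real.exp_nonneg (f x))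
  rw [← h18]
  linarith

end SpincStructure

end Estimate

end

/-! ### The global estimate. -/

theorem mainTheorem8
    {M : Type*} [TopologicalSpace M] [ChartedSpace (EuclideanSpace ℝ (Fin 4)) M]
    [IsManifold (𝓡 4) ∞ M] [T2Space M] [CompactSpace M]
    [RiemannianBundle (fun x : M ↦ TangentSpace (𝓡 4) x)]
    [IsContMDiffRiemannianBundle (𝓡 4) ∞ (EuclideanSpace ℝ (Fin 4))
      (fun x : M ↦ TangentSpace (𝓡 4) x)]
    (o : ManifoldOrientation M)
    {Wp : M → Type*} [TopologicalSpace (TotalSpace (EuclideanSpace ℂ (Fin 2)) Wp)]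
    [∀ x, NormedAddCommGroup (Wp x)] [∀ x, InnerProductSpace ℂ (Wp x)]
    [FiberBundle (EuclideanSpace ℂ (Fin 2)) Wp] [VectorBundle ℂ (EuclideanSpace ℂ (Fin 2)) Wp]
    [VectorBundle ℝ (EuclideanSpace ℂ (Fin 2)) Wp]
    [ContMDiffVectorBundle ∞ (EuclideanSpace ℂ (Fin 2)) Wp (𝓡 4)]
    [IsSmoothHermitianBundle (EuclideanSpace ℂ (Fin 2)) Wp]
    {Wm : M → Type*} [TopologicalSpace (TotalSpace (EuclideanSpace ℂ (Fin 2)) Wm)]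
    [∀ x, NormedAddCommGroup (Wm x)] [∀ x, InnerProductSpace ℂ (Wm x)]
    [FiberBundle (EuclideanSpace ℂ (Fin 2)) Wm] [VectorBundle ℂ (EuclideanSpace ℂ (Fin 2)) Wm]
    [VectorBundle ℝ (EuclideanSpace ℂ (Fin 2)) Wm]
    [ContMDiffVectorBundle ∞ (EuclideanSpace ℂ (Fin 2)) Wm (𝓡 4)]
    [IsSmoothHermitianBundle (EuclideanSpace ℂ (Fin 2)) Wm]
    {L : M → Type*} [TopologicalSpace (TotalSpace ℂ L)]
    [∀ x, NormedAddCommGroup (L x)] [∀ x, InnerProductSpace ℂ (L x)]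
    [FiberBundle ℂ L] [VectorBundle ℂ ℂ L] [VectorBundle ℝ ℂ L]
    [ContMDiffVectorBundle ∞ ℂ L (𝓡 4)] [IsSmoothHermitianBundle ℂ L]
    (S : SpincStructure Wp Wm L o)
    (f : M → ℝ) (hf : ContMDiff (𝓡 4) 𝓘(ℝ, ℝ) ∞ f)
    (A : CovariantDerivative (𝓡 4) ℂ L)
    (covp : CovariantDerivative (𝓡 4) (EuclideanSpace ℂ (Fin 2)) Wp)
    (covm : CovariantDerivative (𝓡 4) (EuclideanSpace ℂ (Fin 2)) Wm)
    (ψ : Π x : M, Wp x)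
    (hψ : S.IsWeightedMonopole f A covp covm ψ)
    (hψ0 : ∃ x, ψ x ≠ 0) :
    ∃ p q : M,
      IsMaxOn (fun x ↦ ‖ψ x‖ ^ 2) Set.univ p ∧
      IsMinOn (fun x ↦ weightedScalarCurvature (𝓡 4) f x * Real.exp (f x)) Set.univ q ∧
      ‖ψ p‖ ^ 2 ≤ -(weightedScalarCurvature (𝓡 4) f q * Real.exp (f q)) := by
  obtain ⟨y, hy⟩ := hψ0
  have hu := hψ.contMDiff.norm_sq_hermitian
  obtain ⟨p, -, hp⟩ := isCompact_univ.exists_isMaxOn ⟨y, mem_univ y⟩ hu.continuous.continuousOn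
  obtain ⟨q, -, hq⟩ := isCompact_univ.exists_isMinOn (α := ℝ) ⟨y, mem_univ y⟩
    ((continuous_weightedScalarCurvature hf).mul
      (Real.continuous_exp.comp hf.continuous)).continuousOn
  refine ⟨p, q, hp, hq, ?_⟩
  -- This is where ψ ≢ 0 matters: the pointwise estimate divides by |φ|² at the maximum, which is
  -- positive only if ψ does not vanish identically.
  have h0 : ψ p ≠ 0 := by
    intro h
    have h1 : ‖ψ y‖ ^ 2 ≤ ‖ψ p‖ ^ 2 := hp (mem_univ y)
    rw [h, norm_zero, zero_pow two_ne_zero] at h1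
    exact absurd h1 (not_le.2 (pow_pos (norm_pos_iff.2 hy) 2))
  exact (hψ.norm_sq_le hf (hp.isLocalMax Filter.univ_mem) h0).trans (neg_le_neg (hq (mem_univ p)))
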